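/- There are an algorithm and a constant $C$ such that the following holds. The input is any finite directed graph $G=(V,E)$ with $E\subseteq V\times V$ (loops allowed), $n=|V|\ge 1$, $m=|E|$, given as a list of its edges in arbitrary order, with arbitrary real edge weights $w:E\to\mathbb{R}$, and a source $s\in V$. A path is a vertex sequence $(v_1,\dots,v_k)$, $k\ge 1$, with $(v_i,v_{i+1})\in E$ for all $i<k$ (vertices may repeat), its weight is $\sum_{i<k}w(v_i,v_{i+1})$, and a negative cycle is a path with $v_1=v_k$ and negative weight. If $G$ contains a negative cycle, the algorithm halts and reports this. Otherwise it halts, reports that there is no negative cycle, and solves the single-source shortest path problem: for each $v\in V$ it tells whether $v$ is reachable from $s$, and if so it returns the minimum weight of a path from $s$ to $v$, together with predecessor pointers that, followed back from $v$ to $s$, give a path of this minimum weight. In all cases its running time is at most $$C\cdot\max(1,n^-)\cdot\left(m+n\log n+1\right),$$ where $n^-$ is the number of vertices with at least one incoming edge of negative weight; that is, its worst-case running time is $\mathcal{O}(n^-\cdot(m+n\log n))$ whenever $n^-\ge 1$ and $n\ge 2$. Running time is the number of operations on a random access machine whose memory consists of a fixed number of integer arrays and real arrays, with unit cost for each memory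 access, each constant, increment, decrement or comparison of integers, each addition, subtraction or comparison of reals, and each elementary control step. -/

import Mathlib

namespace SSSP

/-! ### Weighted directed graphs, paths, negative cycles -/

/-- A finite directed graph on the vertex set `{0, …, n-1}` with edge set `E ⊆ V × V` (loops are
allowed) and real edge weights.  Only the values of `weight` on pairs in `edges` carry meaning. -/
structure WDigraph (n : ℕ) where
  edges : Finset (Fin n × Fin n)
  weight : Fin n → Fin n → ℝ

variable {n : ℕ}

/-- The number `m` of edges. -/
def WDigraph.numEdges (G : WDigraph n) : ℕ := G.edges.card

/-- `n⁻`: the number of vertices having at least one incoming edge of negative weight. -/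
noncomputable def WDigraph.numNegTargets (G : WDigraph n) : ℕ :=
  {v : Fin n | ∃ u, (u, v) ∈ G.edges ∧ G.weight u v < 0}.ncard

/-- `p = [v₁, …, v_k]` is a path from `u` to `v`: `v₁ = u`, `v_k = v` and every `(v_i, v_{i+1})` is
an edge.  Vertices may repeat, and `[v]` is a path from `v` to `v`. -/
def WDigraph.IsPath (G : WDigraph n) (u v : Fin n) (p : List (Fin n)) : Prop :=
  p.head? = some u ∧ p.getLast? = some v ∧ p.IsChain (fun x y => (x, y) ∈ G.edges)

/-- The weight of a path: the sum of the weights of its edges. -/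
def WDigraph.pathWeight (G : WDigraph n) : List (Fin n) → ℝ
  | [] => 0
  | [_] => 0
  | x :: y :: p => G.weight x y + G.pathWeight (y :: p)

/-- The graph contains a cycle (a path that returns to its first vertex) of negative weight. -/
def WDigraph.HasNegativeCycle (G : WDigraph n) : Prop :=
  ∃ (v : Fin n) (p : List (Fin n)), G.IsPath v v p ∧ G.pathWeight p < 0

/-- `p` is a path from `u` to `v` of minimum weight among all paths from `u` to `v`. -/
def WDigraph.IsShortestPath (G : WDigraph n) (u v : Fin n) (p : List (Fin n)) : Prop :=
  G.IsPath u v p ∧ ∀ q, G.IsPath u v q → G.pathWeight p ≤ G.pathWeight q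

/-! ### The machine: a random access machine with integer cells and real cells

The memory consists of arrays of natural numbers and arrays of real numbers; both kinds are named
by numerals occurring in the program, so a program uses a fixed finite number of arrays, and array
cells are addressed indirectly by computed natural numbers.  On natural numbers only constants,
increment, decrement and comparison are available, so that a run of cost `t` increases the largest
number in memory by at most a constant plus `t` (words of logarithmic length suffice); on reals
only addition, subtraction, the constant `0` and comparison are available.  Every operation that
is executed, including every memory access and every test of a loop, is charged. -/

/-- Memory contents: `nat a i` is cell `i` of the natural-number array `a`, and `real a i` is
cell `i` of the real array `a`. -/
structure Memory where
  nat : ℕ → ℕ → ℕ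
  real : ℕ → ℕ → ℝ

/-- Overwrite one natural-number cell. -/
def Memory.setNat (σ : Memory) (a i x : ℕ) : Memory :=
  { σ with nat := Function.update σ.nat a (Function.update (σ.nat a) i x) }

/-- Overwrite one real cell. -/
def Memory.setReal (σ : Memory) (a i : ℕ) (x : ℝ) : Memory :=
  { σ with real := Function.update σ.real a (Function.update (σ.real a) i x) }

/-- Natural-number expressions; `read a e` is the content of the cell of array `a` whose index is
the value of `e`. -/
inductive NExp where
  | lit (k : ℕ)
  | read (a : ℕ) (i : NExp)
  | succ (e : NExp)
  | pred (e : NExp)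

/-- Value of a natural-number expression (the predecessor of `0` is `0`). -/
def NExp.eval (σ : Memory) : NExp → ℕ
  | .lit k => k
  | .read a i => σ.nat a (i.eval σ)
  | .succ e => e.eval σ + 1
  | .pred e => e.eval σ - 1

/-- Cost of evaluating a natural-number expression: the number of its operations. -/
def NExp.cost : NExp → ℕ
  | .lit _ => 1
  | .read _ i => i.cost + 1
  | .succ e => e.cost + 1
  | .pred e => e.cost + 1

/-- Real expressions. -/
inductive RExp where
  | zero
  | read (a : ℕ) (i : NExp)
  | add (x y : RExp)
  | sub (x y : RExp)

/-- Value of a real expression. -/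
def RExp.eval (σ : Memory) : RExp → ℝ
  | .zero => 0
  | .read a i => σ.real a (i.eval σ)
  | .add x y => x.eval σ + y.eval σ
  | .sub x y => x.eval σ - y.eval σ

/-- Cost of evaluating a real expression. -/
def RExp.cost : RExp → ℕ
  | .zero => 1
  | .read _ i => i.cost + 1
  | .add x y => x.cost + y.cost + 1
  | .sub x y => x.cost + y.cost + 1

/-- Tests: comparisons of natural numbers and of reals, and Boolean combinations of them. -/
inductive Test where
  | natEq (x y : NExp)
  | natLt (x y : NExp)
  | realLt (x y : RExp)
  | not (b : Test)
  | and (b c : Test)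

/-- Truth of a test in a given memory. -/
def Test.Holds (σ : Memory) : Test → Prop
  | .natEq x y => x.eval σ = y.eval σ
  | .natLt x y => x.eval σ < y.eval σ
  | .realLt x y => x.eval σ < y.eval σ
  | .not b => ¬ b.Holds σ
  | .and b c => b.Holds σ ∧ c.Holds σ

/-- Cost of evaluating a test. -/
def Test.cost : Test → ℕ
  | .natEq x y => x.cost + y.cost + 1
  | .natLt x y => x.cost + y.cost + 1
  | .realLt x y => x.cost + y.cost + 1
  | .not b => b.cost + 1
  | .and b c => b.cost + c.cost + 1

/-- Programs. -/
inductive Program where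
  | skip
  | setNat (a : ℕ) (i e : NExp)
  | setReal (a : ℕ) (i : NExp) (e : RExp)
  | seq (P Q : Program)
  | ite (b : Test) (P Q : Program)
  | while (b : Test) (P : Program)

/-- `Runs P σ t τ`: started in memory `σ`, the program `P` halts with memory `τ` after a run of
total cost `t`. -/
inductive Runs : Program → Memory → ℕ → Memory → Prop
  | skip (σ : Memory) : Runs .skip σ 1 σ
  | setNat (a : ℕ) (i e : NExp) (σ : Memory) :
      Runs (.setNat a i e) σ (i.cost + e.cost + 1) (σ.setNat a (i.eval σ) (e.eval σ))
  | setReal (a : ℕ) (i : NExp) (e : RExp) (σ : Memory) :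
      Runs (.setReal a i e) σ (i.cost + e.cost + 1) (σ.setReal a (i.eval σ) (e.eval σ))
  | seq {P Q : Program} {σ τ ρ : Memory} {t u : ℕ} :
      Runs P σ t τ → Runs Q τ u ρ → Runs (.seq P Q) σ (t + u) ρ
  | iteTrue {b : Test} {P Q : Program} {σ τ : Memory} {t : ℕ} :
      b.Holds σ → Runs P σ t τ → Runs (.ite b P Q) σ (b.cost + 1 + t) τ
  | iteFalse {b : Test} {P Q : Program} {σ τ : Memory} {t : ℕ} :
      ¬ b.Holds σ → Runs Q σ t τ → Runs (.ite b P Q) σ (b.cost + 1 + t) τ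
  | whileTrue {b : Test} {P : Program} {σ τ ρ : Memory} {t u : ℕ} :
      b.Holds σ → Runs P σ t τ → Runs (.while b P) τ u ρ →
        Runs (.while b P) σ (b.cost + 1 + t + u) ρ
  | whileFalse {b : Test} {P : Program} {σ : Memory} :
      ¬ b.Holds σ → Runs (.while b P) σ (b.cost + 1) σ

/-! ### Input and output conventions of the single-source shortest path problem -/

/-- The initial memory for the graph `G` with source `s`, the edges being listed in the order
`enum`.  Natural-number array `0` holds `n`, `m`, `s`; arrays `1` and `2` hold the tails and the
heads of the edges; real array `0` holds the weights of the edges.  All other cells are `0`. -/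
def inputMemory (G : WDigraph n) (enum : Fin G.numEdges ≃ {e // e ∈ G.edges}) (s : Fin n) :
    Memory where
  nat a i :=
    if a = 0 then
      if i = 0 then n else if i = 1 then G.numEdges else if i = 2 then (s : ℕ) else 0
    else if a = 1 then
      if h : i < G.numEdges then ((enum ⟨i, h⟩).1.1 : ℕ) else 0
    else if a = 2 then
      if h : i < G.numEdges then ((enum ⟨i, h⟩).1.2 : ℕ) else 0
    else 0
  real a i :=
    if a = 0 then
      if h : i < G.numEdges then G.weight (enum ⟨i, h⟩).1.1 (enum ⟨i, h⟩).1.2 else 0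
    else 0

/-- Output, cell `0` of natural-number array `3`: `1` reports a negative cycle, `0` reports that
there is none. -/
def Memory.negCycleFlag (σ : Memory) : ℕ := σ.nat 3 0

/-- Output, natural-number array `4`: entry `v` is `1` if `v` is reachable from the source, and `0`
if it is not. -/
def Memory.reachFlag (σ : Memory) (v : Fin n) : ℕ := σ.nat 4 v

/-- Output, natural-number array `5`: the predecessor of `v` in the shortest path tree. -/
def Memory.parent (σ : Memory) (v : Fin n) : ℕ := σ.nat 5 v

/-- Output, real array `1`: the distance from the source to `v`. -/
def Memory.dist (σ : Memory) (v : Fin n) : ℝ := σ.real 1 v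

/-- The output stored in `σ` is correct for the graph `G` and the source `s`.  If `G` has a negative
cycle, this is reported.  Otherwise it is reported that there is none, every vertex that cannot be
reached from `s` is marked so, and for every other vertex `v` the predecessor pointers, followed
back from `v` to `s`, give a shortest path from `s` to `v`, whose weight is stored as the distance
of `v`. -/
def SolvesSSSP (G : WDigraph n) (s : Fin n) (σ : Memory) : Prop :=
  (G.HasNegativeCycle → σ.negCycleFlag = 1) ∧
  (¬ G.HasNegativeCycle → σ.negCycleFlag = 0 ∧ ∀ v : Fin n,
    ((¬ ∃ p, G.IsPath s v p) → σ.reachFlag v = 0) ∧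
    ((∃ p, G.IsPath s v p) → σ.reachFlag v = 1 ∧
      ∃ p, p.IsChain (fun x y => σ.parent y = (x : ℕ)) ∧
        G.IsShortestPath s v p ∧ σ.dist v = G.pathWeight p))

end SSSP

/-!
The algorithm is that of Bellman, Ford and Dijkstra, run on a priority queue with decrease-key in
constant amortised time.

Start with the potential `D = 0`, and repeat `n⁻ + 1` times: relax all edges of negative weight,
then run Dijkstra's algorithm on the edges of nonnegative weight, with all vertices in the queue at
their present values of `D`.  Throughout, every `D v` is the weight of some path ending in `v`
(`Attained`), and after `j` rounds it is a lower bound for all paths to `v` with fewer than `j`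
edges of negative weight (`BoundedBy`, `BoundedBy.succ`).  On a path without repeated vertices the
edges of negative weight have distinct heads, so that it has at most `n⁻` of them; and without
negative cycles any path can be shortened to such a path without becoming heavier.  Hence after the
last round an edge can be relaxed if and only if there is a negative cycle
(`hasNegativeCycle_iff`).  If there is none, then `D` is a feasible potential, and one more run of
Dijkstra's algorithm, from the source and with the reduced weights, gives the distances and the
predecessors (`solves_of_solved`).  Each round takes time `O(m + n log n + 1)`, and so do the
preparation and the conclusion.

The queue is a hollow heap.  To decrease a key one adds a new node for the vertex as a root; the
old node becomes hollow and keeps two of its children, the new node taking over the others.  Full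
nodes have children of all smaller ranks, and a hollow node that is not a root has at least the
first two of them, so a full node of rank `r` has at least `2 ^ (r / 2)` descendants
(`Heap.WF.exists_descendants`) and ranks are logarithmic.  The search for the minimum destroys the
hollow roots and links full roots of equal rank.  It is paid for by the potential `Heap.pot`, which
grows by a constant when a key is inserted or decreased (`Heap.WF.pot_push`) and by the rank of a
node when the node becomes hollow because its vertex leaves the queue (`Heap.WF.pot_extract`).
Altogether a run of Dijkstra's algorithm takes time `O(m + (n + 1) log (n + m))` (`runs_dijkstra`),
and `log (n + m)` is `O(1 + log n)` because `m ≤ n²`.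

A piece of code without loops is treated as the function `Program.exec` on memories, and loops are
treated by the rule `runs_while`, in which the time is paid for by a potential.

The memory is used as follows; a scalar is kept in cell `0` of an array of its own.

* Natural numbers, input and output: `0`–`2` the input, `3` the flag, `4` the labels of the
  vertices reached, `5` the predecessors.
* Graph: `6` the first edge of the adjacency list of a vertex (edge `e` is referred to as `e + 1`),
  `7` the edge that follows `e` in its list, `8` marks for the vertices with an incoming edge of
  negative weight, and the scalar `22` for their number, which afterwards counts the rounds.
* Heap: `9` the node of a vertex, `10` the vertex of a node, `11` ranks, `12` first children, `13`
  next siblings, `14` the table of ranks, and the scalars `15` (first root), `16` (number of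
  nodes), `17` (bound for the ranks in the table), `18` (best root).
* Other scalars: `19` the vertex and `20` the edge that are being processed, `21` a loop counter,
  `23` and `24` two nodes, `25` a vertex.
* Reals: `0` the given weights, `1` tentative distances, `2` working weights, `3` keys of the heap,
  `4` the potential.
-/

namespace SSSP

/-! ### Reasoning about programs -/

theorem Memory.setNat_nat (σ : Memory) (a i x b : ℕ) :
    (σ.setNat a i x).nat b = if b = a then Function.update (σ.nat a) i x else σ.nat b := by
  by_cases h : b = a
  · subst h; simp [Memory.setNat]
  · simp [Memory.setNat, h]

theorem Memory.setReal_real (σ : Memory) (a i : ℕ) (x : ℝ) (b : ℕ) :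
    (σ.setReal a i x).real b = if b = a then Function.update (σ.real a) i x else σ.real b := by
  by_cases h : b = a
  · subst h; simp [Memory.setReal]
  · simp [Memory.setReal, h]

theorem Memory.setNat_real (σ : Memory) (a i x : ℕ) : (σ.setNat a i x).real = σ.real := rfl

theorem Memory.setReal_nat (σ : Memory) (a i : ℕ) (x : ℝ) : (σ.setReal a i x).nat = σ.nat := rfl

/-- Sequential composition of a list of programs. -/
def Program.block : List Program → Program
  | [] => .skip
  | P :: l => .seq P (Program.block l)

/-- The natural-number scalar kept in cell `0` of array `a`. -/
abbrev NExp.var (a : ℕ) : NExp := .read a (.lit 0)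

/-- Assignment to the natural-number scalar kept in cell `0` of array `a`. -/
abbrev Program.assign (a : ℕ) (e : NExp) : Program := .setNat a (.lit 0) e

/-- The test that a natural-number expression is not zero. -/
abbrev Test.nonzero (e : NExp) : Test := .not (.natEq e (.lit 0))

/-- The final memory of a loop-free program; a loop is treated as if it did nothing, which is
irrelevant where `Program.loopFree` holds. -/
noncomputable def Program.exec : Program → Memory → Memory
  | .skip, σ => σ
  | .setNat a i e, σ => σ.setNat a (i.eval σ) (e.eval σ)
  | .setReal a i e, σ => σ.setReal a (i.eval σ) (e.eval σ)
  | .seq P Q, σ => Q.exec (P.exec σ)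
  | .ite b P Q, σ => open Classical in if b.Holds σ then P.exec σ else Q.exec σ
  | .while _ _, σ => σ

theorem Program.exec_seq (P Q : Program) (σ : Memory) :
    (Program.seq P Q).exec σ = Q.exec (P.exec σ) := rfl

theorem Program.exec_ite_pos {b : Test} {σ : Memory} (h : b.Holds σ) (P Q : Program) :
    (Program.ite b P Q).exec σ = P.exec σ := if_pos h

theorem Program.exec_ite_neg {b : Test} {σ : Memory} (h : ¬ b.Holds σ) (P Q : Program) :
    (Program.ite b P Q).exec σ = Q.exec σ := if_neg h

/-- The program contains no loop. -/
def Program.loopFree : Program → Bool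
  | .seq P Q => P.loopFree && Q.loopFree
  | .ite _ P Q => P.loopFree && Q.loopFree
  | .while _ _ => false
  | _ => true

/-- An upper bound for the cost of a loop-free program: the dearer branch of every conditional is
counted. -/
def Program.maxCost : Program → ℕ
  | .skip => 1
  | .setNat _ i e => i.cost + e.cost + 1
  | .setReal _ i e => i.cost + e.cost + 1
  | .seq P Q => P.maxCost + Q.maxCost
  | .ite b P Q => b.cost + 1 + max P.maxCost Q.maxCost
  | .while _ _ => 0

theorem Program.runs_exec (P : Program) (h : P.loopFree = true) (σ : Memory) :
    ∃ t, t ≤ P.maxCost ∧ Runs P σ t (P.exec σ) := by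
  induction P generalizing σ with
  | skip => exact ⟨1, le_rfl, .skip σ⟩
  | setNat a i e => exact ⟨_, le_rfl, .setNat a i e σ⟩
  | setReal a i e => exact ⟨_, le_rfl, .setReal a i e σ⟩
  | seq P Q ihP ihQ =>
    simp only [Program.loopFree, Bool.and_eq_true] at h
    obtain ⟨t, ht, h1⟩ := ihP h.1 σ
    obtain ⟨u, hu, h2⟩ := ihQ h.2 (P.exec σ)
    exact ⟨t + u, by simp only [Program.maxCost]; omega, .seq h1 h2⟩
  | ite b P Q ihP ihQ =>
    simp only [Program.loopFree, Bool.and_eq_true] at h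
    by_cases hb : b.Holds σ
    · obtain ⟨t, ht, h1⟩ := ihP h.1 σ
      refine ⟨b.cost + 1 + t, by simp only [Program.maxCost]; omega, ?_⟩
      simpa [Program.exec, hb] using Runs.iteTrue hb h1
    · obtain ⟨t, ht, h1⟩ := ihQ h.2 σ
      refine ⟨b.cost + 1 + t, by simp only [Program.maxCost]; omega, ?_⟩
      simpa [Program.exec, hb] using Runs.iteFalse hb h1
  | _ => simp [Program.loopFree] at h

/-- The natural-number arrays that a program may write. -/
def Program.natWrites : Program → List ℕ
  | .skip => []
  | .setNat a _ _ => [a]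
  | .setReal _ _ _ => []
  | .seq P Q => P.natWrites ++ Q.natWrites
  | .ite _ P Q => P.natWrites ++ Q.natWrites
  | .while _ P => P.natWrites

/-- The real arrays that a program may write. -/
def Program.realWrites : Program → List ℕ
  | .skip => []
  | .setNat _ _ _ => []
  | .setReal a _ _ => [a]
  | .seq P Q => P.realWrites ++ Q.realWrites
  | .ite _ P Q => P.realWrites ++ Q.realWrites
  | .while _ P => P.realWrites

/-- A program does not change the arrays that it does not write; the side condition is decidable, so
that such frame conditions are proved by `decide`. -/
theorem Runs.nat_eq {P : Program} {σ τ : Memory} {t : ℕ} (h : Runs P σ t τ) (a : ℕ)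
    (ha : a ∉ P.natWrites) : τ.nat a = σ.nat a := by
  induction h <;> simp_all [Program.natWrites, Memory.setNat_nat, Memory.setReal_nat]

theorem Runs.real_eq {P : Program} {σ τ : Memory} {t : ℕ} (h : Runs P σ t τ) (a : ℕ)
    (ha : a ∉ P.realWrites) : τ.real a = σ.real a := by
  induction h <;> simp_all [Program.realWrites, Memory.setReal_real, Memory.setNat_real]

/-- Amortised analysis of a loop: if every iteration, together with its test, is paid for by a
decrease of the potential `Φ` of the ghost state `g`, then the loop halts, and its total cost is
paid for by the total decrease of the potential, up to the last test. -/
theorem runs_while {α : Type*} {b : Test} {P : Program} (Inv : α → Memory → Prop) (Φ : α → ℕ)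
    (body : ∀ g σ, Inv g σ → b.Holds σ → ∃ t τ g', Runs P σ t τ ∧ Inv g' τ ∧
      b.cost + 1 + t + Φ g' ≤ Φ g) (g : α) (σ : Memory) (h : Inv g σ) :
    ∃ t τ g', Runs (.while b P) σ t τ ∧ Inv g' τ ∧ ¬ b.Holds τ ∧
      t + Φ g' ≤ Φ g + (b.cost + 1) := by
  induction hk : Φ g using Nat.strong_induction_on generalizing g σ with
  | _ k ih =>
    by_cases hb : b.Holds σ
    · obtain ⟨t, τ, g', h1, h2, h3⟩ := body g σ h hb
      obtain ⟨u, ρ, g'', h4, h5, h6, h7⟩ := ih (Φ g') (by omega) g' τ h2 rfl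
      exact ⟨_, ρ, g'', .whileTrue hb h1 h4, h5, h6, by omega⟩
    · exact ⟨_, σ, g, .whileFalse hb, h, hb, by omega⟩

/-- The loop that runs the body for `i = k - 1, …, 0`, where `i` is the scalar in array `a`. -/
def Program.countdown (a : ℕ) (k : NExp) (body : Program) : Program :=
  .seq (.assign a k) (.while (.nonzero (.var a)) (.seq (.assign a (.pred (.var a))) body))

/-- The rule for loops with a counter; `Inv i` is the situation when the values `i` and above of the
counter have been dealt with. -/
theorem runs_countdown {a : ℕ} {k : NExp} {body : Program} (Inv : ℕ → Memory → Prop) (c : ℕ)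
    (step : ∀ i σ, Inv (i + 1) σ → σ.nat a 0 = i →
      ∃ t τ, Runs body σ t τ ∧ t ≤ c ∧ Inv i τ ∧ τ.nat a 0 = i)
    (hset : ∀ i j σ, Inv i σ → Inv i (σ.setNat a 0 j)) (σ : Memory) (h : Inv (k.eval σ) σ) :
    ∃ t τ, Runs (.countdown a k body) σ t τ ∧ t ≤ (c + 20) * k.eval σ + k.cost + 20 ∧
      Inv 0 τ := by
  obtain ⟨t, τ, g', h1, h2, h3, h4⟩ := runs_while (b := .nonzero (.var a))
    (P := .seq (.assign a (.pred (.var a))) body)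
    (fun i σ => Inv i σ ∧ σ.nat a 0 = i) (fun i => (c + 20) * i) (by
      rintro g σ ⟨h1, h2⟩ h3
      obtain ⟨i, rfl⟩ : ∃ i, g = i + 1 := by
        refine ⟨g - 1, ?_⟩
        simp only [Test.Holds, NExp.eval] at h3
        omega
      obtain ⟨t, τ, h4, h5, h6, h7⟩ := step i (σ.setNat a 0 i) (hset _ _ _ h1)
        (by simp [Memory.setNat_nat])
      refine ⟨_, τ, i, .seq (u := t) (.setNat a _ _ σ) ?_, ⟨h6, h7⟩, ?_⟩
      · simpa [NExp.eval, h2] using h4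
      · simp only [Test.cost, NExp.cost]
        nlinarith) (k.eval σ) (σ.setNat a 0 (k.eval σ))
    ⟨hset _ _ _ h, by simp [Memory.setNat_nat]⟩
  refine ⟨_, τ, .seq (.setNat a _ _ σ) h1, ?_, ?_⟩
  · simp only [Test.cost, NExp.cost] at h4 ⊢
    omega
  · simp only [Test.Holds, NExp.eval] at h3
    obtain ⟨h5, h6⟩ := h2
    rw [show g' = 0 by omega] at h5
    exact h5

/-! ### Hollow heaps -/

/-- The list `[r - 1, …, 1, 0]`. -/
def descending : ℕ → List ℕ
  | 0 => []
  | r + 1 => r :: descending r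

theorem mem_descending {i r : ℕ} : i ∈ descending r ↔ i < r := by
  induction r with
  | zero => simp [descending]
  | succ r ih => simp only [descending, List.mem_cons, ih]; omega

theorem length_descending (r : ℕ) : (descending r).length = r := by
  induction r with
  | zero => rfl
  | succ r ih => simp [descending, ih]

theorem drop_two_descending (r : ℕ) : (descending r).drop 2 = descending (r - 2) := by
  rcases r with _ | _ | r <;> simp [descending]

/-- A hollow heap.  Its nodes are the numbers `1, …, size`; node `x` carries the vertex `item x`,
and `node v` is the one node that holds `v` at present (`0` if `v` is not in the queue).  All other
nodes carrying `v` are hollow.  The nodes form a forest, with `ch x` the list of the children of `x`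
and `roots` the list of the roots; while roots of equal rank are being linked, `tab r` is a
further root of rank `r` (`0` if there is none), and these ranks are below `top`. -/
structure Heap where
  rank : ℕ → ℕ
  item : ℕ → ℕ
  node : ℕ → ℕ
  tab : ℕ → ℕ
  key : ℕ → ℝ
  size : ℕ
  top : ℕ
  ch : ℕ → List ℕ
  roots : List ℕ

namespace Heap

/-- The node is not hollow. -/
def Full (h : Heap) (x : ℕ) : Prop := x ≠ 0 ∧ h.node (h.item x) = x

/-- The node belongs to the forest. -/
def Placed (h : Heap) (x : ℕ) : Prop :=
  x ∈ h.roots ∨ (x ≠ 0 ∧ ∃ r, h.tab r = x) ∨ ∃ z, x ∈ h.ch z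

/-- The invariant of hollow heaps.  A full node of rank `r` has children of ranks `r - 1, …, 0`, and
a hollow node that is not a root has at least the first two of these. -/
structure WF (h : Heap) : Prop where
  nodup_roots : h.roots.Nodup
  nodup_ch : ∀ x, (h.ch x).Nodup
  roots_ch : ∀ c x, c ∈ h.roots → c ∉ h.ch x
  ch_inj : ∀ c x y, c ∈ h.ch x → c ∈ h.ch y → x = y
  tab_roots : ∀ r, h.tab r ∉ h.roots
  tab_ch : ∀ r x, h.tab r ∉ h.ch x
  tab_rank : ∀ r, h.tab r ≠ 0 → h.rank (h.tab r) = r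
  tab_full : ∀ r, h.tab r ≠ 0 → h.Full (h.tab r)
  tab_top : ∀ r, h.tab r ≠ 0 → r < h.top
  placed_pos : ∀ x, h.Placed x → x ≠ 0 ∧ x ≤ h.size
  parent_placed : ∀ x, h.ch x ≠ [] → h.Placed x
  full_placed : ∀ x, h.Full x → h.Placed x
  item_node : ∀ v, h.node v ≠ 0 → h.item (h.node v) = v
  key_le : ∀ c x, c ∈ h.ch x → h.key x ≤ h.key c
  rank_lt : ∀ c x, c ∈ h.ch x → h.rank c < h.rank x
  full_ranks : ∀ x, h.Full x → (h.ch x).map h.rank = descending (h.rank x)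
  child_ranks : ∀ c x, c ∈ h.ch x →
    (descending (h.rank c)).take 2 <+: (h.ch c).map h.rank
  rank_zero : h.rank 0 = 0

open Classical in
/-- The number of children of a hollow node. -/
noncomputable def debt (h : Heap) (x : ℕ) : ℕ := if h.Full x then 0 else (h.ch x).length

/-- The potential that pays for the consolidation of the heap, for ranks below `L`. -/
noncomputable def pot (h : Heap) (L : ℕ) : ℕ :=
  3 * h.roots.length + 2 * ∑ r ∈ Finset.range L, (if h.tab r = 0 then 0 else 1) +
    4 * ∑ x ∈ Finset.range (h.size + 1), h.debt x

/-- Insert the vertex `v` with key `k`, or decrease its key to `k`: a new node takes over the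
children of the old node except for the first two, and the old node becomes hollow.  The node `0`,
which has no children, plays the role of the old node of a vertex that is not in the queue. -/
def push (h : Heap) (v : ℕ) (k : ℝ) : Heap where
  rank := Function.update h.rank (h.size + 1) (h.rank (h.node v) - 2)
  item := Function.update h.item (h.size + 1) v
  node := Function.update h.node v (h.size + 1)
  tab := h.tab
  key := Function.update h.key (h.size + 1) k
  size := h.size + 1
  top := h.top
  ch := Function.update (Function.update h.ch (h.node v) ((h.ch (h.node v)).take 2))
    (h.size + 1) ((h.ch (h.node v)).drop 2)
  roots := (h.size + 1) :: h.roots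

/-- Move the first root `x` to the table of ranks. -/
def store (h : Heap) (x : ℕ) (R : List ℕ) : Heap :=
  { h with
    roots := R
    tab := Function.update h.tab (h.rank x) x
    top := if h.rank x < h.top then h.top else h.rank x + 1 }

/-- Make the root `l` a child of the root `w` of the same rank. -/
def link (h : Heap) (w l : ℕ) (R : List ℕ) : Heap :=
  { h with
    roots := w :: R
    tab := Function.update h.tab (h.rank w) 0
    ch := Function.update h.ch w (l :: h.ch w)
    rank := Function.update h.rank w (h.rank w + 1) }

/-- Remove the first root, a hollow node without children. -/
def pop (h : Heap) (R : List ℕ) : Heap := { h with roots := R }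

/-- Make the first child `c` of the first root `x`, a hollow node, a root. -/
def rotate (h : Heap) (x c : ℕ) (cs R : List ℕ) : Heap :=
  { h with
    roots := c :: x :: R
    ch := Function.update h.ch x cs }

/-- Move the root of rank `i`, if there is one in the table, back to the list of the roots, where
`i` is the largest rank in question. -/
def restore (h : Heap) (i : ℕ) : Heap :=
  { h with
    top := i
    tab := Function.update h.tab i 0
    roots := if h.tab i = 0 then h.roots else h.tab i :: h.roots }

/-- Take the vertex `v` out of the queue; its node becomes hollow. -/
def extract (h : Heap) (v : ℕ) : Heap := { h with node := Function.update h.node v 0 }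

theorem WF.ch_zero {h : Heap} (hw : h.WF) : h.ch 0 = [] := by
  by_contra hc
  exact (hw.placed_pos 0 (hw.parent_placed 0 hc)).1 rfl

theorem WF.ch_of_size_lt {h : Heap} (hw : h.WF) {x : ℕ} (hx : h.size < x) : h.ch x = [] := by
  by_contra hc
  have := (hw.placed_pos x (hw.parent_placed x hc)).2
  omega

theorem WF.not_mem_ch {h : Heap} (hw : h.WF) {x : ℕ} (hx : h.size < x) (z : ℕ) : x ∉ h.ch z := by
  intro hc
  have := (hw.placed_pos x (Or.inr (Or.inr ⟨z, hc⟩))).2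
  omega

theorem WF.node_full {h : Heap} (hw : h.WF) {v : ℕ} (hv : h.node v ≠ 0) : h.Full (h.node v) :=
  ⟨hv, by rw [hw.item_node v hv]⟩

theorem WF.node_le {h : Heap} (hw : h.WF) (v : ℕ) : h.node v ≤ h.size := by
  by_cases hv : h.node v = 0
  · omega
  · exact (hw.placed_pos _ (hw.full_placed _ (hw.node_full hv))).2

/-! ### Consolidation keeps the invariant -/

theorem WF.not_placed_zero {h : Heap} (hw : h.WF) : ¬ h.Placed 0 :=
  fun h0 => (hw.placed_pos 0 h0).1 rfl

theorem WF.store {h : Heap} (hw : h.WF) {x : ℕ} {R : List ℕ} (hR : h.roots = x :: R)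
    (hx : h.Full x) (ht : h.tab (h.rank x) = 0) : (h.store x R).WF := by
  have hx0 := hx.1
  have htab : ∀ r, (h.store x R).tab r = if r = h.rank x then x else h.tab r := by
    intro r; simp [Heap.store, Function.update_apply]
  have hnR : x ∉ R ∧ R.Nodup := by
    have := hw.nodup_roots
    rwa [hR, List.nodup_cons] at this
  have hxr : x ∈ h.roots := by simp [hR]
  have hRr : ∀ z, z ∈ R → z ∈ h.roots := by intro z hz; simp [hR, hz]
  have hp : ∀ z, (h.store x R).Placed z ↔ h.Placed z := by
    intro z
    constructor
    · rintro (hz | ⟨hz0, r, hz⟩ | hz)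
      · exact Or.inl (hRr z hz)
      · rw [htab] at hz
        split_ifs at hz
        · exact Or.inl (hz ▸ hxr)
        · exact Or.inr (Or.inl ⟨hz0, r, hz⟩)
      · exact Or.inr (Or.inr hz)
    · rintro (hz | ⟨hz0, r, hz⟩ | hz)
      · rw [hR, List.mem_cons] at hz
        rcases hz with rfl | hz
        · exact Or.inr (Or.inl ⟨hx0, h.rank z, by rw [htab, if_pos rfl]⟩)
        · exact Or.inl hz
      · refine Or.inr (Or.inl ⟨hz0, r, ?_⟩)
        rw [htab, if_neg]
        · exact hz
        · rintro rfl; exact hz0 (hz.symm.trans ht)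
      · exact Or.inr (Or.inr hz)
  constructor
  case placed_pos => intro z; rw [hp]; exact hw.placed_pos z
  case parent_placed => intro z; rw [hp]; exact hw.parent_placed z
  case full_placed => intro z; rw [hp]; exact hw.full_placed z
  case nodup_roots => exact hnR.2
  case roots_ch => intro c z hc; exact hw.roots_ch c z (hRr c hc)
  case tab_roots =>
    intro r; rw [htab]
    split_ifs
    · exact hnR.1
    · exact fun h1 => hw.tab_roots r (hRr _ h1)
  case tab_ch =>
    intro r z; rw [htab]
    split_ifs
    · exact hw.roots_ch x z hxr
    · exact hw.tab_ch r z
  case tab_rank =>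
    intro r; rw [htab]
    split_ifs with hr
    · exact fun _ => hr.symm
    · exact hw.tab_rank r
  case tab_full =>
    intro r; rw [htab]
    split_ifs with hr
    · exact fun _ => hx
    · exact hw.tab_full r
  case tab_top =>
    intro r; rw [htab]
    have := hw.tab_top r
    simp only [Heap.store]
    split_ifs <;> intros <;> omega
  case nodup_ch => exact hw.nodup_ch
  case ch_inj => exact hw.ch_inj
  case item_node => exact hw.item_node
  case key_le => exact hw.key_le
  case rank_lt => exact hw.rank_lt
  case full_ranks => exact hw.full_ranks
  case child_ranks => exact hw.child_ranks
  case rank_zero => exact hw.rank_zero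

theorem WF.pop {h : Heap} (hw : h.WF) {x : ℕ} {R : List ℕ} (hR : h.roots = x :: R)
    (hx : ¬ h.Full x) (hc : h.ch x = []) : (h.pop R).WF := by
  have hnR : x ∉ R ∧ R.Nodup := by
    have := hw.nodup_roots
    rwa [hR, List.nodup_cons] at this
  have hRr : ∀ z, z ∈ R → z ∈ h.roots := by intro z hz; simp [hR, hz]
  have hp : ∀ z, (h.pop R).Placed z → h.Placed z := by
    rintro z (hz | hz | hz)
    · exact Or.inl (hRr z hz)
    · exact Or.inr (Or.inl hz)
    · exact Or.inr (Or.inr hz)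
  have hp' : ∀ z, z ≠ x → h.Placed z → (h.pop R).Placed z := by
    rintro z hzx (hz | hz | hz)
    · rw [hR, List.mem_cons] at hz
      exact Or.inl (hz.resolve_left hzx)
    · exact Or.inr (Or.inl hz)
    · exact Or.inr (Or.inr hz)
  constructor
  case placed_pos => intro z hz; exact hw.placed_pos z (hp z hz)
  case parent_placed =>
    intro z hz
    exact hp' z (by rintro rfl; exact hz hc) (hw.parent_placed z hz)
  case full_placed =>
    intro z hz
    exact hp' z (by rintro rfl; exact hx hz) (hw.full_placed z hz)
  case nodup_roots => exact hnR.2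
  case roots_ch => intro c z hc; exact hw.roots_ch c z (hRr c hc)
  case tab_roots => exact fun r h1 => hw.tab_roots r (hRr _ h1)
  case nodup_ch => exact hw.nodup_ch
  case ch_inj => exact hw.ch_inj
  case tab_ch => exact hw.tab_ch
  case tab_rank => exact hw.tab_rank
  case tab_full => exact hw.tab_full
  case tab_top => exact hw.tab_top
  case item_node => exact hw.item_node
  case key_le => exact hw.key_le
  case rank_lt => exact hw.rank_lt
  case full_ranks => exact hw.full_ranks
  case child_ranks => exact hw.child_ranks
  case rank_zero => exact hw.rank_zero

theorem WF.rotate {h : Heap} (hw : h.WF) {x c : ℕ} {cs R : List ℕ} (hR : h.roots = x :: R)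
    (hx : ¬ h.Full x) (hc : h.ch x = c :: cs) : (h.rotate x c cs R).WF := by
  have hp : ∀ z, (h.rotate x c cs R).Placed z ↔ h.Placed z := by
    intro z
    simp only [Placed, Heap.rotate, hR, Function.update_apply, List.mem_cons]
    constructor
    · grind
    · rintro (hz | hz | ⟨y, hz⟩)
      · grind
      · grind
      · by_cases hy : y = x
        · subst hy
          rw [hc] at hz
          rcases List.mem_cons.1 hz with rfl | hz
          · grind
          · exact Or.inr (Or.inr ⟨y, by simpa using hz⟩)
        · exact Or.inr (Or.inr ⟨y, by simpa [hy] using hz⟩)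
  have hm : ∀ z y, z ∈ (h.rotate x c cs R).ch y → z ∈ h.ch y := by
    intro z y
    simp only [Heap.rotate, Function.update_apply]
    split_ifs <;> grind
  have hm' : ∀ z, z ≠ x → (h.rotate x c cs R).ch z = h.ch z := by
    intro z hz
    simp [Heap.rotate, hz]
  have hcx := hw.nodup_ch x
  have hcz : ∀ z, c ∉ (h.rotate x c cs R).ch z := by
    intro z hz
    have := hm _ _ hz
    have := hw.ch_inj c x z (by grind) this
    subst this
    simp only [Heap.rotate, Function.update_self] at hz
    grind
  have hnx : ∀ z, x ∉ h.ch z := by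
    intro z
    exact hw.roots_ch x z (by grind)
  constructor
  case placed_pos => intro z; rw [hp]; exact hw.placed_pos z
  case parent_placed =>
    intro z; rw [hp]; intro hz
    refine hw.parent_placed z ?_
    intro h0
    obtain ⟨y, hy⟩ := List.exists_mem_of_ne_nil _ hz
    have := hm _ _ hy
    grind
  case full_placed => intro z; rw [hp]; exact hw.full_placed z
  case nodup_ch =>
    intro z
    by_cases hz : z = x
    · rw [hc, List.nodup_cons] at hcx
      simpa [Heap.rotate, hz] using hcx.2
    · rw [hm' z hz]; exact hw.nodup_ch z
  case nodup_roots =>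
    have h1 := hw.nodup_roots
    have h2 : c ∉ h.roots := fun h2 => hw.roots_ch c x h2 (by simp [hc])
    rw [hR] at h1 h2
    exact List.nodup_cons.2 ⟨h2, h1⟩
  case roots_ch =>
    intro d z hd hz
    simp only [Heap.rotate, List.mem_cons] at hd
    rcases hd with rfl | hd
    · exact hcz _ hz
    · exact hw.roots_ch d z (by grind) (hm _ _ hz)
  case ch_inj => intro d y z hy hz; exact hw.ch_inj d y z (hm _ _ hy) (hm _ _ hz)
  case tab_roots =>
    intro r
    have := hw.tab_roots r
    have := hw.tab_ch r x
    simp only [Heap.rotate]; grind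
  case tab_ch => intro r z hz; exact hw.tab_ch r z (hm _ _ hz)
  case tab_rank => exact hw.tab_rank
  case tab_full => exact hw.tab_full
  case tab_top => exact hw.tab_top
  case item_node => exact hw.item_node
  case key_le => intro d z hz; exact hw.key_le _ _ (hm _ _ hz)
  case rank_lt => intro d z hz; exact hw.rank_lt _ _ (hm _ _ hz)
  case full_ranks =>
    intro z hz
    have : z ≠ x := by rintro rfl; exact hx hz
    rw [hm' z this]
    exact hw.full_ranks z hz
  case child_ranks =>
    intro d z hz
    have hdz := hm _ _ hz
    have : d ≠ x := by rintro rfl; exact hnx _ hdz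
    rw [hm' d this]
    exact hw.child_ranks d z hdz
  case rank_zero => exact hw.rank_zero

theorem WF.link {h : Heap} (hw : h.WF) {x w l : ℕ} {R : List ℕ} (hR : h.roots = x :: R)
    (hx : h.Full x) (ht : h.tab (h.rank x) ≠ 0)
    (hwl : (w = x ∧ l = h.tab (h.rank x)) ∨ (w = h.tab (h.rank x) ∧ l = x))
    (hk : h.key w ≤ h.key l) : (h.link w l R).WF := by
  have hrk : h.rank w = h.rank x ∧ h.rank l = h.rank x := by
    have := hw.tab_rank _ ht
    rcases hwl with ⟨rfl, rfl⟩ | ⟨rfl, rfl⟩ <;> simp [this]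
  have hne : w ≠ l := by
    have := hw.tab_roots (h.rank x)
    grind
  have hwch : ∀ z, w ∉ h.ch z := by
    intro z; have := hw.roots_ch x z; have := hw.tab_ch (h.rank x) z; grind
  have hlch : ∀ z, l ∉ h.ch z := by
    intro z; have := hw.roots_ch x z; have := hw.tab_ch (h.rank x) z; grind
  have hnR : x ∉ R ∧ R.Nodup := by
    have := hw.nodup_roots
    rwa [hR, List.nodup_cons] at this
  have hwR : w ∉ R := by have := hw.tab_roots (h.rank x); grind
  have hlR : l ∉ R := by have := hw.tab_roots (h.rank x); grind
  have hwF : h.Full w := by have := hw.tab_full _ ht; grind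
  have hlF : h.Full l := by have := hw.tab_full _ ht; grind
  have htab : ∀ r, (h.link w l R).tab r = if r = h.rank x then 0 else h.tab r := by
    intro r; simp [Heap.link, Function.update_apply, hrk.1]
  have hch : ∀ z, (h.link w l R).ch z = if z = w then l :: h.ch w else h.ch z := by
    intro r; simp [Heap.link, Function.update_apply]
  have hrank : ∀ z, (h.link w l R).rank z = if z = w then h.rank x + 1 else h.rank z := by
    intro r; simp [Heap.link, Function.update_apply, hrk.1]
  have hmap : ∀ z, (h.ch z).map (h.link w l R).rank = (h.ch z).map h.rank := by
    intro z
    refine List.map_congr_left fun d hd => ?_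
    rw [hrank, if_neg]
    rintro rfl
    exact hwch _ hd
  have h0 := hw.not_placed_zero
  have htab' : ∀ r, r ≠ h.rank x → h.tab r ≠ w ∧ h.tab r ≠ l ∧ h.tab r ≠ x := by
    intro r hr
    by_cases hz : h.tab r = 0
    · have := hwF.1; have := hlF.1; have := hx.1; grind
    · have := hw.tab_rank r hz; grind
  have hp : ∀ z, (h.link w l R).Placed z ↔ h.Placed z := by
    intro z
    have hlw : l ∈ (h.link w l R).ch w := by simp [hch]
    have hsub : ∀ y, z ∈ h.ch y → z ∈ (h.link w l R).ch y := by
      intro y hy; rw [hch]; split_ifs with hyw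
      · subst hyw; exact List.mem_cons_of_mem _ hy
      · exact hy
    have hPw := hw.full_placed w hwF
    have hPl := hw.full_placed l hlF
    constructor
    · rintro (hz | ⟨hz0, r, hz⟩ | ⟨y, hz⟩)
      · simp only [Heap.link, List.mem_cons] at hz
        rcases hz with rfl | hz
        · exact hPw
        · exact Or.inl (by grind)
      · rw [htab] at hz
        split_ifs at hz
        · exact absurd hz.symm hz0
        · exact Or.inr (Or.inl ⟨hz0, r, hz⟩)
      · rw [hch] at hz
        split_ifs at hz
        · rcases List.mem_cons.1 hz with rfl | hz
          · exact hPl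
          · exact Or.inr (Or.inr ⟨w, hz⟩)
        · exact Or.inr (Or.inr ⟨y, hz⟩)
    · intro hz
      by_cases hzw : z = w
      · exact Or.inl (by simp [Heap.link, hzw])
      by_cases hzl : z = l
      · exact Or.inr (Or.inr ⟨w, by rw [hzl]; exact hlw⟩)
      rcases hz with hz | ⟨hz0, r, hz⟩ | ⟨y, hz⟩
      · exact Or.inl (by simp only [Heap.link]; grind)
      · refine Or.inr (Or.inl ⟨hz0, r, ?_⟩)
        rw [htab, if_neg]
        · exact hz
        · rintro rfl; grind
      · exact Or.inr (Or.inr ⟨y, hsub y hz⟩)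
  have hFull : ∀ z, (h.link w l R).Full z ↔ h.Full z := fun z => Iff.rfl
  have hroots : (h.link w l R).roots = w :: R := rfl
  have hkey : (h.link w l R).key = h.key := rfl
  constructor
  case placed_pos => intro z; rw [hp]; exact hw.placed_pos z
  case parent_placed =>
    intro z; rw [hp]; intro hz
    by_cases hzw : z = w
    · subst hzw; exact hw.full_placed _ hwF
    · rw [hch, if_neg hzw] at hz; exact hw.parent_placed z hz
  case full_placed => intro z; rw [hp]; exact hw.full_placed z
  case nodup_ch =>
    intro z
    rw [hch]
    have := hlch w
    have := hw.nodup_ch w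
    have := hw.nodup_ch z
    grind
  case nodup_roots => rw [hroots]; exact List.nodup_cons.2 ⟨hwR, hnR.2⟩
  case roots_ch =>
    intro d z; rw [hroots, hch]
    have := hw.roots_ch d z
    have := hw.roots_ch d w
    have := hwch z
    grind
  case ch_inj =>
    intro d y z
    rw [hch, hch]
    have := hw.ch_inj d y z
    have := hlch y
    have := hlch z
    grind
  case tab_roots =>
    intro r; rw [htab, hroots]
    have := hw.tab_roots r
    have := htab' r
    have h0R : 0 ∉ R := fun hz => h0 (Or.inl (by grind))
    have := hwF.1
    grind
  case tab_ch =>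
    intro r z; rw [htab, hch]
    have := hw.tab_ch r z
    have := hw.tab_ch r w
    have := htab' r
    have h0R : ∀ y, 0 ∉ h.ch y := fun y hz => h0 (Or.inr (Or.inr ⟨y, hz⟩))
    have := hlF.1
    have := h0R w
    have := h0R z
    grind
  case tab_rank =>
    intro r; rw [htab]
    split_ifs with hr
    · exact fun h => absurd rfl h
    · intro h; rw [hrank, if_neg (htab' r hr).1]; exact hw.tab_rank r h
  case tab_full =>
    intro r; rw [htab]
    split_ifs with hr
    · exact fun h => absurd rfl h
    · exact hw.tab_full r
  case tab_top =>
    intro r; rw [htab]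
    split_ifs with hr
    · exact fun h => absurd rfl h
    · exact hw.tab_top r
  case item_node => exact hw.item_node
  case key_le =>
    intro d z; rw [hch, hkey]
    have := hw.key_le d z
    have := hw.key_le d w
    grind
  case rank_lt =>
    intro d z; rw [hch, hrank, hrank]
    have := hw.rank_lt d z
    have := hw.rank_lt d w
    have := hwch z
    grind
  case full_ranks =>
    intro z hz
    rw [hch, hrank]
    split_ifs with hzw
    · rw [List.map_cons, hmap, hw.full_ranks w hwF, hrank, if_neg hne.symm, hrk.1, hrk.2,
        descending]
    · rw [hmap, hw.full_ranks z hz]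
  case child_ranks =>
    intro d z hz
    by_cases hdw : d = w
    · exfalso
      rw [hch] at hz
      have := hwch z
      have := hwch w
      grind
    rw [hrank, if_neg hdw, hch, if_neg hdw, hmap]
    rw [hch] at hz
    by_cases hdl : d = l
    · rw [hdl, hw.full_ranks l hlF]; exact List.take_prefix _ _
    · have := hw.child_ranks d z
      have := hw.child_ranks d w
      grind
  case rank_zero => rw [hrank, if_neg hwF.1.symm, hw.rank_zero]

theorem WF.restore {h : Heap} (hw : h.WF) {i : ℕ} (hi : h.top = i + 1) : (h.restore i).WF := by
  have h0 := hw.not_placed_zero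
  have h0R : 0 ∉ h.roots := fun hz => h0 (Or.inl hz)
  have h0c : ∀ y, 0 ∉ h.ch y := fun y hz => h0 (Or.inr (Or.inr ⟨y, hz⟩))
  have hroots : ∀ z, z ∈ (h.restore i).roots ↔ z ∈ h.roots ∨ (z ≠ 0 ∧ z = h.tab i) := by
    intro z; simp only [Heap.restore]; grind
  have htab : ∀ r, (h.restore i).tab r = if r = i then 0 else h.tab r := by
    intro r; simp [Heap.restore, Function.update_apply]
  have hp : ∀ z, (h.restore i).Placed z ↔ h.Placed z := by
    intro z
    simp only [Placed, hroots, htab]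
    constructor
    · rintro ((h1 | ⟨h1, h2⟩) | ⟨hz, r, h1⟩ | h1)
      · exact Or.inl h1
      · exact Or.inr (Or.inl ⟨h1, i, h2.symm⟩)
      · split_ifs at h1
        · exact absurd h1.symm hz
        · exact Or.inr (Or.inl ⟨hz, r, h1⟩)
      · exact Or.inr (Or.inr h1)
    · rintro (h1 | ⟨hz, r, h1⟩ | h1)
      · exact Or.inl (Or.inl h1)
      · by_cases hr : r = i
        · exact Or.inl (Or.inr ⟨hz, hr ▸ h1.symm⟩)
        · exact Or.inr (Or.inl ⟨hz, r, by simpa [hr] using h1⟩)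
      · exact Or.inr (Or.inr h1)
  constructor
  case placed_pos => intro z; rw [hp]; exact hw.placed_pos z
  case parent_placed => intro z; rw [hp]; exact hw.parent_placed z
  case full_placed => intro z; rw [hp]; exact hw.full_placed z
  case nodup_roots =>
    simp only [Heap.restore]
    split_ifs
    · exact hw.nodup_roots
    · exact List.nodup_cons.2 ⟨hw.tab_roots i, hw.nodup_roots⟩
  case roots_ch =>
    intro d z; rw [hroots]; have := hw.roots_ch d z; have := hw.tab_ch i z
    simp only [Heap.restore]; grind
  case tab_roots =>
    intro r
    rw [hroots, htab]
    have := hw.tab_roots r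
    by_cases hr : r = i
    · simp [hr, h0R]
    · rw [if_neg hr]
      rintro (h1 | ⟨h1, h2⟩)
      · exact this h1
      · exact hr ((hw.tab_rank r h1).symm.trans
          ((congrArg h.rank h2).trans (hw.tab_rank i (h2 ▸ h1))))
  case tab_ch =>
    intro r z
    rw [htab]
    have := hw.tab_ch r z
    have := h0c z
    simp only [Heap.restore]
    grind
  case tab_rank => intro r; rw [htab]; have := hw.tab_rank r; simp only [Heap.restore]; grind
  case tab_full =>
    intro r; rw [htab]
    split_ifs with hr
    · exact fun h => absurd rfl h
    · exact hw.tab_full r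
  case tab_top => intro r; rw [htab]; have := hw.tab_top r; simp only [Heap.restore]; grind
  case nodup_ch => exact hw.nodup_ch
  case ch_inj => exact hw.ch_inj
  case item_node => exact hw.item_node
  case key_le => exact hw.key_le
  case rank_lt => exact hw.rank_lt
  case full_ranks => exact hw.full_ranks
  case child_ranks => exact hw.child_ranks
  case rank_zero => exact hw.rank_zero

/-- The node that becomes hollow satisfies `child_ranks` whether it is a root or not, as its
children still have all the ranks below its own. -/
theorem WF.extract {h : Heap} (hw : h.WF) {v : ℕ} (ht : ∀ r, h.tab r = 0) :
    (h.extract v).WF := by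
  have hF : ∀ z, (h.extract v).Full z → h.Full z := by
    rintro z ⟨hz, hz'⟩
    refine ⟨hz, ?_⟩
    simp only [Heap.extract, Function.update_apply] at hz'
    split_ifs at hz' with h1
    · exact absurd hz'.symm hz
    · exact hz'
  constructor
  case full_placed => intro z hz; exact hw.full_placed z (hF z hz)
  case full_ranks => intro z hz; exact hw.full_ranks z (hF z hz)
  case tab_full => intro r hr; exact absurd (ht r) hr
  case item_node =>
    intro u
    have := hw.item_node u
    simp only [Heap.extract, Function.update_apply]
    grind
  case nodup_roots => exact hw.nodup_roots
  case nodup_ch => exact hw.nodup_ch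
  case roots_ch => exact hw.roots_ch
  case ch_inj => exact hw.ch_inj
  case tab_roots => exact hw.tab_roots
  case tab_ch => exact hw.tab_ch
  case tab_rank => exact hw.tab_rank
  case tab_top => exact hw.tab_top
  case placed_pos => exact hw.placed_pos
  case parent_placed => exact hw.parent_placed
  case key_le => exact hw.key_le
  case rank_lt => exact hw.rank_lt
  case child_ranks => exact hw.child_ranks
  case rank_zero => exact hw.rank_zero

/-- The new node, whose rank is smaller by two than that of the old one, takes over exactly the
children that it needs as a full node, and the old node is left with the two that it needs as a
hollow one. -/
theorem WF.push {h : Heap} (hw : h.WF) {v : ℕ} {k : ℝ} (ht : ∀ r, h.tab r = 0)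
    (hk : h.node v ≠ 0 → k ≤ h.key (h.node v)) : (h.push v k).WF := by
  have hxle := hw.node_le v
  set x := h.node v with hx
  set y := h.size + 1 with hy
  have hyx : y ≠ x := by omega
  have hnode : ∀ u, (h.push v k).node u = if u = v then y else h.node u := by
    intro u; simp [Heap.push, Function.update_apply, hy]
  have hitem : ∀ u, (h.push v k).item u = if u = y then v else h.item u := by
    intro u; simp [Heap.push, Function.update_apply, hy]
  have hkey : ∀ u, (h.push v k).key u = if u = y then k else h.key u := by
    intro u; simp [Heap.push, Function.update_apply, hy]
  have hrank : ∀ u, (h.push v k).rank u = if u = y then h.rank x - 2 else h.rank u := by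
    intro u; simp [Heap.push, Function.update_apply, hy, hx]
  have hch : ∀ u, (h.push v k).ch u =
      if u = y then (h.ch x).drop 2 else if u = x then (h.ch x).take 2 else h.ch u := by
    intro u; simp [Heap.push, Function.update_apply, hy, hx]
  have hroots : (h.push v k).roots = y :: h.roots := rfl
  have htab : (h.push v k).tab = h.tab := rfl
  have hsize : (h.push v k).size = y := rfl
  have hchy : ∀ z, y ∉ h.ch z := hw.not_mem_ch (by omega)
  have hcy : h.ch y = [] := hw.ch_of_size_lt (by omega)
  have hnodup := hw.nodup_ch x
  have htd : (h.ch x).take 2 ++ (h.ch x).drop 2 = h.ch x := List.take_append_drop 2 _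
  have hmem : ∀ c z, c ∈ (h.push v k).ch z → c ∈ h.ch (if z = y then x else z) := by
    intro c z
    rw [hch]
    split_ifs with h1 h2
    · exact fun h => List.mem_of_mem_drop h
    · subst h2; exact fun h => List.mem_of_mem_take h
    · exact id
  have hmem' : ∀ c z, c ∈ h.ch z → ∃ z', c ∈ (h.push v k).ch z' := by
    intro c z hc
    by_cases hzx : z = x
    · subst hzx
      rw [← htd, List.mem_append] at hc
      rcases hc with hc | hc
      · exact ⟨x, by rw [hch, if_neg hyx.symm, if_pos rfl]; exact hc⟩
      · exact ⟨y, by rw [hch, if_pos rfl]; exact hc⟩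
    · exact ⟨z, by rw [hch, if_neg, if_neg hzx]; exact hc; rintro rfl; simp [hcy] at hc⟩
  have hp : ∀ z, (h.push v k).Placed z ↔ z = y ∨ h.Placed z := by
    intro z
    simp only [Placed, hroots, htab, List.mem_cons, ht]
    constructor
    · rintro ((h | h) | ⟨h, r, h'⟩ | ⟨u, h⟩)
      · exact Or.inl h
      · exact Or.inr (Or.inl h)
      · exact absurd h'.symm h
      · exact Or.inr (Or.inr (Or.inr ⟨_, hmem _ _ h⟩))
    · rintro (h | h | ⟨h, r, h'⟩ | ⟨u, h⟩)
      · exact Or.inl (Or.inl h)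
      · exact Or.inl (Or.inr h)
      · exact absurd h'.symm h
      · exact Or.inr (Or.inr (hmem' _ _ h))
  have hF : ∀ z, (h.push v k).Full z → z = y ∨ (h.Full z ∧ z ≠ x ∧ z ≠ y) := by
    rintro z ⟨hz, hz'⟩
    by_cases hzy : z = y
    · exact Or.inl hzy
    rw [hitem, if_neg hzy, hnode] at hz'
    split_ifs at hz' with h1
    · exact absurd hz'.symm hzy
    · refine Or.inr ⟨⟨hz, hz'⟩, ?_, hzy⟩
      rintro rfl
      exact h1 (hw.item_node v hz)
  have hmap : ∀ z, (h.ch z).map (h.push v k).rank = (h.ch z).map h.rank := by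
    intro z
    refine List.map_congr_left fun d hd => ?_
    rw [hrank, if_neg]
    rintro rfl
    exact hchy _ hd
  have hranks : (h.ch x).map h.rank = descending (h.rank x) := by
    by_cases hx0 : x = 0
    · rw [hx0, hw.ch_zero, hw.rank_zero]; rfl
    · exact hw.full_ranks x (hw.node_full hx0)
  constructor
  case placed_pos =>
    intro z; rw [hp, hsize]
    rintro (h | h)
    · omega
    · have := hw.placed_pos z h; omega
  case parent_placed =>
    intro z hz; rw [hp]
    by_cases hzy : z = y
    · exact Or.inl hzy
    · obtain ⟨c, hc⟩ := List.exists_mem_of_ne_nil _ hz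
      have := hmem _ _ hc
      rw [if_neg hzy] at this
      exact Or.inr (hw.parent_placed z (List.ne_nil_of_mem this))
  case full_placed =>
    intro z hz; rw [hp]
    rcases hF z hz with h | h
    · exact Or.inl h
    · exact Or.inr (hw.full_placed z h.1)
  case nodup_roots =>
    rw [hroots, List.nodup_cons]
    refine ⟨fun hm => ?_, hw.nodup_roots⟩
    have := hw.placed_pos y (Or.inl hm)
    omega
  case nodup_ch =>
    intro z; rw [hch]
    split_ifs
    · exact hnodup.sublist (List.drop_sublist _ _)
    · exact hnodup.sublist (List.take_sublist _ _)
    · exact hw.nodup_ch z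
  case roots_ch =>
    intro c z hc hz
    have := hmem _ _ hz
    rw [hroots, List.mem_cons] at hc
    rcases hc with rfl | hc
    · exact hchy _ this
    · exact hw.roots_ch _ _ hc this
  case ch_inj =>
    intro c a b ha hb
    have h1 := hmem _ _ ha
    have h2 := hmem _ _ hb
    have h3 := hw.ch_inj _ _ _ h1 h2
    have h4 : ∀ c, c ∈ (h.ch x).take 2 → c ∈ (h.ch x).drop 2 → False := by
      intro c h1 h2
      rw [← htd, List.nodup_append] at hnodup
      exact hnodup.2.2 c h1 c h2 rfl
    rw [hch] at ha hb
    have := h4 c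
    grind
  case tab_roots =>
    intro r; rw [htab, hroots, ht]
    intro h0
    rcases List.mem_cons.1 h0 with h0 | h0
    · omega
    · exact (hw.placed_pos 0 (Or.inl h0)).1 rfl
  case tab_ch =>
    intro r z hz; rw [htab, ht] at hz
    exact (hw.placed_pos 0 (Or.inr (Or.inr ⟨_, hmem _ _ hz⟩))).1 rfl
  case tab_rank => intro r hr; exact absurd (ht r) hr
  case tab_full => intro r hr; exact absurd (ht r) hr
  case tab_top => intro r hr; exact absurd (ht r) hr
  case item_node =>
    intro u; rw [hnode]
    split_ifs with huv
    · intro; rw [hitem, if_pos rfl, huv]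
    · intro hu; rw [hitem, if_neg]
      · exact hw.item_node u hu
      · have := hw.node_le u; omega
  case key_le =>
    intro c z hc
    have h1 := hmem _ _ hc
    rw [hkey, hkey, if_neg (show c ≠ y by rintro rfl; exact hchy _ h1)]
    split_ifs with hzy
    · rw [if_pos hzy] at h1
      refine le_trans (hk ?_) (hw.key_le _ _ h1)
      intro h0
      rw [h0, hw.ch_zero] at h1
      simp at h1
    · rw [if_neg hzy] at h1
      exact hw.key_le _ _ h1
  case rank_lt =>
    intro c z hc
    have h1 := hmem _ _ hc
    rw [hrank, hrank, if_neg (show c ≠ y by rintro rfl; exact hchy _ h1)]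
    split_ifs with hzy
    · rw [hch, if_pos hzy] at hc
      have := List.mem_map_of_mem (f := h.rank) hc
      rw [List.map_drop, hranks, drop_two_descending] at this
      exact mem_descending.1 this
    · rw [if_neg hzy] at h1
      exact hw.rank_lt _ _ h1
  case full_ranks =>
    intro z hz
    rcases hF z hz with rfl | ⟨h1, h2, h3⟩
    · rw [hch, if_pos rfl, hrank, if_pos rfl, List.map_drop, hmap, hranks, drop_two_descending]
    · rw [hch, if_neg h3, if_neg h2, hmap, hrank, if_neg h3, hw.full_ranks z h1]
  case child_ranks =>
    intro c z hc
    have h1 := hmem _ _ hc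
    have hcy' : c ≠ y := by rintro rfl; exact hchy _ h1
    rw [hrank, if_neg hcy', hch, if_neg hcy']
    split_ifs with hcx
    · rw [List.map_take, hmap, hranks, hcx]
    · rw [hmap]
      exact hw.child_ranks _ _ h1
  case rank_zero => rw [hrank, if_neg (by omega), hw.rank_zero]

end Heap

/-! ### Ranks are logarithmic, and a root has the smallest key -/

theorem sum_le_sum_add {s : Finset ℕ} {f g : ℕ → ℕ} (a c : ℕ)
    (h : ∀ x ∈ s, x ≠ a → g x ≤ f x) (ha : g a ≤ f a + c) :
    ∑ x ∈ s, g x ≤ ∑ x ∈ s, f x + c := by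
  calc ∑ x ∈ s, g x ≤ ∑ x ∈ s, (f x + if x = a then c else 0) := by
        refine Finset.sum_le_sum fun x hx => ?_
        split_ifs with hxa
        · rw [hxa]; exact ha
        · exact h x hx hxa
    _ ≤ ∑ x ∈ s, f x + c := by
        rw [Finset.sum_add_distrib, Finset.sum_ite_eq']
        split_ifs <;> omega

theorem sum_add_le_sum {s : Finset ℕ} {f g : ℕ → ℕ} (a c : ℕ) (has : a ∈ s)
    (h : ∀ x ∈ s, x ≠ a → g x ≤ f x) (ha : g a + c ≤ f a) :
    ∑ x ∈ s, g x + c ≤ ∑ x ∈ s, f x := by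
  calc ∑ x ∈ s, g x + c = ∑ x ∈ s, (g x + if x = a then c else 0) := by
        rw [Finset.sum_add_distrib, Finset.sum_ite_eq', if_pos has]
    _ ≤ ∑ x ∈ s, f x := by
        refine Finset.sum_le_sum fun x hx => ?_
        split_ifs with hxa
        · rw [hxa]; exact ha
        · exact h x hx hxa

namespace Heap

/-- Node `y` is a descendant of node `x`, or equal to it. -/
def Below (h : Heap) (x y : ℕ) : Prop := Relation.ReflTransGen (fun a b => b ∈ h.ch a) x y

theorem WF.rank_le_of_below {h : Heap} (hw : h.WF) {x y : ℕ} (hxy : h.Below x y) :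
    h.rank y ≤ h.rank x := by
  induction hxy with
  | refl => exact le_rfl
  | tail _ hc ih => exact (hw.rank_lt _ _ hc).le.trans ih

theorem WF.not_below_of_siblings {h : Heap} (hw : h.WF) {x c d : ℕ} (hc : c ∈ h.ch x)
    (hd : d ∈ h.ch x) (hcd : c ≠ d) : ¬ h.Below c d := by
  intro hb
  rcases Relation.ReflTransGen.cases_tail hb with rfl | ⟨z, hz, hdz⟩
  · exact hcd rfl
  · rw [hw.ch_inj _ _ _ hdz hd] at hz
    have := hw.rank_le_of_below hz
    have := hw.rank_lt _ _ hc
    omega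

theorem WF.below_total {h : Heap} (hw : h.WF) {c d y : ℕ} (hc : h.Below c y) (hd : h.Below d y) :
    h.Below c d ∨ h.Below d c := by
  have hu : Relator.RightUnique (Function.swap (fun a b => b ∈ h.ch a)) :=
    fun _ _ _ h1 h2 => hw.ch_inj _ _ _ h1 h2
  have h1 := Relation.reflTransGen_swap.2 hc
  have h2 := Relation.reflTransGen_swap.2 hd
  rcases Relation.ReflTransGen.total_of_right_unique hu h1 h2 with h3 | h3
  · exact Or.inr (Relation.reflTransGen_swap.1 h3)
  · exact Or.inl (Relation.reflTransGen_swap.1 h3)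

/-- A node that has its first two children, and is not a hollow root, has exponentially many
descendants in its rank. -/
theorem WF.exists_descendants {h : Heap} (hw : h.WF) (x : ℕ) (hx : h.Placed x)
    (hr : (descending (h.rank x)).take 2 <+: (h.ch x).map h.rank) :
    ∃ S : Finset ℕ, 2 ^ (h.rank x / 2) ≤ S.card ∧
      ∀ y ∈ S, y ∈ Finset.Icc 1 h.size ∧ h.Below x y := by
  induction hk : h.rank x using Nat.strong_induction_on generalizing x with
  | _ k ih =>
    have hself : x ∈ Finset.Icc 1 h.size := by
      have := hw.placed_pos x hx
      rw [Finset.mem_Icc]; omega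
    -- With `a r` the least number of descendants, `a (r + 2) ≥ a (r + 1) + a r ≥ 2 * a r`.
    rcases k with _ | _ | r
    · exact ⟨{x}, by simp, by simpa using ⟨by simpa using hself, .refl⟩⟩
    · exact ⟨{x}, by simp, by simpa using ⟨by simpa using hself, .refl⟩⟩
    rw [hk] at hr
    obtain ⟨c, d, l, hl, hc, hd⟩ : ∃ c d l, h.ch x = c :: d :: l ∧ h.rank c = r + 1 ∧
        h.rank d = r := by
      rcases hch : h.ch x with _ | ⟨c, _ | ⟨d, l⟩⟩
      · simp [hch, descending] at hr
      · simp [hch, descending, List.cons_prefix_cons] at hr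
      · simp only [hch, descending, List.take_succ_cons, List.take_zero, List.map_cons,
          List.cons_prefix_cons] at hr
        exact ⟨c, d, l, rfl, hr.1.symm, hr.2.1.symm⟩
    have hcx : c ∈ h.ch x := by simp [hl]
    have hdx : d ∈ h.ch x := by simp [hl]
    obtain ⟨S, hS, hS'⟩ := ih (r + 1) (by omega) c (Or.inr (Or.inr ⟨x, hcx⟩))
      (hw.child_ranks _ _ hcx) hc
    obtain ⟨T, hT, hT'⟩ := ih r (by omega) d (Or.inr (Or.inr ⟨x, hdx⟩))
      (hw.child_ranks _ _ hdx) hd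
    have hcd : c ≠ d := by rintro rfl; omega
    have hdisj : Disjoint S T := by
      rw [Finset.disjoint_left]
      intro y hy hy'
      rcases hw.below_total (hS' y hy).2 (hT' y hy').2 with h1 | h1
      · exact hw.not_below_of_siblings hcx hdx hcd h1
      · exact hw.not_below_of_siblings hdx hcx hcd.symm h1
    refine ⟨S ∪ T, ?_, ?_⟩
    · rw [Finset.card_union_of_disjoint hdisj]
      have h1 : 2 ^ (r / 2) ≤ 2 ^ ((r + 1) / 2) := Nat.pow_le_pow_right (by omega) (by omega)
      have h2 : (r + 1 + 1) / 2 = r / 2 + 1 := by omega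
      rw [h2, pow_succ]
      omega
    · intro y hy
      rcases Finset.mem_union.1 hy with hy | hy
      · exact ⟨(hS' y hy).1, .head hcx (hS' y hy).2⟩
      · exact ⟨(hT' y hy).1, .head hdx (hT' y hy).2⟩

/-- The nodes of rank `r` have at least `2 ^ (r / 2)` descendants, and there are only `size`
nodes. -/
theorem WF.full_rank_lt {h : Heap} (hw : h.WF) {x N : ℕ} (hx : h.Full x) (hN : h.size ≤ N) :
    h.rank x < 2 * Nat.log 2 N + 2 := by
  obtain ⟨S, hS, hS'⟩ := hw.exists_descendants x (hw.full_placed x hx)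
    (by rw [hw.full_ranks x hx]; exact List.take_prefix _ _)
  have h1 : S.card ≤ h.size := by
    calc S.card ≤ (Finset.Icc 1 h.size).card := Finset.card_le_card fun y hy => (hS' y hy).1
      _ = h.size := by simp
  have h2 : h.rank x / 2 ≤ Nat.log 2 N := Nat.le_log_of_pow_le (by omega) (by omega)
  omega

/-- The key of a node is at least the key of some root. -/
theorem WF.exists_root_le {h : Heap} (hw : h.WF) (x : ℕ) (hx : h.Placed x) :
    ∃ y, (y ∈ h.roots ∨ ∃ r, h.tab r ≠ 0 ∧ h.tab r = y) ∧ h.key y ≤ h.key x := by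
  obtain ⟨M, hM⟩ : ∃ M, ∀ y, h.Placed y → h.rank y ≤ M := by
    refine ⟨(Finset.range (h.size + 1)).sup h.rank, fun y hy => Finset.le_sup (f := h.rank) ?_⟩
    have := hw.placed_pos y hy
    rw [Finset.mem_range]; omega
  -- Ranks increase, and keys do not, on the way from a node to its root.
  induction hk : M - h.rank x using Nat.strong_induction_on generalizing x with
  | _ k ih =>
    rcases hx with hx | ⟨hx, r, hr⟩ | ⟨z, hz⟩
    · exact ⟨x, Or.inl hx, le_rfl⟩
    · exact ⟨x, Or.inr ⟨r, by rwa [hr], hr⟩, le_rfl⟩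
    · have hpz := hw.parent_placed z (List.ne_nil_of_mem hz)
      have h1 := hw.rank_lt _ _ hz
      have h2 := hM z hpz
      obtain ⟨y, hy, hy'⟩ := ih (M - h.rank z) (by omega) z hpz rfl
      exact ⟨y, hy, hy'.trans (hw.key_le _ _ hz)⟩

/-! ### The potential -/

theorem pot_store {h : Heap} {x : ℕ} (L : ℕ) {R : List ℕ} (hR : h.roots = x :: R)
    (ht : h.tab (h.rank x) = 0) :
    (h.store x R).pot L + 1 ≤ h.pot L := by
  have h1 := sum_le_sum_add (s := Finset.range L) (f := fun r => if h.tab r = 0 then 0 else 1)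
    (g := fun r => if (h.store x R).tab r = 0 then 0 else 1) (h.rank x) 1
    (by intro r _ hr; simp [Heap.store, hr]) (by split_ifs <;> omega)
  have h2 : (h.store x R).debt = h.debt := rfl
  simp only [pot, h2, hR, List.length_cons]
  simp only [Heap.store] at h1 ⊢
  omega

/-- The table loses an entry, which releases `2`, while the number of roots in the list is
unchanged. -/
theorem pot_link {h : Heap} {x w l L : ℕ} {R : List ℕ} (hR : h.roots = x :: R)
    (hL : h.rank w < L) (ht : h.tab (h.rank w) ≠ 0) (hw : h.Full w) :
    (h.link w l R).pot L + 2 ≤ h.pot L := by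
  have htab : ∀ r, (h.link w l R).tab r = if r = h.rank w then 0 else h.tab r := by
    intro r; simp [Heap.link, Function.update_apply]
  have h1 := sum_add_le_sum (s := Finset.range L) (f := fun r => if h.tab r = 0 then 0 else 1)
    (g := fun r => if (h.link w l R).tab r = 0 then 0 else 1) (h.rank w) 1 (Finset.mem_range.2 hL)
    (by intro r _ hr; simp only [htab, if_neg hr]; exact le_rfl) (by simp [htab, ht])
  have h2 : (h.link w l R).debt = h.debt := by
    funext z
    have h3 : ∀ z, (h.link w l R).Full z ↔ h.Full z := fun z => Iff.rfl
    by_cases hz : z = w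
    · rw [debt, debt, if_pos ((h3 z).2 (hz ▸ hw)), if_pos (hz ▸ hw)]
    · have h4 : (h.link w l R).ch z = h.ch z := by simp [Heap.link, hz]
      unfold debt
      rw [h4]
      by_cases hf : h.Full z
      · rw [if_pos ((h3 z).2 hf), if_pos hf]
      · rw [if_neg (mt (h3 z).1 hf), if_neg hf]
  have h3 : (h.link w l R).roots = w :: R := rfl
  have h4 : (h.link w l R).size = h.size := rfl
  unfold pot
  rw [h2, h3, h4, hR, List.length_cons, List.length_cons]
  omega

theorem pot_pop {h : Heap} {x : ℕ} (L : ℕ) {R : List ℕ} (hR : h.roots = x :: R) :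
    (h.pop R).pot L + 3 ≤ h.pot L := by
  have h2 : (h.pop R).debt = h.debt := rfl
  have h3 : (h.pop R).tab = h.tab := rfl
  have h4 : (h.pop R).roots = R := rfl
  have h5 : (h.pop R).size = h.size := rfl
  unfold pot
  rw [h2, h3, h4, h5, hR, List.length_cons]
  omega

/-- The new root costs `3`, but a hollow node loses a child, which releases `4`. -/
theorem pot_rotate {h : Heap} {x c : ℕ} (L : ℕ) {cs R : List ℕ} (hR : h.roots = x :: R)
    (hx : ¬ h.Full x) (hc : h.ch x = c :: cs) (hs : x ≤ h.size) :
    (h.rotate x c cs R).pot L + 1 ≤ h.pot L := by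
  have hF : ∀ r, (h.rotate x c cs R).Full r ↔ h.Full r := fun r => Iff.rfl
  have hch : ∀ r, (h.rotate x c cs R).ch r = if r = x then cs else h.ch r := by
    intro r; simp [Heap.rotate, Function.update_apply]
  have h1 := sum_add_le_sum (s := Finset.range (h.size + 1)) (f := h.debt)
    (g := (h.rotate x c cs R).debt) x 1 (Finset.mem_range.2 (by omega))
    (by intro r _ hr; simp only [debt, hF, hch, if_neg hr]; exact le_rfl)
    (by simp [debt, hF, hch, hx, hc])
  have h2 : (h.rotate x c cs R).roots = c :: x :: R := rfl
  have h3 : (h.rotate x c cs R).tab = h.tab := rfl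
  have h4 : (h.rotate x c cs R).size = h.size := rfl
  simp only [pot, hR, h2, h3, h4, List.length_cons]
  omega

theorem pot_restore {h : Heap} (i L : ℕ) (hL : i < L) :
    (h.restore i).pot L ≤ h.pot L + 1 := by
  have h2 : (h.restore i).debt = h.debt := rfl
  by_cases hi : h.tab i = 0
  · have h1 : (h.restore i).tab = h.tab := by
      simp only [Heap.restore]; rw [← hi]; simp
    simp only [pot, h2, h1]
    simp [Heap.restore, hi]
  · have h1 := sum_add_le_sum (s := Finset.range L) (f := fun r => if h.tab r = 0 then 0 else 1)
      (g := fun r => if (h.restore i).tab r = 0 then 0 else 1) i 1 (Finset.mem_range.2 hL)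
      (by intro r _ hr; simp [Heap.restore, hr]) (by simp [Heap.restore, hi])
    simp only [pot, h2]
    simp only [Heap.restore, hi, if_false, List.length_cons] at h1 ⊢
    omega

/-- Only the node of `v` becomes hollow, and a full node has as many children as its rank says. -/
theorem WF.pot_extract {h : Heap} (hw : h.WF) {v : ℕ} (L : ℕ) (hv : h.node v ≠ 0) :
    (h.extract v).pot L ≤ h.pot L + 4 * h.rank (h.node v) := by
  have hF : ∀ z, z ≠ h.node v → h.Full z → (h.extract v).Full z := by
    rintro z hz ⟨h1, h2⟩
    refine ⟨h1, ?_⟩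
    simp only [Heap.extract]
    rw [Function.update_of_ne, h2]
    rintro h3
    rw [h3] at h2
    exact hz h2.symm
  have h1 := sum_le_sum_add (s := Finset.range (h.size + 1)) (f := h.debt)
    (g := (h.extract v).debt) (h.node v) (h.rank (h.node v))
    (by
      intro z _ hz
      have := hF z hz
      have h3 : (h.extract v).ch = h.ch := rfl
      simp only [debt, h3]
      split_ifs <;> first | omega | tauto)
    (by
      have h4 : (h.ch (h.node v)).length = h.rank (h.node v) := by
        rw [← List.length_map (f := h.rank), hw.full_ranks _ (hw.node_full hv), length_descending]
      have h3 : (h.extract v).ch = h.ch := rfl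
      simp only [debt, h3, h4]
      split_ifs <;> omega)
  simp only [pot]
  have h5 : (h.extract v).size = h.size := rfl
  have h6 : (h.extract v).roots = h.roots := rfl
  have h7 : (h.extract v).tab = h.tab := rfl
  rw [h5, h6, h7]
  omega

/-- A new root costs `3`, and the old node, having become hollow, has at most two children. -/
theorem WF.pot_push {h : Heap} (hw : h.WF) (v : ℕ) (k : ℝ) (L : ℕ) :
    (h.push v k).pot L ≤ h.pot L + 11 := by
  have hxle := hw.node_le v
  have hF : ∀ z, z ≠ h.node v → z ≠ h.size + 1 → h.Full z → (h.push v k).Full z := by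
    rintro z hz hz' ⟨h1, h2⟩
    refine ⟨h1, ?_⟩
    simp only [Heap.push]
    rw [Function.update_of_ne hz', Function.update_of_ne, h2]
    rintro h3
    rw [h3] at h2
    exact hz h2.symm
  have h1 := sum_le_sum_add (s := Finset.range (h.size + 1)) (f := h.debt)
    (g := (h.push v k).debt) (h.node v) 2
    (by
      intro z hz hzv
      have hz' : z ≠ h.size + 1 := by rw [Finset.mem_range] at hz; omega
      have := hF z hzv hz'
      have h3 : (h.push v k).ch z = h.ch z := by
        simp only [Heap.push]; rw [Function.update_of_ne hz', Function.update_of_ne hzv]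
      simp only [debt, h3]
      split_ifs <;> first | omega | tauto)
    (by
      have h3 : (h.push v k).ch (h.node v) = (h.ch (h.node v)).take 2 := by
        simp only [Heap.push]; rw [Function.update_of_ne (by omega), Function.update_self]
      simp only [debt, h3, List.length_take]
      split_ifs <;> omega)
  have h2 : (h.push v k).debt (h.size + 1) = 0 := by
    have : (h.push v k).Full (h.size + 1) := ⟨by omega, by simp [Heap.push]⟩
    simp [debt, this]
  simp only [pot]
  have h5 : (h.push v k).size = h.size + 1 := rfl
  have h6 : (h.push v k).roots = (h.size + 1) :: h.roots := rfl
  have h7 : (h.push v k).tab = h.tab := rfl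
  rw [h5, h6, h7, Finset.sum_range_succ _ (h.size + 1), h2, List.length_cons]
  omega

end Heap

/-! ### Hollow heaps in memory -/

/-- Starting from `p` and following the pointers `nxt` up to the null pointer `0` one meets exactly
the elements of the list. -/
def Seg (nxt : ℕ → ℕ) : ℕ → List ℕ → Prop
  | p, [] => p = 0
  | p, a :: l => p = a ∧ a ≠ 0 ∧ Seg nxt (nxt a) l

theorem Seg.congr {nxt nxt' : ℕ → ℕ} {p : ℕ} {l : List ℕ} (h : Seg nxt p l)
    (heq : ∀ a ∈ l, nxt' a = nxt a) : Seg nxt' p l := by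
  induction l generalizing p with
  | nil => exact h
  | cons a l ih =>
    refine ⟨h.1, h.2.1, ?_⟩
    rw [heq a (by simp)]
    exact ih h.2.2 fun b hb => heq b (by simp [hb])

theorem Seg.update {nxt : ℕ → ℕ} {p : ℕ} {l : List ℕ} (h : Seg nxt p l) {a : ℕ} (ha : a ∉ l)
    (v : ℕ) : Seg (Function.update nxt a v) p l :=
  h.congr fun b hb => Function.update_of_ne (by rintro rfl; exact ha hb) _ _

theorem Seg.eq_zero_iff {nxt : ℕ → ℕ} {p : ℕ} {l : List ℕ} (h : Seg nxt p l) :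
    p = 0 ↔ l = [] := by
  cases l with
  | nil => simpa [Seg] using h
  | cons a l => obtain ⟨rfl, h0, _⟩ := h; simpa using h0

/-- The memory holds the heap `h`: child lists and the list of the roots are linked by the pointers
in array `13`, their first elements being in array `12` and in the scalar `15`. -/
structure Rep (σ : Memory) (h : Heap) : Prop where
  node : σ.nat 9 = h.node
  item : σ.nat 10 = h.item
  rank : σ.nat 11 = h.rank
  tab : σ.nat 14 = h.tab
  key : σ.real 3 = h.key
  size : σ.nat 16 0 = h.size
  top : σ.nat 17 0 = h.top
  roots : Seg (σ.nat 13) (σ.nat 15 0) h.roots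
  ch : ∀ x, Seg (σ.nat 13) (σ.nat 12 x) (h.ch x)
  null : σ.nat 13 0 = 0

/-- Push the vertex in the scalar `25`, with the key in real array `1`.  With the old node in the
scalar `23`, the scalar `24` is its second child.  If there is no such child, or no old node, then
the null pointer `0` is followed and its cell in array `13` is overwritten by `0`, which is what it
contains in any case. -/
def pushProg : Program := .block [
  .assign 16 (.succ (.var 16)),
  .assign 23 (.read 9 (.var 25)),
  .assign 24 (.read 13 (.read 12 (.var 23))),
  .setNat 10 (.var 16) (.var 25),
  .setReal 3 (.var 16) (.read 1 (.var 25)),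
  .setNat 11 (.var 16) (.pred (.pred (.read 11 (.var 23)))),
  .setNat 12 (.var 16) (.read 13 (.var 24)),
  .setNat 13 (.var 24) (.lit 0),
  .setNat 13 (.var 16) (.var 15),
  .assign 15 (.var 16),
  .setNat 9 (.var 25) (.var 16)]

/-- One step of the consolidation, which deals with the first root: a full root is moved to the
table of ranks or, if its place there is taken, linked with the root found there; a hollow root is
removed, or has its first child made a root. -/
def stepProg : Program := .block [
  .assign 23 (.var 15),
  .ite (.natEq (.read 9 (.read 10 (.var 23))) (.var 23))
    (.ite (.natEq (.read 14 (.read 11 (.var 23))) (.lit 0))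
      (.block [
        .assign 15 (.read 13 (.var 23)),
        .setNat 14 (.read 11 (.var 23)) (.var 23),
        .ite (.natLt (.read 11 (.var 23)) (.var 17)) .skip
          (.assign 17 (.succ (.read 11 (.var 23))))])
      (.block [
        .assign 24 (.read 14 (.read 11 (.var 23))),
        .setNat 14 (.read 11 (.var 23)) (.lit 0),
        .ite (.realLt (.read 3 (.var 24)) (.read 3 (.var 23)))
          (.block [
            .setNat 13 (.var 24) (.read 13 (.var 23)),
            .setNat 13 (.var 23) (.read 12 (.var 24)),
            .setNat 12 (.var 24) (.var 23),
            .setNat 11 (.var 24) (.succ (.read 11 (.var 24))),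
            .assign 15 (.var 24)])
          (.block [
            .setNat 13 (.var 24) (.read 12 (.var 23)),
            .setNat 12 (.var 23) (.var 24),
            .setNat 11 (.var 23) (.succ (.read 11 (.var 23)))])]))
    (.ite (.natEq (.read 12 (.var 23)) (.lit 0))
      (.assign 15 (.read 13 (.var 23)))
      (.block [
        .assign 24 (.read 12 (.var 23)),
        .setNat 12 (.var 23) (.read 13 (.var 24)),
        .setNat 13 (.var 24) (.var 23),
        .assign 15 (.var 24)]))]

/-- Move the table entry of the largest rank back to the list of the roots, and keep the root of
smallest key met so far in the scalar `18`. -/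
def restoreProg : Program := .block [
  .assign 17 (.pred (.var 17)),
  .assign 23 (.read 14 (.var 17)),
  .ite (.natEq (.var 23) (.lit 0)) .skip
    (.block [
      .setNat 14 (.var 17) (.lit 0),
      .setNat 13 (.var 23) (.var 15),
      .assign 15 (.var 23),
      .ite (.and (.not (.natEq (.var 18) (.lit 0)))
          (.not (.realLt (.read 3 (.var 23)) (.read 3 (.var 18))))) .skip
        (.assign 18 (.var 23))])]

theorem rep_push {σ : Memory} {h : Heap} (hσ : Rep σ h) (hw : h.WF) :
    Rep (pushProg.exec σ) (h.push (σ.nat 25 0) (σ.real 1 (σ.nat 25 0))) := by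
  obtain ⟨e1, e2, e3, e4, e5, e6, e7, e8, e9, e10⟩ := hσ
  set v := σ.nat 25 0 with hv
  have hxle : h.node v ≤ h.size := hw.node_le v
  have hy0 : h.size + 1 ≠ h.node v := by omega
  have hnr : h.size + 1 ∉ h.roots := by
    intro hm; have := hw.placed_pos _ (Or.inl hm); omega
  have hnc : ∀ z, h.size + 1 ∉ h.ch z := hw.not_mem_ch (by omega)
  have hlast : ∀ z, 0 ∉ h.ch z := by
    intro z hz; exact hw.not_placed_zero (Or.inr (Or.inr ⟨z, hz⟩))
  have hlast' : 0 ∉ h.roots := fun hz => hw.not_placed_zero (Or.inl hz)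
  set x := h.node v with hx
  set d := σ.nat 13 (σ.nat 12 x) with hd
  obtain ⟨_, _, hr⟩ := pushProg.runs_exec (by decide) σ
  have n9 : (pushProg.exec σ).nat 9 = Function.update (σ.nat 9) v (h.size + 1) := by
    simp [pushProg, Program.block, Program.exec, NExp.eval, Memory.setNat_nat, Memory.setReal_nat,
      ← e6, hv]
  have n10 : (pushProg.exec σ).nat 10 = Function.update (σ.nat 10) (h.size + 1) v := by
    simp [pushProg, Program.block, Program.exec, NExp.eval, Memory.setNat_nat, Memory.setReal_nat,
      ← e6, hv]
  have n11 : (pushProg.exec σ).nat 11 =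
      Function.update (σ.nat 11) (h.size + 1) (σ.nat 11 x - 1 - 1) := by
    simp [pushProg, Program.block, Program.exec, NExp.eval, Memory.setNat_nat, Memory.setReal_nat,
      ← e6, hv, hx, ← e1]
  have n12 : (pushProg.exec σ).nat 12 = Function.update (σ.nat 12) (h.size + 1) (σ.nat 13 d) := by
    simp [pushProg, Program.block, Program.exec, NExp.eval, Memory.setNat_nat, Memory.setReal_nat,
      ← e6, hv, hx, hd, ← e1]
  have n13 : (pushProg.exec σ).nat 13 =
      Function.update (Function.update (σ.nat 13) d 0) (h.size + 1) (σ.nat 15 0) := by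
    simp [pushProg, Program.block, Program.exec, NExp.eval, Memory.setNat_nat, Memory.setReal_nat,
      ← e6, hv, hx, hd, ← e1]
  have n14 : (pushProg.exec σ).nat 14 = σ.nat 14 := hr.nat_eq _ (by decide)
  have n15 : (pushProg.exec σ).nat 15 0 = h.size + 1 := by
    simp [pushProg, Program.block, Program.exec, NExp.eval, Memory.setNat_nat, Memory.setReal_nat,
      ← e6]
  have n16 : (pushProg.exec σ).nat 16 0 = h.size + 1 := by
    simp [pushProg, Program.block, Program.exec, NExp.eval, Memory.setNat_nat, Memory.setReal_nat,
      ← e6]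
  have n17 : (pushProg.exec σ).nat 17 = σ.nat 17 := hr.nat_eq _ (by decide)
  have hreal : (pushProg.exec σ).real 3 = Function.update (σ.real 3) (h.size + 1) (σ.real 1 v) := by
    simp [pushProg, Program.block, Program.exec, NExp.eval, RExp.eval, Memory.setNat_nat,
      Memory.setNat_real, Memory.setReal_nat, Memory.setReal_real, ← e6, hv]
  have hdx : d = 0 ∨ d ∈ h.ch x := by
    have := e9 x
    rcases hch : h.ch x with _ | ⟨c, _ | ⟨d', l⟩⟩
    · rw [hch] at this
      rw [hd, show σ.nat 12 x = 0 from this]; exact Or.inl e10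
    · rw [hch] at this
      obtain ⟨h1, h2, h3⟩ := this
      rw [hd, h1]; exact Or.inl h3
    · rw [hch] at this
      obtain ⟨h1, h2, h3, h4, h5⟩ := this
      rw [hd, h1, h3]; exact Or.inr (by simp)
  have hdr : d ∉ h.roots := by
    rcases hdx with h0 | h0
    · rwa [h0]
    · exact fun h1 => hw.roots_ch _ _ h1 h0
  have hdc : ∀ z, z ≠ x → d ∉ h.ch z := by
    intro z hz
    rcases hdx with h0 | h0
    · rw [h0]; exact hlast z
    · exact fun h1 => hz (hw.ch_inj _ _ _ h1 h0)
  constructor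
  · rw [n9, e1]; rfl
  · rw [n10, e2]; rfl
  · rw [n11, e3, Nat.sub_sub]; rfl
  · rw [n14, e4]; rfl
  · rw [hreal, e5]; rfl
  · rw [n16]; rfl
  · rw [n17, e7]; rfl
  · rw [n13, n15]
    refine ⟨rfl, by omega, ?_⟩
    rw [Function.update_self]
    exact (e8.update hdr 0).update hnr _
  · intro z
    rw [n12, n13]
    simp only [Heap.push, ← hx]
    have hS := e9 x
    have hN := hw.nodup_ch x
    by_cases hz : z = h.size + 1
    · subst hz
      simp only [Function.update_self]
      rcases hch : h.ch x with _ | ⟨c, _ | ⟨d', l⟩⟩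
      · rw [hch] at hS
        rw [hd, show σ.nat 12 x = 0 from hS, e10]; exact e10
      · rw [hch] at hS
        obtain ⟨h1, h2, h3⟩ := hS
        rw [hd, h1, show σ.nat 13 c = 0 from h3]; exact e10
      · rw [hch] at hS hN
        obtain ⟨h1, h2, h3, h4, h5⟩ := hS
        have hd' : d = d' := by rw [hd, h1, h3]
        have := hnc x
        rw [hd']
        refine (h5.update ?_ 0).update ?_ _
        · simp at hN; exact hN.2.1
        · rw [hch] at this; simp at this; exact this.2.2
    rw [Function.update_of_ne hz, Function.update_of_ne hz]
    by_cases hzx : z = x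
    · subst hzx
      rw [Function.update_self]
      have := hnc x
      have h0 := hlast x
      refine Seg.update ?_ (fun h1 => this (List.mem_of_mem_take h1)) _
      rcases hch : h.ch x with _ | ⟨c, _ | ⟨d', l⟩⟩
      · rw [hch] at hS; exact hS
      · rw [hch] at hS h0
        obtain ⟨h1, h2, h3⟩ := hS
        rw [hd, h1, show σ.nat 13 c = 0 from h3]
        exact Seg.update (l := [c]) ⟨rfl, h2, h3⟩ h0 0
      · rw [hch] at hS hN
        obtain ⟨h1, h2, h3, h4, h5⟩ := hS
        have hd' : d = d' := by rw [hd, h1, h3]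
        have hcd : c ≠ d' := by rintro rfl; simp at hN
        rw [hd']
        refine ⟨h1, h2, ?_, h4, ?_⟩
        · rw [Function.update_of_ne hcd, h3]
        · simp [Seg]
    · rw [Function.update_of_ne hzx]
      exact ((e9 z).update (hdc z hzx) 0).update (hnc z) _
  · rw [n13, Function.update_of_ne (by omega)]
    by_cases h0 : d = 0
    · rw [h0, Function.update_self]
    · rw [Function.update_of_ne (Ne.symm h0), e10]

theorem rep_store {σ : Memory} {h : Heap} (hσ : Rep σ h) {x : ℕ} {R : List ℕ}
    (hR : h.roots = x :: R) (hx : h.Full x) (ht : h.tab (h.rank x) = 0) :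
    Rep (stepProg.exec σ) (h.store x R) := by
  obtain ⟨e1, e2, e3, e4, e5, e6, e7, e8, e9, e10⟩ := hσ
  rw [hR] at e8
  obtain ⟨h1, h2, h3⟩ := e8
  have hnat : ∀ a, (stepProg.exec σ).nat a =
      if a = 14 then Function.update (σ.nat 14) (h.rank x) x else
      if a = 15 then Function.update (σ.nat 15) 0 (σ.nat 13 x) else
      if a = 17 then Function.update (σ.nat 17) 0
        (if h.rank x < h.top then h.top else h.rank x + 1) else
      if a = 23 then Function.update (σ.nat 23) 0 x else σ.nat a := by
    intro a
    have hx' : σ.nat 9 (σ.nat 10 x) = x := by rw [e1, e2]; exact hx.2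
    have ht' : σ.nat 14 (σ.nat 11 x) = 0 := by rw [e4, e3]; exact ht
    simp [stepProg, Program.block, Program.exec, NExp.eval, Test.Holds,
      Memory.setNat_nat, h1, hx', ht']
    by_cases hlt : h.rank x < h.top
    · simp [e3, e7, hlt, Memory.setNat_nat]
      split_ifs <;> simp_all
    · simp [e3, e7, hlt, Memory.setNat_nat]
      split_ifs <;> simp_all
  have hreal : (stepProg.exec σ).real 3 = σ.real 3 := by
    have hx' : σ.nat 9 (σ.nat 10 x) = x := by rw [e1, e2]; exact hx.2
    have ht' : σ.nat 14 (σ.nat 11 x) = 0 := by rw [e4, e3]; exact ht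
    obtain ⟨t, _, hr⟩ := stepProg.runs_exec (by decide) σ
    exact hr.real_eq 3 (by decide)
  constructor
  case key => rw [hreal]; exact e5
  all_goals simp only [hnat, Nat.reduceEqDiff, if_false, if_true, Function.update_self]
  case roots => exact h3
  case top => rfl
  case tab => simp [Heap.store, e4]
  all_goals assumption

theorem rep_pop {σ : Memory} {h : Heap} (hσ : Rep σ h) {x : ℕ} {R : List ℕ}
    (hR : h.roots = x :: R) (hx : ¬ h.Full x) (hc : h.ch x = []) :
    Rep (stepProg.exec σ) (h.pop R) := by
  obtain ⟨e1, e2, e3, e4, e5, e6, e7, e8, e9, e10⟩ := hσ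
  rw [hR] at e8
  obtain ⟨h1, h2, h3⟩ := e8
  have hnat : ∀ a, (stepProg.exec σ).nat a =
      if a = 15 then Function.update (σ.nat 15) 0 (σ.nat 13 x) else
      if a = 23 then Function.update (σ.nat 23) 0 x else σ.nat a := by
    intro a
    have hx' : ¬ σ.nat 9 (σ.nat 10 x) = x := by rw [e1, e2]; exact fun h0 => hx ⟨h2, h0⟩
    have ht' : σ.nat 12 x = 0 := (e9 x).eq_zero_iff.2 hc
    simp [stepProg, Program.block, Program.exec, NExp.eval, Test.Holds,
      Memory.setNat_nat, h1, hx', ht']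
  have hreal : (stepProg.exec σ).real 3 = σ.real 3 := by
    obtain ⟨t, _, hr⟩ := stepProg.runs_exec (by decide) σ
    exact hr.real_eq 3 (by decide)
  constructor
  case key => rw [hreal]; exact e5
  all_goals simp only [hnat, Nat.reduceEqDiff, if_false, if_true, Function.update_self]
  case roots => exact h3
  all_goals assumption

theorem rep_rotate {σ : Memory} {h : Heap} (hσ : Rep σ h) (hw : h.WF) {x c : ℕ}
    {cs R : List ℕ} (hR : h.roots = x :: R) (hx : ¬ h.Full x) (hc : h.ch x = c :: cs) :
    Rep (stepProg.exec σ) (h.rotate x c cs R) := by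
  obtain ⟨e1, e2, e3, e4, e5, e6, e7, e8, e9, e10⟩ := hσ
  have hcx : c ∈ h.ch x := by simp [hc]
  have hcr : c ∉ h.roots := fun h0 => hw.roots_ch _ _ h0 hcx
  have hN := hw.nodup_ch x
  have hS := e9 x
  rw [hR] at e8 hcr
  rw [hc] at hN hS
  obtain ⟨h1, h2, h3⟩ := e8
  obtain ⟨h4, h5, h6⟩ := hS
  have hnat : ∀ a, (stepProg.exec σ).nat a =
      if a = 12 then Function.update (σ.nat 12) x (σ.nat 13 c) else
      if a = 13 then Function.update (σ.nat 13) c x else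
      if a = 15 then Function.update (σ.nat 15) 0 c else
      if a = 23 then Function.update (σ.nat 23) 0 x else
      if a = 24 then Function.update (σ.nat 24) 0 c else σ.nat a := by
    intro a
    have hx' : ¬ σ.nat 9 (σ.nat 10 x) = x := by rw [e1, e2]; exact fun h0 => hx ⟨h2, h0⟩
    simp [stepProg, Program.block, Program.exec, NExp.eval, Test.Holds,
      Memory.setNat_nat, h1, hx', h4, h5]
    split_ifs <;> simp_all
  have hreal : (stepProg.exec σ).real 3 = σ.real 3 := by
    obtain ⟨t, _, hr⟩ := stepProg.runs_exec (by decide) σ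
    exact hr.real_eq 3 (by decide)
  constructor
  case key => rw [hreal]; exact e5
  all_goals simp only [hnat, Nat.reduceEqDiff, if_false, if_true, Function.update_self]
  case roots =>
    simp only [List.mem_cons, not_or] at hcr
    refine ⟨rfl, h5, ?_⟩
    rw [Function.update_self]
    refine ⟨rfl, h2, ?_⟩
    rw [Function.update_of_ne (Ne.symm hcr.1)]
    exact h3.update hcr.2 _
  case ch =>
    intro z
    by_cases hz : z = x
    · subst hz
      simp only [Heap.rotate, Function.update_self]
      exact h6.update (List.nodup_cons.1 hN).1 _
    · simp only [Heap.rotate, Function.update_of_ne hz]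
      exact (e9 z).update (fun h0 => hz (hw.ch_inj _ _ _ h0 hcx)) _
  case null => rw [Function.update_of_ne (Ne.symm h5), e10]
  all_goals assumption

theorem rep_link {σ : Memory} {h : Heap} (hσ : Rep σ h) (hw : h.WF) {x : ℕ} {R : List ℕ}
    (hR : h.roots = x :: R) (hx : h.Full x) (ht : h.tab (h.rank x) ≠ 0) :
    Rep (stepProg.exec σ) (if h.key (h.tab (h.rank x)) < h.key x
      then h.link (h.tab (h.rank x)) x R else h.link x (h.tab (h.rank x)) R) := by
  obtain ⟨e1, e2, e3, e4, e5, e6, e7, e8, e9, e10⟩ := hσ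
  have hyr := hw.tab_roots (h.rank x)
  have hyc := hw.tab_ch (h.rank x)
  have hrk := hw.tab_rank _ ht
  have hxr : x ∈ h.roots := by simp [hR]
  have hN := hw.nodup_roots
  rw [hR] at e8 hyr hN
  obtain ⟨h1, h2, h3⟩ := e8
  simp only [List.mem_cons, not_or] at hyr
  have hx' : σ.nat 9 (σ.nat 10 x) = x := by rw [e1, e2]; exact hx.2
  set y := h.tab (h.rank x) with hy
  have hy' : σ.nat 14 (σ.nat 11 x) = y := by rw [e4, e3]
  have hreal : (stepProg.exec σ).real 3 = σ.real 3 := by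
    obtain ⟨t, _, hr⟩ := stepProg.runs_exec (by decide) σ
    exact hr.real_eq 3 (by decide)
  by_cases hlt : h.key y < h.key x
  · rw [if_pos hlt]
    have hnat : ∀ a, (stepProg.exec σ).nat a =
        if a = 11 then Function.update (σ.nat 11) y (h.rank y + 1) else
        if a = 12 then Function.update (σ.nat 12) y x else
        if a = 13 then Function.update (Function.update (σ.nat 13) y (σ.nat 13 x)) x
          (σ.nat 12 y) else
        if a = 14 then Function.update (σ.nat 14) (h.rank x) 0 else
        if a = 15 then Function.update (σ.nat 15) 0 y else
        if a = 23 then Function.update (σ.nat 23) 0 x else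
        if a = 24 then Function.update (σ.nat 24) 0 y else σ.nat a := by
      intro a
      simp [stepProg, Program.block, Program.exec, NExp.eval, RExp.eval, Test.Holds,
        Memory.setNat_nat, Memory.setNat_real, h1, hx', hy', ht, e5, hlt]
      split_ifs <;> simp_all
    constructor
    case key => rw [hreal]; exact e5
    all_goals simp only [hnat, Nat.reduceEqDiff, if_false, if_true, Function.update_self]
    case rank => rw [e3]; rfl
    case tab => simp [Heap.link, e4, hrk]
    case roots =>
      refine ⟨rfl, ht, ?_⟩
      rw [Function.update_of_ne hyr.1, Function.update_self]
      exact (h3.update hyr.2 _).update (List.nodup_cons.1 hN).1 _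
    case ch =>
      intro z
      have hz : Seg (Function.update (Function.update (σ.nat 13) y (σ.nat 13 x)) x (σ.nat 12 y))
          (σ.nat 12 z) (h.ch z) :=
        ((e9 z).update (hyc z) _).update (hw.roots_ch x z hxr) _
      by_cases hzy : z = y
      · rw [hzy] at hz ⊢
        simp only [Heap.link, Function.update_self]
        refine ⟨rfl, h2, ?_⟩
        rwa [Function.update_self]
      · simp only [Heap.link, Function.update_of_ne hzy]
        exact hz
    case null => rw [Function.update_of_ne (Ne.symm h2), Function.update_of_ne (Ne.symm ht), e10]
    all_goals assumption
  · rw [if_neg hlt]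
    have hnat : ∀ a, (stepProg.exec σ).nat a =
        if a = 11 then Function.update (σ.nat 11) x (h.rank x + 1) else
        if a = 12 then Function.update (σ.nat 12) x y else
        if a = 13 then Function.update (σ.nat 13) y (σ.nat 12 x) else
        if a = 14 then Function.update (σ.nat 14) (h.rank x) 0 else
        if a = 23 then Function.update (σ.nat 23) 0 x else
        if a = 24 then Function.update (σ.nat 24) 0 y else σ.nat a := by
      intro a
      simp [stepProg, Program.block, Program.exec, NExp.eval, RExp.eval, Test.Holds,
        Memory.setNat_nat, Memory.setNat_real, h1, hx', hy', ht, e5, hlt]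
      split_ifs <;> simp_all
    constructor
    case key => rw [hreal]; exact e5
    all_goals simp only [hnat, Nat.reduceEqDiff, if_false, if_true]
    case rank => rw [e3]; rfl
    case tab => simp [Heap.link, e4]
    case roots =>
      refine ⟨h1, h2, ?_⟩
      rw [Function.update_of_ne (Ne.symm hyr.1)]
      exact h3.update hyr.2 _
    case ch =>
      intro z
      have hz : Seg (Function.update (σ.nat 13) y (σ.nat 12 x)) (σ.nat 12 z) (h.ch z) :=
        (e9 z).update (hyc z) _
      by_cases hzx : z = x
      · rw [hzx] at hz ⊢
        simp only [Heap.link, Function.update_self]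
        refine ⟨rfl, ht, ?_⟩
        rwa [Function.update_self]
      · simp only [Heap.link, Function.update_of_ne hzx]
        exact hz
    case null => rw [Function.update_of_ne (Ne.symm ht), e10]
    all_goals assumption

theorem rep_restore {σ : Memory} {h : Heap} (hσ : Rep σ h) (hw : h.WF) {i : ℕ}
    (hi : h.top = i + 1) : Rep (restoreProg.exec σ) (h.restore i) ∧
      (restoreProg.exec σ).nat 18 0 = if h.tab i = 0 ∨ (σ.nat 18 0 ≠ 0 ∧
        h.key (σ.nat 18 0) ≤ h.key (h.tab i)) then σ.nat 18 0 else h.tab i := by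
  obtain ⟨e1, e2, e3, e4, e5, e6, e7, e8, e9, e10⟩ := hσ
  have hreal : (restoreProg.exec σ).real 3 = σ.real 3 := by
    obtain ⟨t, _, hr⟩ := restoreProg.runs_exec (by decide) σ
    exact hr.real_eq 3 (by decide)
  have hi' : σ.nat 17 0 - 1 = i := by rw [e7, hi]; rfl
  set y := h.tab i with hy
  by_cases ht : y = 0
  · have hnat : ∀ a, (restoreProg.exec σ).nat a =
        if a = 17 then Function.update (σ.nat 17) 0 i else
        if a = 23 then Function.update (σ.nat 23) 0 y else σ.nat a := by
      intro a
      simp [restoreProg, Program.block, Program.exec, NExp.eval, Test.Holds,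
        Memory.setNat_nat, hi', e4, ← hy, ht]
      split_ifs <;> simp_all
    refine ⟨?_, ?_⟩
    · constructor
      case key => rw [hreal]; exact e5
      all_goals simp only [hnat, Nat.reduceEqDiff, if_false, if_true, Function.update_self]
      case tab => simp only [Heap.restore]; rw [← ht, hy]; simp [e4]
      case roots => simp only [Heap.restore, ← hy, ht, if_true]; exact e8
      case top => rfl
      all_goals assumption
    · rw [if_pos (Or.inl ht), hnat]; rfl
  · obtain ⟨_, _, hr⟩ := restoreProg.runs_exec (by decide) σ
    have n9 : (restoreProg.exec σ).nat 9 = σ.nat 9 := hr.nat_eq _ (by decide)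
    have n10 : (restoreProg.exec σ).nat 10 = σ.nat 10 := hr.nat_eq _ (by decide)
    have n11 : (restoreProg.exec σ).nat 11 = σ.nat 11 := hr.nat_eq _ (by decide)
    have n12 : (restoreProg.exec σ).nat 12 = σ.nat 12 := hr.nat_eq _ (by decide)
    have n16 : (restoreProg.exec σ).nat 16 = σ.nat 16 := hr.nat_eq _ (by decide)
    have n13 : (restoreProg.exec σ).nat 13 = Function.update (σ.nat 13) y (σ.nat 15 0) := by
      by_cases hc : ¬ σ.nat 18 0 = 0 ∧ σ.real 3 (σ.nat 18 0) ≤ σ.real 3 y <;>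
      simp [restoreProg, Program.block, Program.exec, NExp.eval, RExp.eval, Test.Holds,
        Memory.setNat_nat, Memory.setNat_real, hi', e4, ← hy, ht, hc]
    have n14 : (restoreProg.exec σ).nat 14 = Function.update (σ.nat 14) i 0 := by
      by_cases hc : ¬ σ.nat 18 0 = 0 ∧ σ.real 3 (σ.nat 18 0) ≤ σ.real 3 y <;>
      simp [restoreProg, Program.block, Program.exec, NExp.eval, RExp.eval, Test.Holds,
        Memory.setNat_nat, Memory.setNat_real, hi', e4, ← hy, ht, hc]
    have n15 : (restoreProg.exec σ).nat 15 0 = y := by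
      by_cases hc : ¬ σ.nat 18 0 = 0 ∧ σ.real 3 (σ.nat 18 0) ≤ σ.real 3 y <;>
      simp [restoreProg, Program.block, Program.exec, NExp.eval, RExp.eval, Test.Holds,
        Memory.setNat_nat, Memory.setNat_real, hi', e4, ← hy, ht, hc]
    have n17 : (restoreProg.exec σ).nat 17 0 = i := by
      by_cases hc : ¬ σ.nat 18 0 = 0 ∧ σ.real 3 (σ.nat 18 0) ≤ σ.real 3 y <;>
      simp [restoreProg, Program.block, Program.exec, NExp.eval, RExp.eval, Test.Holds,
        Memory.setNat_nat, Memory.setNat_real, hi', e4, ← hy, ht, hc]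
    refine ⟨?_, ?_⟩
    · constructor
      case key => rw [hreal]; exact e5
      case node => rw [n9, e1]; rfl
      case item => rw [n10, e2]; rfl
      case rank => rw [n11, e3]; rfl
      case size => rw [n16, e6]; rfl
      case tab => rw [n14, e4]; rfl
      case roots =>
        rw [n13, n15]
        simp only [Heap.restore, ← hy, if_neg ht]
        refine ⟨rfl, ht, ?_⟩
        rw [Function.update_self]
        exact e8.update (hw.tab_roots i) _
      case ch =>
        rw [n12, n13]
        exact fun z => (e9 z).update (hw.tab_ch i z) _
      case null => rw [n13, Function.update_of_ne (Ne.symm ht), e10]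
      case top => rw [n17]; rfl
    · by_cases hc : ¬ σ.nat 18 0 = 0 ∧ σ.real 3 (σ.nat 18 0) ≤ σ.real 3 y
      · rw [if_pos (Or.inr (by rw [← e5]; exact hc))]
        simp [restoreProg, Program.block, Program.exec, NExp.eval, RExp.eval, Test.Holds,
          Memory.setNat_nat, Memory.setNat_real, hi', e4, ← hy, ht, hc]
      · rw [if_neg (by rw [← e5]; exact not_or.2 ⟨ht, hc⟩)]
        simp [restoreProg, Program.block, Program.exec, NExp.eval, RExp.eval, Test.Holds,
          Memory.setNat_nat, Memory.setNat_real, hi', e4, ← hy, ht, hc]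

/-! ### Finding the minimum -/

/-- Only the shape of the forest may differ: the same vertices are in the queue, in the same
nodes. -/
structure Heap.SameQueue (h h' : Heap) : Prop where
  node : h'.node = h.node
  item : h'.item = h.item
  key : h'.key = h.key
  size : h'.size = h.size

theorem Heap.SameQueue.trans {h h' h'' : Heap} (a : h.SameQueue h') (b : h'.SameQueue h'') :
    h.SameQueue h'' :=
  ⟨b.node.trans a.node, b.item.trans a.item, b.key.trans a.key, b.size.trans a.size⟩

/-- No linking is going on. -/
structure Heap.Idle (h : Heap) : Prop where
  tab : ∀ r, h.tab r = 0
  top : h.top = 0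

/-- The bound for the ranks in a heap that never has more than `N` nodes. -/
def rankBound (N : ℕ) : ℕ := 2 * Nat.log 2 N + 2

/-- Every step of the consolidation is paid for by the potential. -/
theorem step_spec {σ : Memory} {h : Heap} {N : ℕ} (hσ : Rep σ h) (hw : h.WF) (hN : h.size ≤ N)
    (htop : h.top ≤ rankBound N) (hne : h.roots ≠ []) :
    ∃ h', Rep (stepProg.exec σ) h' ∧ h'.WF ∧ h.SameQueue h' ∧ h'.top ≤ rankBound N ∧
      h'.pot (rankBound N) + 1 ≤ h.pot (rankBound N) := by
  obtain ⟨x, R, hR⟩ := List.exists_cons_of_ne_nil hne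
  by_cases hx : h.Full x
  · have hr : h.rank x < rankBound N := hw.full_rank_lt hx hN
    by_cases ht : h.tab (h.rank x) = 0
    · refine ⟨_, rep_store hσ hR hx ht, hw.store hR hx ht, ⟨rfl, rfl, rfl, rfl⟩, ?_,
        Heap.pot_store _ hR ht⟩
      simp only [Heap.store]
      split_ifs <;> omega
    · have hrk := hw.tab_rank _ ht
      refine ⟨_, rep_link hσ hw hR hx ht, ?_⟩
      split_ifs with hlt
      · refine ⟨hw.link hR hx ht (Or.inr ⟨rfl, rfl⟩) hlt.le, ⟨rfl, rfl, rfl, rfl⟩, htop, ?_⟩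
        have := Heap.pot_link (L := rankBound N) (w := h.tab (h.rank x)) (l := x) hR
          (by rwa [hrk]) (by rwa [hrk]) (hw.tab_full _ ht)
        omega
      · refine ⟨hw.link hR hx ht (Or.inl ⟨rfl, rfl⟩) (not_lt.1 hlt), ⟨rfl, rfl, rfl, rfl⟩,
          htop, ?_⟩
        have := Heap.pot_link (L := rankBound N) (w := x) (l := h.tab (h.rank x)) hR hr ht hx
        omega
  · rcases hc : h.ch x with _ | ⟨c, cs⟩
    · refine ⟨_, rep_pop hσ hR hx hc, hw.pop hR hx hc, ⟨rfl, rfl, rfl, rfl⟩, htop, ?_⟩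
      have := Heap.pot_pop (rankBound N) hR
      omega
    · have hs := (hw.placed_pos x (Or.inl (by simp [hR]))).2
      exact ⟨_, rep_rotate hσ hw hR hx hc, hw.rotate hR hx hc, ⟨rfl, rfl, rfl, rfl⟩, htop,
        Heap.pot_rotate _ hR hx hc hs⟩

/-- Link roots of equal rank until all roots have different ranks, rebuild the list of the roots and
find the root of smallest key. -/
def selectProg : Program := .block [
  .while (.nonzero (.var 15)) stepProg,
  .assign 18 (.lit 0),
  .while (.nonzero (.var 17)) restoreProg]

theorem runs_consolidate {σ : Memory} {h : Heap} {N : ℕ} (hσ : Rep σ h) (hw : h.WF)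
    (hN : h.size ≤ N) (htop : h.top ≤ rankBound N) :
    ∃ t τ h', Runs (.while (.nonzero (.var 15)) stepProg) σ t τ ∧ Rep τ h' ∧ h'.WF ∧
      h.SameQueue h' ∧ h'.top ≤ rankBound N ∧ h'.roots = [] ∧
      t + 100 * h'.pot (rankBound N) ≤ 100 * h.pot (rankBound N) + 10 := by
  obtain ⟨t, τ, h', h1, ⟨h2, h3, h4, h5⟩, h6, h7⟩ := runs_while
    (b := .nonzero (.var 15)) (P := stepProg)
    (fun h' σ' => Rep σ' h' ∧ h'.WF ∧ h.SameQueue h' ∧ h'.top ≤ rankBound N)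
    (fun h' => 100 * h'.pot (rankBound N)) (by
      rintro g σ' ⟨h1, h2, h3, h4⟩ hb
      have hne : g.roots ≠ [] := by
        rw [Ne, ← h1.roots.eq_zero_iff]
        exact hb
      obtain ⟨t, ht, hr⟩ := stepProg.runs_exec (by decide) σ'
      obtain ⟨h', h5, h6, h7, h8, h9⟩ := step_spec h1 h2 (h3.size ▸ hN) h4 hne
      refine ⟨t, _, h', hr, ⟨h5, h6, h3.trans h7, h8⟩, ?_⟩
      have hc : stepProg.maxCost + 10 ≤ 100 := by decide
      have hc' : (Test.nonzero (.var 15)).cost + 1 ≤ 10 := by decide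
      omega) h σ ⟨hσ, hw, ⟨rfl, rfl, rfl, rfl⟩, htop⟩
  refine ⟨t, τ, h', h1, h2, h3, h4, h5, ?_, ?_⟩
  · rw [← h2.roots.eq_zero_iff]
    exact not_not.1 h6
  · have hc' : (Test.nonzero (.var 15)).cost + 1 ≤ 10 := by decide
    omega

/-- The content of the scalar `18` while the list of the roots is rebuilt: a root of smallest key,
if there is a root; all roots are full. -/
def BestRoot (h : Heap) (b : ℕ) : Prop :=
  (b = 0 ∧ h.roots = []) ∨
    (b ∈ h.roots ∧ (∀ y ∈ h.roots, h.Full y) ∧ ∀ y ∈ h.roots, h.key b ≤ h.key y)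

theorem BestRoot.restore {h : Heap} (hw : h.WF) {b i : ℕ} (hb : BestRoot h b) :
    BestRoot (h.restore i) (if h.tab i = 0 ∨ (b ≠ 0 ∧ h.key b ≤ h.key (h.tab i)) then b
      else h.tab i) := by
  by_cases ht : h.tab i = 0
  · have : (h.restore i).roots = h.roots := by simp [Heap.restore, ht]
    rw [if_pos (Or.inl ht), BestRoot, this]
    exact hb
  have hroots : (h.restore i).roots = h.tab i :: h.roots := by simp [Heap.restore, ht]
  have hF : ∀ y, (h.restore i).Full y ↔ h.Full y := fun y => Iff.rfl
  have hk : (h.restore i).key = h.key := rfl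
  have htF := hw.tab_full i ht
  right
  rw [hroots, hk]
  rcases hb with ⟨rfl, hb⟩ | ⟨h1, h2, h3⟩
  · rw [if_neg (by simp [ht]), hb]
    simp [hF, htF]
  · have hb0 : b ≠ 0 := fun h0 => hw.not_placed_zero (h0 ▸ Or.inl h1)
    by_cases hle : h.key b ≤ h.key (h.tab i)
    · rw [if_pos (Or.inr ⟨hb0, hle⟩)]
      refine ⟨List.mem_cons_of_mem _ h1, ?_, ?_⟩
      · intro y hy
        rcases List.mem_cons.1 hy with rfl | hy
        · exact htF
        · exact h2 y hy
      · intro y hy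
        rcases List.mem_cons.1 hy with rfl | hy
        · exact hle
        · exact h3 y hy
    · rw [if_neg (by tauto)]
      refine ⟨List.mem_cons_self, ?_, ?_⟩
      · intro y hy
        rcases List.mem_cons.1 hy with rfl | hy
        · exact htF
        · exact h2 y hy
      · intro y hy
        rcases List.mem_cons.1 hy with rfl | hy
        · exact le_rfl
        · exact (not_le.1 hle).le.trans (h3 y hy)

theorem runs_restore {σ : Memory} {h : Heap} {L : ℕ} (hσ : Rep σ h) (hw : h.WF)
    (hroots : h.roots = []) (hb : σ.nat 18 0 = 0) (htop : h.top ≤ L) :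
    ∃ t τ h', Runs (.while (.nonzero (.var 17)) restoreProg) σ t τ ∧ Rep τ h' ∧ h'.WF ∧
      h.SameQueue h' ∧ h'.Idle ∧ BestRoot h' (τ.nat 18 0) ∧
      t + 100 * h'.pot L ≤ 100 * h.pot L + 200 * L + 10 := by
  obtain ⟨t, τ, h', h1, ⟨h2, h3, h4, h5, h5'⟩, h6, h7⟩ := runs_while
    (b := .nonzero (.var 17)) (P := restoreProg)
    (fun h' σ' => Rep σ' h' ∧ h'.WF ∧ h.SameQueue h' ∧ h'.top ≤ L ∧ BestRoot h' (σ'.nat 18 0))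
    (fun h' => 100 * h'.pot L + 200 * h'.top) (by
      rintro g σ' ⟨h1, h2, h3, h4, h4'⟩ hb
      obtain ⟨i, hi⟩ : ∃ i, g.top = i + 1 := by
        refine Nat.exists_eq_succ_of_ne_zero ?_
        rw [← h1.top]
        exact hb
      obtain ⟨t, ht, hr⟩ := restoreProg.runs_exec (by decide) σ'
      obtain ⟨h5, h6⟩ := rep_restore h1 h2 hi
      refine ⟨t, _, g.restore i, hr, ⟨h5, h2.restore hi, h3.trans ⟨rfl, rfl, rfl, rfl⟩, ?_, ?_⟩, ?_⟩
      · simp only [Heap.restore]; omega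
      · rw [h6]; exact h4'.restore h2
      · have hc : restoreProg.maxCost + 10 ≤ 100 := by decide
        have hc' : (Test.nonzero (.var 17)).cost + 1 ≤ 10 := by decide
        have hp := Heap.pot_restore (h := g) i L (by omega)
        have hi' : (g.restore i).top = i := rfl
        omega) h σ ⟨hσ, hw, ⟨rfl, rfl, rfl, rfl⟩, htop, Or.inl ⟨hb, hroots⟩⟩
  have htop0 : h'.top = 0 := by rw [← h2.top]; exact not_not.1 h6
  refine ⟨t, τ, h', h1, h2, h3, h4, ⟨fun r => ?_, htop0⟩, h5', ?_⟩
  · by_contra h0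
    have := h3.tab_top r h0
    omega
  · have hc' : (Test.nonzero (.var 17)).cost + 1 ≤ 10 := by decide
    omega

/-- In an idle heap the best root has the smallest key in the queue. -/
theorem BestRoot.min {h : Heap} (hw : h.WF) (hi : h.Idle) {b : ℕ} (hb : BestRoot h b) {x : ℕ}
    (hx : h.Full x) : h.Full b ∧ b ∈ h.roots ∧ h.key b ≤ h.key x := by
  obtain ⟨y, hy, hyx⟩ := hw.exists_root_le x (hw.full_placed x hx)
  have hy : y ∈ h.roots := by
    rcases hy with hy | ⟨r, hr, _⟩
    · exact hy
    · exact absurd (hi.tab r) hr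
  rcases hb with ⟨_, hb⟩ | ⟨h1, h2, h3⟩
  · simp [hb] at hy
  · exact ⟨h2 b h1, h1, (h3 y hy).trans hyx⟩

/-- The search for the minimum takes logarithmic amortised time. -/
theorem runs_select {σ : Memory} {h : Heap} {N : ℕ} (hσ : Rep σ h) (hw : h.WF) (hi : h.Idle)
    (hN : h.size ≤ N) :
    ∃ t τ h', Runs selectProg σ t τ ∧ Rep τ h' ∧ h'.WF ∧ h.SameQueue h' ∧ h'.Idle ∧
      BestRoot h' (τ.nat 18 0) ∧
      t + 100 * h'.pot (rankBound N) ≤ 100 * h.pot (rankBound N) + 200 * rankBound N + 30 := by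
  obtain ⟨t, τ, h', h1, h2, h3, h4, h5, h6, h7⟩ := runs_consolidate hσ hw hN (by rw [hi.top]; omega)
  have h2' : Rep (τ.setNat 18 0 0) h' := by
    obtain ⟨e1, e2, e3, e4, e5, e6, e7, e8, e9, e10⟩ := h2
    constructor <;> simpa [Memory.setNat_nat, Memory.setNat_real]
  obtain ⟨u, ρ, h'', g1, g2, g3, g4, g5, g6, g7⟩ := runs_restore h2' h3 h6
    (by simp [Memory.setNat_nat]) h5
  refine ⟨_, ρ, h'', .seq h1 (.seq (.setNat _ _ _ _) (.seq g1 (.skip _))), g2, g3, h4.trans g4, g5,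
    g6, ?_⟩
  simp only [NExp.cost]
  omega

/-! ### The invariant of Dijkstra's algorithm -/

/-- A directed multigraph on `{0, …, n - 1}` with the edges `0, …, m - 1`, where edge `e` goes from
`tl e` to `hd e`; the list `adj v` consists of the numbers `e + 1` for the edges `e` leaving `v`. -/
structure Net where
  n : ℕ
  m : ℕ
  tl : ℕ → ℕ
  hd : ℕ → ℕ
  adj : ℕ → List ℕ

/-- The ends of the edges are vertices, and the lists `adj v` contain each edge once, at its
tail. -/
structure Net.OK (N : Net) : Prop where
  tl_lt : ∀ e < N.m, N.tl e < N.n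
  hd_lt : ∀ e < N.m, N.hd e < N.n
  mem_adj : ∀ v < N.n, ∀ a, a ∈ N.adj v ↔ ∃ e < N.m, a = e + 1 ∧ N.tl e = v
  sum_adj : ∑ v ∈ Finset.range N.n, (N.adj v).length = N.m

/-- The memory holds the graph: the edges are stored as in the input, and the adjacency lists are
linked by the pointers in array `7`, starting from array `6`. -/
structure NetRep (σ : Memory) (N : Net) : Prop where
  n : σ.nat 0 0 = N.n
  m : σ.nat 0 1 = N.m
  tl : σ.nat 1 = N.tl
  hd : σ.nat 2 = N.hd
  adj : ∀ v < N.n, Seg (fun a => σ.nat 7 (a - 1)) (σ.nat 6 v) (N.adj v)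

/-- The data of a run of Dijkstra's algorithm: edges of negative weight `W` are ignored, and the run
starts with the tentative distances `D` of the vertices `v` that have `lab v ≠ 0`. -/
structure Job where
  N : Net
  W : ℕ → ℝ
  D : ℕ → ℝ
  lab : ℕ → ℕ

/-- The tentative distance of `v` is the length of a path that starts at an initially labelled
vertex, ends at `v`, and follows the predecessor pointers through vertices in `S`. -/
inductive Got (J : Job) (D : ℕ → ℝ) (par : ℕ → ℕ) (S : Finset ℕ) : ℕ → Prop
  | init {v : ℕ} : v ∈ S → J.lab v ≠ 0 → D v = J.D v → Got J D par S v
  | step {e : ℕ} : e < J.N.m → J.N.hd e ∈ S → Got J D par S (J.N.tl e) → 0 ≤ J.W e →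
      D (J.N.hd e) = D (J.N.tl e) + J.W e → par (J.N.hd e) = J.N.tl e →
      Got J D par S (J.N.hd e)

theorem Got.mem {J : Job} {D : ℕ → ℝ} {par : ℕ → ℕ} {S : Finset ℕ} {v : ℕ}
    (h : Got J D par S v) : v ∈ S := by
  cases h <;> assumption

theorem Got.mono {J : Job} {D D' : ℕ → ℝ} {par par' : ℕ → ℕ} {S S' : Finset ℕ} {v : ℕ}
    (h : Got J D par S v) (hS : S ⊆ S') (hD : ∀ v ∈ S, D' v = D v)
    (hp : ∀ v ∈ S, par' v = par v) : Got J D' par' S' v := by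
  induction h with
  | init h1 h2 h3 => exact .init (hS h1) h2 (by rw [hD _ h1, h3])
  | step h1 h2 h3 h4 h5 h6 ih =>
    exact .step h1 (hS h2) ih h4 (by rw [hD _ h2, hD _ h3.mem, h5]) (by rw [hp _ h2, h6])

/-- The invariant of Dijkstra's algorithm.  The vertices in `done` have left the queue `h`; `D`,
`lab` and `par` are the tentative distances, the marks of the vertices reached so far and their
predecessors; all edges leaving vertices in `done` have been relaxed, apart from the edges listed in
`c`. -/
structure DInv (J : Job) (D : ℕ → ℝ) (lab par : ℕ → ℕ) (h : Heap) (done : Finset ℕ)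
    (c : List ℕ) : Prop where
  wf : h.WF
  idle : h.Idle
  queued : ∀ v, h.node v ≠ 0 ↔ v < J.N.n ∧ lab v ≠ 0 ∧ v ∉ done
  key : ∀ v, h.node v ≠ 0 → h.key (h.node v) = D v
  done_lt : ∀ v ∈ done, v < J.N.n ∧ lab v ≠ 0
  mono : ∀ u ∈ done, ∀ v, h.node v ≠ 0 → D u ≤ D v
  closed : ∀ e < J.N.m, J.N.tl e ∈ done → 0 ≤ J.W e → e + 1 ∉ c →
    lab (J.N.hd e) ≠ 0 ∧ D (J.N.hd e) ≤ D (J.N.tl e) + J.W e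
  source : ∀ v < J.N.n, lab v ≠ 0 → (J.lab v ≠ 0 ∧ D v = J.D v) ∨
    ∃ e < J.N.m, J.N.hd e = v ∧ J.N.tl e ∈ done ∧ 0 ≤ J.W e ∧ D v = D (J.N.tl e) + J.W e ∧
      par v = J.N.tl e
  got : ∀ v ∈ done, Got J D par done v
  init : ∀ v < J.N.n, J.lab v ≠ 0 → lab v ≠ 0 ∧ D v ≤ J.D v
  lab_le : ∀ v < J.N.n, lab v ≤ 1
  size : h.size + ∑ v ∈ Finset.range J.N.n \ done, (J.N.adj v).length + c.length ≤ J.N.n + J.N.m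

theorem sum_sdiff_insert {n v : ℕ} {done : Finset ℕ} (f : ℕ → ℕ) (hv : v < n) (hd : v ∉ done) :
    ∑ x ∈ Finset.range n \ insert v done, f x + f v = ∑ x ∈ Finset.range n \ done, f x := by
  rw [Finset.sdiff_insert, Finset.sum_erase_add _ _ (by simp [hv, hd])]

/-- A vertex of smallest tentative distance leaves the queue.  Its tentative distance is then the
largest among the vertices that have left the queue, which is needed for relaxing its edges. -/
theorem DInv.extract {J : Job} {D : ℕ → ℝ} {lab par : ℕ → ℕ} {h : Heap} {done : Finset ℕ}
    (hI : DInv J D lab par h done []) (hJ : J.N.OK) {v : ℕ} (hv : h.node v ≠ 0)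
    (hmin : ∀ x, h.Full x → D v ≤ h.key x) :
    DInv J D lab par (h.extract v) (insert v done) (J.N.adj v) ∧
      ∀ w ∈ insert v done, D w ≤ D v := by
  have hq := (hI.queued v).1 hv
  have hnode : ∀ w, (h.extract v).node w = if w = v then 0 else h.node w := by
    intro w; simp [Heap.extract, Function.update_apply]
  have hmax : ∀ w ∈ insert v done, D w ≤ D v := by
    intro w hw
    rcases Finset.mem_insert.1 hw with rfl | hw
    · exact le_rfl
    · exact hI.mono w hw v hv
  refine ⟨?_, hmax⟩
  constructor
  case wf => exact hI.wf.extract hI.idle.tab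
  case idle => exact ⟨hI.idle.tab, hI.idle.top⟩
  case queued =>
    intro w; rw [hnode]
    by_cases hwv : w = v
    · simp [hwv]
    · simp only [hwv, if_false, hI.queued w, Finset.mem_insert, false_or]
  case key =>
    intro w; rw [hnode]
    split_ifs with hwv
    · exact fun h0 => absurd rfl h0
    · exact hI.key w
  case done_lt =>
    intro w hw
    rcases Finset.mem_insert.1 hw with rfl | hw
    · exact ⟨hq.1, hq.2.1⟩
    · exact hI.done_lt w hw
  case mono =>
    intro u hu w; rw [hnode]
    split_ifs with hwv
    · exact fun h0 => absurd rfl h0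
    · intro hw
      refine (hmax u hu).trans ?_
      have := hmin _ (hI.wf.node_full hw)
      rwa [hI.key w hw] at this
  case closed =>
    intro e he hu hW hc
    rcases Finset.mem_insert.1 hu with h1 | h1
    · exact absurd ((hJ.mem_adj v hq.1 _).2 ⟨e, he, rfl, h1⟩) hc
    · exact hI.closed e he h1 hW (by simp)
  case source =>
    intro w hw hl
    rcases hI.source w hw hl with h1 | ⟨e, h1, h2, h3, h4⟩
    · exact Or.inl h1
    · exact Or.inr ⟨e, h1, h2, Finset.mem_insert_of_mem h3, h4⟩
  case got =>
    have hg : ∀ w ∈ done, Got J D par (insert v done) w := fun w hw =>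
      (hI.got w hw).mono (Finset.subset_insert _ _) (fun _ _ => rfl) (fun _ _ => rfl)
    intro w hw
    rcases Finset.mem_insert.1 hw with rfl | hw'
    · rcases hI.source w hq.1 hq.2.1 with ⟨h1, h2⟩ | ⟨e, h1, h2, h3, h4, h5, h6⟩
      · exact .init hw h1 h2
      · subst h2
        exact .step h1 hw (hg _ h3) h4 h5 h6
    · exact hg w hw'
  case init => exact hI.init
  case lab_le => exact hI.lab_le
  case size =>
    have h1 := hI.size
    rw [← sum_sdiff_insert _ hq.1 hq.2.2] at h1
    have h2 : (h.extract v).size = h.size := rfl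
    simp only [List.length_nil] at h1
    omega

/-- An edge is passed over that has negative weight or does not improve the tentative distance. -/
theorem DInv.skip {J : Job} {D : ℕ → ℝ} {lab par : ℕ → ℕ} {h : Heap} {done : Finset ℕ}
    {c : List ℕ} {e : ℕ} (hI : DInv J D lab par h done ((e + 1) :: c))
    (hc : 0 ≤ J.W e → lab (J.N.hd e) ≠ 0 ∧ D (J.N.hd e) ≤ D (J.N.tl e) + J.W e) :
    DInv J D lab par h done c := by
  refine { hI with closed := ?_, size := ?_ }
  · intro e' he' hd hW hec
    by_cases hee : e' = e
    · subst hee; exact hc hW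
    · exact hI.closed e' he' hd hW (by simp [hee, hec])
  · have := hI.size
    simp only [List.length_cons] at this
    omega

/-- An edge of nonnegative weight is relaxed.  Its head is still to leave the queue, as the
tentative distances of the vertices that have left it are at most that of the tail. -/
theorem DInv.relax {J : Job} {D : ℕ → ℝ} {lab par : ℕ → ℕ} {h : Heap} {done : Finset ℕ}
    {c : List ℕ} {e : ℕ} (hI : DInv J D lab par h done ((e + 1) :: c)) (hJ : J.N.OK)
    (he : e < J.N.m) (hu : J.N.tl e ∈ done) (hmax : ∀ w ∈ done, D w ≤ D (J.N.tl e))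
    (hW : 0 ≤ J.W e)
    (hc : lab (J.N.hd e) = 0 ∨ D (J.N.tl e) + J.W e < D (J.N.hd e)) :
    J.N.hd e ∉ done ∧
    DInv J (Function.update D (J.N.hd e) (D (J.N.tl e) + J.W e))
      (Function.update lab (J.N.hd e) 1) (Function.update par (J.N.hd e) (J.N.tl e))
      (h.push (J.N.hd e) (D (J.N.tl e) + J.W e)) done c := by
  set v := J.N.hd e with hv
  set u := J.N.tl e
  set k := D u + J.W e with hk
  have hvn : v < J.N.n := hJ.hd_lt e he
  have hvd : v ∉ done := by
    intro hvd
    rcases hc with hc | hc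
    · exact (hI.done_lt v hvd).2 hc
    · have := hmax v hvd
      linarith
  have hdk : ∀ w ∈ done, D w ≤ k := fun w hw => by have := hmax w hw; linarith
  have hD : ∀ w, w ∈ done → Function.update D v k w = D w := fun w hw =>
    Function.update_of_ne (by rintro rfl; exact hvd hw) _ _
  have hnode : ∀ w, (h.push v k).node w = if w = v then h.size + 1 else h.node w := by
    intro w; simp [Heap.push, Function.update_apply]
  have hkey : ∀ x, (h.push v k).key x = if x = h.size + 1 then k else h.key x := by
    intro w; simp [Heap.push, Function.update_apply]
  refine ⟨hvd, ?_⟩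
  constructor
  case wf =>
    refine hI.wf.push hI.idle.tab fun h0 => ?_
    rw [hI.key v h0]
    exact (hc.resolve_left ((hI.queued v).1 h0).2.1).le
  case idle => exact ⟨hI.idle.tab, hI.idle.top⟩
  case queued =>
    intro w; rw [hnode]
    by_cases hwv : w = v
    · simp [hwv, hvn, hvd]
    · simp only [hwv, if_false, hI.queued w, Function.update_of_ne hwv]
  case key =>
    intro w; rw [hnode]
    by_cases hwv : w = v
    · simp [hwv, hkey]
    · have := hI.wf.node_le w
      rw [if_neg hwv, hkey, if_neg (by omega), Function.update_of_ne hwv]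
      exact hI.key w
  case done_lt =>
    intro w hw
    have := hI.done_lt w hw
    refine ⟨this.1, ?_⟩
    rw [Function.update_of_ne (by rintro rfl; exact hvd hw)]
    exact this.2
  case mono =>
    intro w hw x; rw [hnode, hD w hw]
    by_cases hxv : x = v
    · intro; rw [hxv, Function.update_self]; exact hdk w hw
    · rw [if_neg hxv, Function.update_of_ne hxv]
      exact hI.mono w hw x
  case closed =>
    intro e' he' hd hW' hec
    rw [hD _ hd]
    by_cases hee : e' = e
    · subst hee
      rw [← hv, Function.update_self, Function.update_self]
      exact ⟨one_ne_zero, hk.le⟩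
    · have h1 := hI.closed e' he' hd hW' (by simp [hee, hec])
      by_cases hev : J.N.hd e' = v
      · rw [hev] at h1 ⊢
        rw [Function.update_self, Function.update_self]
        exact ⟨one_ne_zero, (hc.resolve_left h1.1).le.trans h1.2⟩
      · rwa [Function.update_of_ne hev, Function.update_of_ne hev]
  case source =>
    intro w hw
    by_cases hwv : w = v
    · intro _
      exact Or.inr ⟨e, he, hwv.symm, hu, hW, by rw [hwv, Function.update_self, hD _ hu],
        by rw [hwv, Function.update_self]⟩
    · rw [Function.update_of_ne hwv, Function.update_of_ne hwv, Function.update_of_ne hwv]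
      intro hl
      rcases hI.source w hw hl with h1 | ⟨e', h1, h2, h3, h4, h5, h6⟩
      · exact Or.inl h1
      · exact Or.inr ⟨e', h1, h2, h3, h4, by rw [hD _ h3]; exact h5, h6⟩
  case got =>
    intro w hw
    refine (hI.got w hw).mono subset_rfl hD fun x hx => ?_
    rw [Function.update_of_ne (by rintro rfl; exact hvd hx)]
  case init =>
    intro w hw hl
    by_cases hwv : w = v
    · have h1 := hI.init w hw hl
      rw [hwv] at h1 ⊢
      rw [Function.update_self, Function.update_self]
      exact ⟨one_ne_zero, (hc.resolve_left h1.1).le.trans h1.2⟩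
    · rw [Function.update_of_ne hwv, Function.update_of_ne hwv]
      exact hI.init w hw hl
  case lab_le =>
    intro w hw
    by_cases hwv : w = v
    · rw [hwv, Function.update_self]
    · rw [Function.update_of_ne hwv]; exact hI.lab_le w hw
  case size =>
    have h1 := hI.size
    have h2 : (h.push v k).size = h.size + 1 := rfl
    simp only [List.length_cons] at h1
    omega

/-- The outcome of a run of Dijkstra's algorithm: no edge of nonnegative weight can be relaxed, the
final tentative distances are lengths of paths, which the predecessor pointers describe, and they
are at most the initial ones. -/
structure Job.Solved (J : Job) (D : ℕ → ℝ) (lab par : ℕ → ℕ) : Prop where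
  closed : ∀ e < J.N.m, lab (J.N.tl e) ≠ 0 → 0 ≤ J.W e →
    lab (J.N.hd e) ≠ 0 ∧ D (J.N.hd e) ≤ D (J.N.tl e) + J.W e
  got : ∀ v < J.N.n, lab v ≠ 0 → Got J D par (Finset.range J.N.n) v
  init : ∀ v < J.N.n, J.lab v ≠ 0 → lab v ≠ 0 ∧ D v ≤ J.D v
  lab_le : ∀ v < J.N.n, lab v ≤ 1

/-- The heap is empty; the arrays may still contain data of nodes that were in use before. -/
structure Heap.Clean (h : Heap) : Prop where
  wf : h.WF
  idle : h.Idle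
  roots : h.roots = []
  node : ∀ v, h.node v = 0

theorem Heap.Clean.not_placed {h : Heap} (hc : h.Clean) (x : ℕ) : ¬ h.Placed x := by
  intro hx
  obtain ⟨y, hy | ⟨r, hr, _⟩, _⟩ := hc.wf.exists_root_le x hx
  · simp [hc.roots] at hy
  · exact hr (hc.idle.tab r)

/-- Between two runs of Dijkstra's algorithm the numbers of the nodes can be used anew. -/
theorem Heap.Clean.reset {h : Heap} (hc : h.Clean) : ({ h with size := 0 } : Heap).Clean := by
  have hp := hc.not_placed
  refine ⟨?_, ⟨hc.idle.tab, hc.idle.top⟩, hc.roots, hc.node⟩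
  exact { hc.wf with
    placed_pos := fun x hx => absurd hx (hp x)
    tab_full := hc.wf.tab_full
    parent_placed := hc.wf.parent_placed
    full_placed := hc.wf.full_placed
    full_ranks := hc.wf.full_ranks }

theorem Heap.Clean.pot_reset {h : Heap} (hc : h.Clean) (L : ℕ) :
    ({ h with size := 0 } : Heap).pot L = 0 := by
  have h1 := hc.reset.wf.ch_zero
  simp only [Heap.pot, Heap.debt, Finset.range_one, zero_add, Finset.sum_singleton] at h1 ⊢
  rw [h1]
  simp [hc.roots, hc.idle.tab]

theorem DInv.clean {J : Job} {D : ℕ → ℝ} {lab par : ℕ → ℕ} {h : Heap} {done : Finset ℕ}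
    {c : List ℕ} (hI : DInv J D lab par h done c) (hr : h.roots = []) : h.Clean := by
  refine ⟨hI.wf, hI.idle, hr, fun v => ?_⟩
  by_contra hv
  obtain ⟨y, hy | ⟨r, hr, _⟩, _⟩ :=
    hI.wf.exists_root_le _ (hI.wf.full_placed _ (hI.wf.node_full hv))
  · simp [hr] at hy
  · exact hr (hI.idle.tab r)

theorem DInv.solved {J : Job} {D : ℕ → ℝ} {lab par : ℕ → ℕ} {h : Heap} {done : Finset ℕ}
    (hJ : J.N.OK) (hI : DInv J D lab par h done []) (hr : h.roots = []) : J.Solved D lab par := by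
  have hnode := (hI.clean hr).node
  have hd : ∀ v < J.N.n, lab v ≠ 0 → v ∈ done := by
    intro v hv hl
    by_contra hvd
    exact (hI.queued v).2 ⟨hv, hl, hvd⟩ (hnode v)
  refine ⟨?_, ?_, hI.init, hI.lab_le⟩
  · intro e he hl hW
    exact hI.closed e he (hd _ (hJ.tl_lt e he) hl) hW (by simp)
  · intro v hv hl
    refine (hI.got v (hd v hv hl)).mono ?_ (fun _ _ => rfl) (fun _ _ => rfl)
    exact fun w hw => Finset.mem_range.2 (hI.done_lt w hw).1

/-! ### Dijkstra's algorithm as a program -/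

theorem Rep.congr {σ τ : Memory} {h : Heap} (hσ : Rep σ h)
    (hn : ∀ a ∈ [9, 10, 11, 12, 13, 14, 15, 16, 17], τ.nat a = σ.nat a)
    (hr : τ.real 3 = σ.real 3) : Rep τ h := by
  obtain ⟨e1, e2, e3, e4, e5, e6, e7, e8, e9, e10⟩ := hσ
  constructor
  · rw [hn 9 (by decide), e1]
  · rw [hn 10 (by decide), e2]
  · rw [hn 11 (by decide), e3]
  · rw [hn 14 (by decide), e4]
  · rw [hr, e5]
  · rw [hn 16 (by decide), e6]
  · rw [hn 17 (by decide), e7]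
  · rw [hn 13 (by decide), hn 15 (by decide)]; exact e8
  · rw [hn 13 (by decide), hn 12 (by decide)]; exact e9
  · rw [hn 13 (by decide), e10]

theorem NetRep.congr {σ τ : Memory} {N : Net} (hσ : NetRep σ N)
    (hn : ∀ a ∈ [0, 1, 2, 6, 7], τ.nat a = σ.nat a) : NetRep τ N := by
  obtain ⟨e1, e2, e3, e4, e5⟩ := hσ
  constructor
  · rw [hn 0 (by decide), e1]
  · rw [hn 0 (by decide), e2]
  · rw [hn 1 (by decide), e3]
  · rw [hn 2 (by decide), e4]
  · rw [hn 6 (by decide), hn 7 (by decide)]; exact e5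

theorem Runs.nat_eq_of_forall {P : Program} {σ τ : Memory} {t : ℕ} (h : Runs P σ t τ) {l : List ℕ}
    (hl : ∀ a ∈ l, a ∉ P.natWrites) : ∀ a ∈ l, τ.nat a = σ.nat a :=
  fun a ha => h.nat_eq a (hl a ha)

/-- The edge in the scalar `20`, which leaves the vertex in the scalar `19` and enters the vertex in
the scalar `25`, has nonnegative weight and improves the tentative distance. -/
def relaxTest : Test :=
  .and (.not (.realLt (.read 2 (.pred (.var 20))) .zero))
    (.not (.and (.not (.natEq (.read 4 (.var 25)) (.lit 0)))
      (.not (.realLt (.add (.read 1 (.var 19)) (.read 2 (.pred (.var 20)))) (.read 1 (.var 25))))))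

/-- Relax the edge in the scalar `20`, and go on to the next edge of the adjacency list. -/
def relaxProg : Program := .block [
  .assign 25 (.read 2 (.pred (.var 20))),
  .ite relaxTest
    (.block [
      .setReal 1 (.var 25) (.add (.read 1 (.var 19)) (.read 2 (.pred (.var 20)))),
      .setNat 4 (.var 25) (.lit 1),
      .setNat 5 (.var 25) (.var 19),
      pushProg])
    .skip,
  .assign 20 (.read 7 (.pred (.var 20)))]

/-- The code for relaxing an edge keeps the invariant and raises the potential by a constant. -/
theorem relax_spec {σ : Memory} {h : Heap} {J : Job} {done : Finset ℕ} {c : List ℕ} {e : ℕ}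
    (hσ : Rep σ h) (hN : NetRep σ J.N) (hW : σ.real 2 = J.W) (hJ : J.N.OK)
    (hI : DInv J (σ.real 1) (σ.nat 4) (σ.nat 5) h done ((e + 1) :: c))
    (hue : σ.nat 19 0 = J.N.tl e) (hea : σ.nat 20 0 = e + 1) (he : e < J.N.m)
    (hu : J.N.tl e ∈ done) (hmax : ∀ w ∈ done, σ.real 1 w ≤ σ.real 1 (J.N.tl e)) (L : ℕ) :
    ∃ h', Rep (relaxProg.exec σ) h' ∧
      DInv J ((relaxProg.exec σ).real 1) ((relaxProg.exec σ).nat 4) ((relaxProg.exec σ).nat 5) h'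
        done c ∧
      h'.pot L ≤ h.pot L + 11 ∧ (relaxProg.exec σ).nat 20 0 = σ.nat 7 e ∧
      ∀ w ∈ done, (relaxProg.exec σ).real 1 w = σ.real 1 w := by
  set v := J.N.hd e with hv
  set k := σ.real 1 (J.N.tl e) + J.W e with hk
  set σ₁ := σ.setNat 25 0 v with hσ₁
  have hσ₁' : (Program.assign 25 (.read 2 (.pred (.var 20)))).exec σ = σ₁ := by
    simp [Program.exec, NExp.eval, hea, hN.hd, hσ₁, hv]
  have hh : relaxTest.Holds σ₁ ↔ 0 ≤ J.W e ∧ (σ.nat 4 v = 0 ∨ k < σ.real 1 v) := by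
    simp only [relaxTest, Test.Holds, NExp.eval, RExp.eval, hσ₁, Memory.setNat_nat,
      Memory.setNat_real]
    simp [hea, hue, hW, hk]
    tauto
  by_cases hc : 0 ≤ J.W e ∧ (σ.nat 4 v = 0 ∨ k < σ.real 1 v)
  · obtain ⟨hvd, hI'⟩ := hI.relax hJ he hu hmax hc.1 hc.2
    set σ₂ := ((σ₁.setReal 1 v k).setNat 4 v 1).setNat 5 v (J.N.tl e) with hσ₂
    obtain ⟨_, _, hr⟩ := pushProg.runs_exec (by decide) σ₂
    have hex : relaxProg.exec σ = (pushProg.exec σ₂).setNat 20 0 (σ.nat 7 e) := by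
      simp only [relaxProg, Program.block, Program.exec_seq]
      rw [hσ₁', Program.exec_ite_pos (hh.2 hc)]
      have h1 : (pushProg.exec σ₂).nat 7 = σ.nat 7 := by
        rw [hr.nat_eq 7 (by decide)]
        simp [hσ₂, hσ₁, Memory.setNat_nat, Memory.setReal_nat]
      have h2 : (pushProg.exec σ₂).nat 20 0 = e + 1 := by
        rw [hr.nat_eq 20 (by decide)]
        simp [hσ₂, hσ₁, Memory.setNat_nat, Memory.setReal_nat, hea]
      have h3 : ((σ₁.setReal (1) (NExp.eval σ₁ (.var 25))
          (RExp.eval σ₁ (.add (.read 1 (.var 19)) (.read 2 (.pred (.var 20)))))).setNat 4 v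
            1).setNat 5 v (J.N.tl e) = σ₂ := by
        simp [hσ₂, hσ₁, NExp.eval, RExp.eval, Memory.setNat_nat, Memory.setNat_real, hea, hue, hW,
          hk]
      have h4 : NExp.eval σ₁ (.var 25) = v := by
        simp [hσ₁, NExp.eval, Memory.setNat_nat]
      have h5 : σ₁.nat 19 0 = J.N.tl e := by
        simp [hσ₁, Memory.setNat_nat, hue]
      simp only [Program.exec, NExp.eval, Memory.setNat_nat,
        Memory.setReal_nat] at h3 h4 ⊢
      simp only [Nat.reduceEqDiff, if_false, h4, h5] at h3 ⊢
      rw [h3, h1, h2]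
      rfl
    have hσ₂' : Rep σ₂ h := by
      refine hσ.congr (fun a ha => ?_) ?_
      · simp only [List.mem_cons, List.not_mem_nil, or_false] at ha
        rcases ha with rfl | rfl | rfl | rfl | rfl | rfl | rfl | rfl | rfl <;>
        simp [hσ₂, hσ₁, Memory.setNat_nat, Memory.setReal_nat]
      · simp [hσ₂, hσ₁, Memory.setNat_real, Memory.setReal_real]
    have hpush := rep_push hσ₂' hI.wf
    have hv25 : σ₂.nat 25 0 = v := by simp [hσ₂, hσ₁, Memory.setNat_nat, Memory.setReal_nat]
    have hD : σ₂.real 1 = Function.update (σ.real 1) v k := by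
      simp [hσ₂, hσ₁, Memory.setNat_real, Memory.setReal_real]
    rw [hv25, hD, Function.update_self] at hpush
    have hreal : (relaxProg.exec σ).real 1 = Function.update (σ.real 1) v k := by
      rw [hex, Memory.setNat_real, hr.real_eq 1 (by decide), hD]
    have hlab : (relaxProg.exec σ).nat 4 = Function.update (σ.nat 4) v 1 := by
      rw [hex, Memory.setNat_nat, if_neg (by decide), hr.nat_eq 4 (by decide)]
      simp [hσ₂, hσ₁, Memory.setNat_nat, Memory.setReal_nat]
    have hpar : (relaxProg.exec σ).nat 5 = Function.update (σ.nat 5) v (J.N.tl e) := by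
      rw [hex, Memory.setNat_nat, if_neg (by decide), hr.nat_eq 5 (by decide)]
      simp [hσ₂, hσ₁, Memory.setNat_nat, Memory.setReal_nat]
    refine ⟨h.push v k, ?_, ?_, hI.wf.pot_push v k L, ?_, ?_⟩
    · rw [hex]
      refine hpush.congr (fun a ha => ?_) rfl
      rw [Memory.setNat_nat, if_neg]
      rintro rfl; revert ha; decide
    · rw [hreal, hlab, hpar]; exact hI'
    · rw [hex]; simp [Memory.setNat_nat]
    · intro w hw
      rw [hreal, Function.update_of_ne (by rintro rfl; exact hvd hw)]
  · have hex : relaxProg.exec σ = σ₁.setNat 20 0 (σ.nat 7 e) := by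
      simp only [relaxProg, Program.block, Program.exec_seq]
      rw [hσ₁', Program.exec_ite_neg (mt hh.1 hc)]
      simp only [Program.exec]
      simp [NExp.eval, hσ₁, Memory.setNat_nat, hea]
    refine ⟨h, ?_, ?_, by omega, ?_, ?_⟩
    · refine hσ.congr (fun a ha => ?_) (by rw [hex]; rfl)
      rw [hex, Memory.setNat_nat, if_neg, hσ₁, Memory.setNat_nat, if_neg]
      all_goals rintro rfl; revert ha; decide
    · have h1 : (relaxProg.exec σ).real 1 = σ.real 1 := by rw [hex]; rfl
      have h2 : (relaxProg.exec σ).nat 4 = σ.nat 4 := by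
        rw [hex]; simp [hσ₁, Memory.setNat_nat]
      have h3 : (relaxProg.exec σ).nat 5 = σ.nat 5 := by
        rw [hex]; simp [hσ₁, Memory.setNat_nat]
      rw [h1, h2, h3]
      refine hI.skip fun hW0 => ?_
      have := not_and.1 hc hW0
      rw [not_or] at this
      exact ⟨this.1, not_lt.1 this.2⟩
    · rw [hex]; simp [Memory.setNat_nat]
    · intro w _; rw [hex]; rfl

/-- Relaxing all edges in an adjacency list. -/
theorem runs_scan {σ : Memory} {h : Heap} {J : Job} {done : Finset ℕ} {c : List ℕ} {u : ℕ}
    (hσ : Rep σ h) (hN : NetRep σ J.N) (hW : σ.real 2 = J.W) (hJ : J.N.OK)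
    (hI : DInv J (σ.real 1) (σ.nat 4) (σ.nat 5) h done c)
    (hu : σ.nat 19 0 = u) (hud : u ∈ done) (hc : Seg (fun a => σ.nat 7 (a - 1)) (σ.nat 20 0) c)
    (hce : ∀ a ∈ c, ∃ e < J.N.m, a = e + 1 ∧ J.N.tl e = u)
    (hmax : ∀ w ∈ done, σ.real 1 w ≤ σ.real 1 u) (L : ℕ) :
    ∃ t τ h', Runs (.while (.nonzero (.var 20)) relaxProg) σ t τ ∧ Rep τ h' ∧
      DInv J (τ.real 1) (τ.nat 4) (τ.nat 5) h' done [] ∧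
      t + 100 * h'.pot L ≤ 100 * h.pot L + 1500 * c.length + 10 := by
  obtain ⟨t, τ, ⟨h', c'⟩, h1, ⟨g1, g2, g3, g4, g5, g6, g7, g8⟩, h3, h4⟩ := runs_while
    (b := .nonzero (.var 20)) (P := relaxProg)
    (fun (g : Heap × List ℕ) σ' => Rep σ' g.1 ∧ NetRep σ' J.N ∧ σ'.real 2 = J.W ∧
      DInv J (σ'.real 1) (σ'.nat 4) (σ'.nat 5) g.1 done g.2 ∧ σ'.nat 19 0 = u ∧
      Seg (fun a => σ'.nat 7 (a - 1)) (σ'.nat 20 0) g.2 ∧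
      (∀ a ∈ g.2, ∃ e < J.N.m, a = e + 1 ∧ J.N.tl e = u) ∧
      (∀ w ∈ done, σ'.real 1 w ≤ σ'.real 1 u))
    (fun g => 100 * g.1.pot L + 1500 * g.2.length) (by
      rintro ⟨h', c'⟩ σ' ⟨h1, h2, h3, h4, h5, h6, h7, h8⟩ hb
      rcases c' with _ | ⟨a, c'⟩
      · exact absurd h6 hb
      obtain ⟨e, he, rfl, hte⟩ := h7 a (by simp)
      obtain ⟨g1, g2, g3⟩ := h6
      obtain ⟨h'', f1, f2, f3, f4, f5⟩ := relax_spec h1 h2 h3 hJ h4 (by rw [h5, hte]) g1 he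
        (by rwa [hte]) (by rwa [hte]) L
      obtain ⟨t, ht, hr⟩ := relaxProg.runs_exec (by decide) σ'
      refine ⟨t, _, ⟨h'', c'⟩, hr, ⟨f1, h2.congr (hr.nat_eq_of_forall (by decide)), ?_, f2, ?_, ?_,
        fun a ha => h7 a (by simp [ha]), ?_⟩, ?_⟩
      · rw [hr.real_eq 2 (by decide), h3]
      · rw [hr.nat_eq 19 (by decide), h5]
      · rw [hr.nat_eq 7 (by decide), f4]; exact g3
      · intro w hw; rw [f5 w hw, f5 u hud]; exact h8 w hw
      · have hcost : relaxProg.maxCost ≤ 300 := by decide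
        have hc' : (Test.nonzero (.var 20)).cost + 1 ≤ 10 := by decide
        simp only [List.length_cons] at f3 ⊢
        omega) (h, c) σ ⟨hσ, hN, hW, hI, hu, hc, hce, hmax⟩
  have hc0 : c' = [] := by
    rw [← g6.eq_zero_iff]
    exact not_not.1 h3
  subst hc0
  have hc' : (Test.nonzero (.var 20)).cost + 1 ≤ 10 := by decide
  exact ⟨t, τ, h', h1, g1, g4, by simp only [List.length_nil] at h4; omega⟩

/-- Put the labelled vertices into the queue. -/
def fillProg : Program := .countdown 21 (.var 0)
  (.ite (.natEq (.read 4 (.var 21)) (.lit 0)) .skip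
    (.block [.assign 25 (.var 21), pushProg]))

/-- Take the next vertex out of the queue and relax the edges leaving it.  If there are only hollow
nodes left, this empties the heap. -/
def settleProg : Program := .block [
  selectProg,
  .ite (.nonzero (.var 18))
    (.block [
      .assign 19 (.read 10 (.var 18)),
      .setNat 9 (.var 19) (.lit 0),
      .assign 20 (.read 6 (.var 19)),
      .while (.nonzero (.var 20)) relaxProg])
    .skip]

/-- Dijkstra's algorithm, started with all labelled vertices in the queue. -/
def dijkstraProg : Program := .block [
  .assign 16 (.lit 0),
  fillProg,
  .while (.nonzero (.var 15)) settleProg]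

/-- The situation while the queue is filled, when the vertices `v ≥ i` have been considered. -/
def FillInv (J : Job) (L : ℕ) (i : ℕ) (σ : Memory) : Prop :=
  σ.nat 4 = J.lab ∧ σ.real 1 = J.D ∧ ∃ h, Rep σ h ∧ h.WF ∧ h.Idle ∧
    (∀ v, h.node v ≠ 0 ↔ i ≤ v ∧ v < J.N.n ∧ J.lab v ≠ 0) ∧
    (∀ v, h.node v ≠ 0 → h.key (h.node v) = J.D v) ∧ h.size + i ≤ J.N.n ∧
    h.pot L + 11 * i ≤ 11 * J.N.n

theorem fill_step {J : Job} {L i : ℕ} {σ : Memory} (h : FillInv J L (i + 1) σ)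
    (hi : σ.nat 21 0 = i) :
    FillInv J L i ((Program.ite (.natEq (.read 4 (.var 21)) (.lit 0)) .skip
      (.block [.assign 25 (.var 21), pushProg])).exec σ) := by
  obtain ⟨h1, h2, h, h3, h4, h5, h6, h7, h8, h9⟩ := h
  by_cases hl : J.lab i = 0
  · have hex : (Program.ite (.natEq (.read 4 (.var 21)) (.lit 0)) .skip
        (.block [.assign 25 (.var 21), pushProg])).exec σ = σ := by
      simp [Program.exec, Test.Holds, NExp.eval, hi, h1, hl]
    rw [hex]
    refine ⟨h1, h2, h, h3, h4, h5, fun v => ?_, h7, by omega, by omega⟩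
    rw [h6]
    by_cases hv : v = i
    · subst hv; simp [hl]
    · have : i + 1 ≤ v ↔ i ≤ v := by omega
      rw [this]
  · have hex : (Program.ite (.natEq (.read 4 (.var 21)) (.lit 0)) .skip
        (.block [.assign 25 (.var 21), pushProg])).exec σ = pushProg.exec (σ.setNat 25 0 i) := by
      simp [Program.exec, Program.block, Test.Holds, NExp.eval, hi, h1, hl]
    rw [hex]
    have hR : Rep (σ.setNat 25 0 i) h := by
      refine h3.congr (fun a ha => ?_) rfl
      rw [Memory.setNat_nat, if_neg]
      rintro rfl; revert ha; decide
    obtain ⟨_, _, hr⟩ := pushProg.runs_exec (by decide) (σ.setNat 25 0 i)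
    have hp := rep_push hR h4
    have hv : (σ.setNat 25 0 i).nat 25 0 = i := by simp [Memory.setNat_nat]
    rw [hv, Memory.setNat_real, h2] at hp
    have hni : h.node i = 0 := by
      by_contra h0
      have := ((h6 i).1 h0).1
      omega
    have hnode : ∀ w, (h.push i (J.D i)).node w = if w = i then h.size + 1 else h.node w := by
      intro w; simp [Heap.push, Function.update_apply]
    have hkey : ∀ x, (h.push i (J.D i)).key x = if x = h.size + 1 then J.D i else h.key x := by
      intro w; simp [Heap.push, Function.update_apply]
    refine ⟨?_, ?_, _, hp, h4.push h5.tab (fun h0 => absurd hni h0), ⟨h5.tab, h5.top⟩, ?_, ?_, ?_,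
      ?_⟩
    · rw [hr.nat_eq 4 (by decide), Memory.setNat_nat, if_neg (by decide), h1]
    · rw [hr.real_eq 1 (by decide), Memory.setNat_real, h2]
    · intro v
      rw [hnode]
      by_cases hvi : v = i
      · simp only [hvi, if_true]
        have : i < J.N.n := by omega
        simp [hl, this]
      · rw [if_neg hvi, h6]
        have : i + 1 ≤ v ↔ i ≤ v := by omega
        rw [this]
    · intro v
      rw [hnode]
      by_cases hvi : v = i
      · simp [hvi, hkey]
      · have := h4.node_le v
        rw [if_neg hvi, hkey, if_neg (by omega)]
        exact h7 v
    · have : (h.push i (J.D i)).size = h.size + 1 := rfl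
      omega
    · have := h4.pot_push i (J.D i) L
      omega

theorem DInv.of_fill {J : Job} {L : ℕ} {σ : Memory} (hJ : J.N.OK) (hl : ∀ v < J.N.n, J.lab v ≤ 1)
    (hF : FillInv J L 0 σ) : ∃ h, Rep σ h ∧
      DInv J (σ.real 1) (σ.nat 4) (σ.nat 5) h ∅ [] ∧ h.pot L ≤ 11 * J.N.n := by
  obtain ⟨h1, h2, h, h3, h4, h5, h6, h7, h8, h9⟩ := hF
  refine ⟨h, h3, ?_, by omega⟩
  constructor
  case wf => exact h4
  case idle => exact h5
  case queued => intro v; rw [h6, h1]; simp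
  case key => intro v hv; rw [h2]; exact h7 v hv
  case done_lt => simp
  case mono => simp
  case closed => simp
  case source => intro v _ hl; rw [h1] at hl; exact Or.inl ⟨hl, by rw [h2]⟩
  case got => simp
  case init => intro v _ hl; rw [h1, h2]; exact ⟨hl, le_rfl⟩
  case lab_le => rw [h1]; exact hl
  case size =>
    have := hJ.sum_adj
    simp only [Finset.sdiff_empty, List.length_nil]
    omega

theorem DInv.sameQueue {J : Job} {D : ℕ → ℝ} {lab par : ℕ → ℕ} {h h' : Heap} {done : Finset ℕ}
    {c : List ℕ} (hI : DInv J D lab par h done c) (hs : h.SameQueue h') (hw : h'.WF)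
    (hi : h'.Idle) : DInv J D lab par h' done c := by
  refine { hI with wf := hw, idle := hi, queued := ?_, key := ?_, mono := ?_, size := ?_ }
  · rw [hs.node]; exact hI.queued
  · rw [hs.node, hs.key]; exact hI.key
  · rw [hs.node]; exact hI.mono
  · rw [hs.size]; exact hI.size

open Classical in
/-- The time that the main loop may still take: the potential of the heap, for every vertex that has
not left the queue the time for taking it out and for relaxing its edges, and the time for a last
search, which finds hollow nodes only. -/
noncomputable def Job.budget (J : Job) (L : ℕ) (h : Heap) (done : Finset ℕ) : ℕ :=
  100 * h.pot L +
    ∑ v ∈ Finset.range J.N.n \ done, (1500 * (J.N.adj v).length + (600 * L + 200)) +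
    if h.roots = [] then 0 else 600 * L + 200

theorem runs_settle {σ : Memory} {h : Heap} {J : Job} {done : Finset ℕ} (hJ : J.N.OK)
    (hσ : Rep σ h) (hN : NetRep σ J.N) (hW : σ.real 2 = J.W)
    (hI : DInv J (σ.real 1) (σ.nat 4) (σ.nat 5) h done []) (hne : h.roots ≠ []) :
    ∃ t τ h' done', Runs settleProg σ t τ ∧ Rep τ h' ∧
      DInv J (τ.real 1) (τ.nat 4) (τ.nat 5) h' done' [] ∧
      t + 10 + J.budget (rankBound (J.N.n + J.N.m)) h' done' ≤
        J.budget (rankBound (J.N.n + J.N.m)) h done := by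
  set L := rankBound (J.N.n + J.N.m) with hL
  have hsize : h.size ≤ J.N.n + J.N.m := by have := hI.size; omega
  obtain ⟨t, τ, h', h1, h2, h3, h4, h5, h6, h7⟩ := runs_select hσ hI.wf hI.idle hsize
  rw [← hL] at h7
  have hI' : DInv J (τ.real 1) (τ.nat 4) (τ.nat 5) h' done [] := by
    rw [h1.real_eq 1 (by decide), h1.nat_eq 4 (by decide), h1.nat_eq 5 (by decide)]
    exact hI.sameQueue h4 h3 h5
  have hN' : NetRep τ J.N := hN.congr (h1.nat_eq_of_forall (by decide))
  have hW' : τ.real 2 = J.W := by rw [h1.real_eq 2 (by decide), hW]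
  have hc1 : (Test.nonzero (.var 18)).cost = 5 := by decide
  by_cases hb : τ.nat 18 0 = 0
  · have hroots : h'.roots = [] := by
      rcases h6 with ⟨_, h6⟩ | ⟨h6, _⟩
      · exact h6
      · rw [hb] at h6
        exact absurd (Or.inl h6) h3.not_placed_zero
    refine ⟨_, τ, h', done, .seq h1 (.seq (.iteFalse (by simpa [Test.Holds, NExp.eval] using hb)
      (.skip _)) (.skip _)), h2, hI', ?_⟩
    simp only [Job.budget, hroots, hne, if_true, if_false]
    omega
  · obtain ⟨hbF, hbr⟩ : h'.Full (τ.nat 18 0) ∧ τ.nat 18 0 ∈ h'.roots := by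
      rcases h6 with ⟨h6, _⟩ | ⟨h6, h8, _⟩
      · exact absurd h6 hb
      · exact ⟨h8 _ h6, h6⟩
    set b := τ.nat 18 0 with hbdef
    set v := h'.item b with hv
    have hnv : h'.node v = b := hbF.2
    have hnv0 : h'.node v ≠ 0 := by rw [hnv]; exact hb
    have hmin : ∀ x, h'.Full x → τ.real 1 v ≤ h'.key x := by
      intro x hx
      rw [← hI'.key v hnv0, hnv]
      exact (h6.min h3 h5 hx).2.2
    obtain ⟨hI'', hmax⟩ := hI'.extract hJ hnv0 hmin
    have hvq := (hI'.queued v).1 hnv0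
    set τ₁ := ((τ.setNat 19 0 v).setNat 9 v 0).setNat 20 0 (τ.nat 6 v) with hτ₁
    have hR : Rep τ₁ (h'.extract v) := by
      obtain ⟨e1, e2, e3, e4, e5, e6, e7, e8, e9, e10⟩ := h2
      constructor
      case node => simp [hτ₁, Memory.setNat_nat, Heap.extract, e1]
      all_goals simpa [hτ₁, Memory.setNat_nat, Memory.setNat_real, Heap.extract]
    obtain ⟨u, ρ, h'', g1, g2, g3, g4⟩ := runs_scan (u := v) (c := J.N.adj v) (J := J)
      (done := insert v done) hR
      (hN'.congr (by
        intro a ha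
        simp only [hτ₁, Memory.setNat_nat]
        rw [if_neg, if_neg, if_neg]
        all_goals rintro rfl; revert ha; decide))
      (by simpa [hτ₁, Memory.setNat_real] using hW') hJ
      (by simpa [hτ₁, Memory.setNat_real, Memory.setNat_nat] using hI'')
      (by simp [hτ₁, Memory.setNat_nat]) (Finset.mem_insert_self _ _)
      (by simpa [hτ₁, Memory.setNat_nat] using hN'.adj v hvq.1)
      (fun a ha => (hJ.mem_adj v hvq.1 a).1 ha)
      (by simpa [hτ₁, Memory.setNat_real] using hmax) L
    have hrun : ∃ s, s ≤ 30 + u ∧ Runs (.block [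
        .assign 19 (.read 10 (.var 18)),
        .setNat 9 (.var 19) (.lit 0),
        .assign 20 (.read 6 (.var 19)),
        .while (.nonzero (.var 20)) relaxProg]) τ s ρ := by
      have hτ : Rep τ h' := h2
      have hv' : τ.nat 10 b = v := by rw [hτ.item]
      refine ⟨_, ?_, .seq (.setNat _ _ _ _) (.seq (.setNat _ _ _ _) (.seq (.setNat _ _ _ _)
        (.seq (t := u) ?_ (.skip _))))⟩
      · simp only [NExp.cost]; omega
      · convert g1 using 1
        simp [hτ₁, NExp.eval, Memory.setNat_nat, hv', ← hbdef]
    obtain ⟨s, hs, hrun⟩ := hrun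
    refine ⟨_, ρ, h'', insert v done, .seq h1 (.seq (.iteTrue
      (by simpa [Test.Holds, NExp.eval] using hb) hrun) (.skip _)), g2, g3, ?_⟩
    have hp := h3.pot_extract L hnv0
    have hrk : h'.rank (h'.node v) < L := by
      rw [hnv]; exact h3.full_rank_lt hbF (h4.size ▸ hsize)
    have hsum := sum_sdiff_insert (fun v => 1500 * (J.N.adj v).length + (600 * L + 200))
      hvq.1 hvq.2.2
    simp only [Job.budget, hne, if_false]
    split_ifs <;> omega

/-- Dijkstra's algorithm takes time `O(m + (n + 1) log (n + m))`.  It leaves the heap empty, so that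
it can be run again. -/
theorem runs_dijkstra {σ : Memory} {J : Job} {h : Heap} (hJ : J.N.OK)
    (hl : ∀ v < J.N.n, J.lab v ≤ 1) (hσ : Rep σ h) (hc : h.Clean) (hN : NetRep σ J.N)
    (hW : σ.real 2 = J.W) (hD : σ.real 1 = J.D) (hlab : σ.nat 4 = J.lab) :
    ∃ t τ h', Runs dijkstraProg σ t τ ∧ Rep τ h' ∧ h'.Clean ∧
      J.Solved (τ.real 1) (τ.nat 4) (τ.nat 5) ∧
      t ≤ 3000 * (J.N.m + (J.N.n + 1) * rankBound (J.N.n + J.N.m)) := by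
  set L := rankBound (J.N.n + J.N.m) with hL
  have hL2 : 2 ≤ L := by simp [hL, rankBound]
  have hn0 : (σ.setNat 16 0 0).nat 0 0 = J.N.n := by simp [Memory.setNat_nat, hN.n]
  have hF : FillInv J L J.N.n (σ.setNat 16 0 0) := by
    refine ⟨by simpa [Memory.setNat_nat], by simpa [Memory.setNat_real], { h with size := 0 }, ?_,
      hc.reset.wf, hc.reset.idle, ?_, ?_, by simp, by rw [hc.pot_reset]; omega⟩
    · obtain ⟨e1, e2, e3, e4, e5, e6, e7, e8, e9, e10⟩ := hσ
      constructor
      case size => simp [Memory.setNat_nat]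
      all_goals simpa [Memory.setNat_nat, Memory.setNat_real]
    · intro v
      have := hc.node v
      simp only [this, ne_eq, not_true_eq_false, false_iff, not_and]
      omega
    · intro v hv; exact absurd (hc.node v) hv
  obtain ⟨t, τ, h1, h2, h3⟩ := runs_countdown (a := 21) (k := .var 0)
    (body := .ite (.natEq (.read 4 (.var 21)) (.lit 0)) .skip
      (.block [.assign 25 (.var 21), pushProg])) (FillInv J L) 100 (by
      intro i σ' hi hi'
      obtain ⟨t, ht, hr⟩ := Program.runs_exec (.ite (.natEq (.read 4 (.var 21)) (.lit 0)) .skip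
        (.block [.assign 25 (.var 21), pushProg])) (by decide) σ'
      refine ⟨t, _, hr, ht.trans (by decide), fill_step hi hi', ?_⟩
      rw [hr.nat_eq 21 (by decide), hi'])
    (by
      rintro i j σ' ⟨h1, h2, h, h3, h4⟩
      refine ⟨by simpa [Memory.setNat_nat], by simpa [Memory.setNat_real], h, ?_, h4⟩
      refine h3.congr (fun a ha => ?_) rfl
      rw [Memory.setNat_nat, if_neg]
      rintro rfl; revert ha; decide) (σ.setNat 16 0 0) (by simpa [NExp.eval, hn0] using hF)
  have hk : NExp.eval (σ.setNat 16 0 0) (.var 0) = J.N.n := by simpa [NExp.eval] using hn0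
  rw [hk] at h2
  obtain ⟨h', h4, h5, h6⟩ := DInv.of_fill hJ hl h3
  have hset : ∀ a ∈ [0, 1, 2, 6, 7], (σ.setNat 16 0 0).nat a = σ.nat a := by
    intro a ha
    rw [Memory.setNat_nat, if_neg]
    rintro rfl; revert ha; decide
  have hN' : NetRep τ J.N :=
    (hN.congr hset).congr (h1.nat_eq_of_forall (by decide))
  have hW' : τ.real 2 = J.W := by rw [h1.real_eq 2 (by decide)]; exact hW
  obtain ⟨u, ρ, ⟨h'', done⟩, g1, ⟨g2, g3, g4, g5⟩, g6, g7⟩ := runs_while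
    (b := .nonzero (.var 15)) (P := settleProg)
    (fun (g : Heap × Finset ℕ) σ' => Rep σ' g.1 ∧ NetRep σ' J.N ∧ σ'.real 2 = J.W ∧
      DInv J (σ'.real 1) (σ'.nat 4) (σ'.nat 5) g.1 g.2 [])
    (fun g => J.budget L g.1 g.2) (by
      rintro ⟨h, done⟩ σ' ⟨h1, h2, h3, h4⟩ hb
      have hne : h.roots ≠ [] := by
        rw [Ne, ← h1.roots.eq_zero_iff]
        exact hb
      obtain ⟨t, τ, h', done', f1, f2, f3, f4⟩ := runs_settle hJ h1 h2 h3 h4 hne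
      refine ⟨t, τ, (h', done'), f1, ⟨f2, h2.congr (f1.nat_eq_of_forall (by decide)), ?_, f3⟩, ?_⟩
      · rw [f1.real_eq 2 (by decide), h3]
      · have hc' : (Test.nonzero (.var 15)).cost + 1 ≤ 10 := by decide
        rw [← hL] at f4
        dsimp only at f4 ⊢
        omega) (h', ∅) τ ⟨h4, hN', hW', h5⟩
  have hr : h''.roots = [] := by
    rw [← g2.roots.eq_zero_iff]
    exact not_not.1 g6
  refine ⟨_, ρ, h'', .seq (.setNat _ _ _ _) (.seq h1 (.seq g1 (.skip _))), g2, g5.clean hr,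
    g5.solved hJ hr, ?_⟩
  have hbud : J.budget L h' ∅ ≤ 1100 * J.N.n + 1500 * J.N.m + J.N.n * (600 * L + 200) +
      (600 * L + 200) := by
    have hs : ∑ v ∈ Finset.range J.N.n, (1500 * (J.N.adj v).length + (600 * L + 200)) =
        1500 * J.N.m + J.N.n * (600 * L + 200) := by
      rw [Finset.sum_add_distrib, ← Finset.mul_sum, hJ.sum_adj]
      simp
    simp only [Job.budget, Finset.sdiff_empty, hs]
    split_ifs <;> omega
  have hc' : (Test.nonzero (.var 15)).cost + 1 ≤ 10 := by decide
  have hnL : J.N.n * 2 ≤ J.N.n * L := Nat.mul_le_mul_left _ hL2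
  have e1 : J.N.n * (600 * L + 200) = 600 * (J.N.n * L) + 200 * J.N.n := by ring
  have e2 : (J.N.n + 1) * L = J.N.n * L + L := by ring
  rw [e1] at hbud
  rw [e2]
  generalize J.N.n * L = p at *
  simp only [NExp.cost] at h2 ⊢
  dsimp only at g7
  omega

/-! ### Paths -/

section Paths

variable {n : ℕ} {G : WDigraph n}

theorem WDigraph.isPath_self (v : Fin n) : G.IsPath v v [v] := by simp [WDigraph.IsPath]

theorem WDigraph.IsPath.ne_nil {u v : Fin n} {p : List (Fin n)} (h : G.IsPath u v p) : p ≠ [] := by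
  rintro rfl; simp [WDigraph.IsPath] at h

theorem WDigraph.IsPath.snoc {u v x : Fin n} {p : List (Fin n)} (h : G.IsPath u v p)
    (hx : (v, x) ∈ G.edges) : G.IsPath u x (p ++ [x]) := by
  obtain ⟨h1, h2, h3⟩ := h
  refine ⟨?_, by simp, ?_⟩
  · rw [List.head?_append, h1]; rfl
  · rw [List.isChain_append]
    refine ⟨h3, by simp, ?_⟩
    intro a ha b hb
    rw [h2] at ha
    simp only [Option.mem_def, Option.some.injEq, List.head?_cons] at ha hb
    subst ha hb
    exact hx

theorem WDigraph.IsPath.of_snoc {u v : Fin n} {p : List (Fin n)} (h : G.IsPath u v p) :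
    (p = [v] ∧ u = v) ∨ ∃ q x, p = q ++ [v] ∧ G.IsPath u x q ∧ (x, v) ∈ G.edges := by
  obtain ⟨h1, h2, h3⟩ := h
  rcases List.eq_nil_or_concat' p with rfl | ⟨q, y, rfl⟩
  · simp at h1
  have hy : y = v := by simpa using h2
  subst hy
  rcases List.eq_nil_or_concat' q with rfl | ⟨r, x, rfl⟩
  · left; simpa [eq_comm] using h1
  · right
    rw [List.isChain_append] at h3
    refine ⟨_, x, rfl, ⟨?_, by simp, h3.1⟩, h3.2.2 x (by simp) y (by simp)⟩
    rw [List.head?_append] at h1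
    cases r <;> simpa using h1

/-- Induction on paths from a fixed vertex `u`, which are extended at their ends. -/
theorem WDigraph.IsPath.induction {u : Fin n} {P : Fin n → List (Fin n) → Prop}
    (self : P u [u])
    (snoc : ∀ q x v, G.IsPath u x q → (x, v) ∈ G.edges → P x q → P v (q ++ [v]))
    {v : Fin n} {p : List (Fin n)} (h : G.IsPath u v p) : P v p := by
  induction hk : p.length generalizing p v with
  | zero => exact absurd (List.length_eq_zero_iff.1 hk) h.ne_nil
  | succ k ih =>
    rcases h.of_snoc with ⟨rfl, rfl⟩ | ⟨q, x, rfl, hq, hx⟩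
    · exact self
    · exact snoc q x v hq hx (ih hq (by simpa using hk))

theorem WDigraph.pathWeight_append {v : Fin n} (p q : List (Fin n)) :
    G.pathWeight (p ++ v :: q) = G.pathWeight (p ++ [v]) + G.pathWeight (v :: q) := by
  induction p with
  | nil => simp [WDigraph.pathWeight]
  | cons a p ih =>
    cases p with
    | nil => simp [WDigraph.pathWeight]
    | cons b p =>
      simp only [List.cons_append, WDigraph.pathWeight] at ih ⊢
      rw [ih]; ring

theorem WDigraph.IsPath.eq_snoc {u v : Fin n} {p : List (Fin n)} (h : G.IsPath u v p) :
    ∃ q, p = q ++ [v] := by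
  rcases h.of_snoc with ⟨rfl, _⟩ | ⟨q, _, rfl, _⟩
  · exact ⟨[], rfl⟩
  · exact ⟨q, rfl⟩

theorem WDigraph.IsPath.pathWeight_snoc {u v : Fin n} {p : List (Fin n)} (h : G.IsPath u v p)
    (x : Fin n) : G.pathWeight (p ++ [x]) = G.pathWeight p + G.weight v x := by
  obtain ⟨q, rfl⟩ := h.eq_snoc
  rw [List.append_assoc, List.singleton_append, WDigraph.pathWeight_append]
  simp [WDigraph.pathWeight]

open Classical in
/-- The number of edges of negative weight on a path. -/
noncomputable def WDigraph.negEdges (G : WDigraph n) : List (Fin n) → ℕ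
  | [] => 0
  | [_] => 0
  | x :: y :: p => (if G.weight x y < 0 then 1 else 0) + G.negEdges (y :: p)

open Classical in
theorem WDigraph.IsPath.negEdges_snoc {u v : Fin n} {p : List (Fin n)} (h : G.IsPath u v p)
    (x : Fin n) : G.negEdges (p ++ [x]) = G.negEdges p + if G.weight v x < 0 then 1 else 0 := by
  obtain ⟨q, rfl⟩ := h.eq_snoc
  clear h
  induction q with
  | nil => simp [WDigraph.negEdges]
  | cons a q ih =>
    cases q with
    | nil => simp [WDigraph.negEdges]
    | cons b q =>
      simp only [List.cons_append, WDigraph.negEdges] at ih ⊢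
      rw [ih, add_assoc]

/-- On a path without repeated vertices the edges of negative weight have different heads. -/
theorem WDigraph.IsPath.negEdges_le {u v : Fin n} {p : List (Fin n)} (h : G.IsPath u v p)
    (hp : p.Nodup) : G.negEdges p ≤ G.numNegTargets := by
  classical
  set S := {v : Fin n | ∃ u, (u, v) ∈ G.edges ∧ G.weight u v < 0} with hS
  have key : ∀ {v : Fin n} {p : List (Fin n)}, G.IsPath u v p →
      G.negEdges p ≤ (p.filter (· ∈ S)).length := by
    intro v p h
    refine h.induction (P := fun v p => G.negEdges p ≤ (p.filter (· ∈ S)).length) ?_ ?_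
    · simp [WDigraph.negEdges]
    · intro q x v hq hx ih
      rw [hq.negEdges_snoc, List.filter_append, List.length_append]
      split_ifs with hneg
      · have : v ∈ S := ⟨x, hx, hneg⟩
        simp [this, ih]
      · omega
  refine (key h).trans ?_
  rw [WDigraph.numNegTargets, ← hS, ← List.toFinset_card_of_nodup (hp.filter _),
    ← Set.ncard_coe_finset]
  refine Set.ncard_le_ncard (fun x hx => ?_) (Set.toFinite _)
  simp only [List.coe_toFinset, List.mem_filter, decide_eq_true_eq, Set.mem_ofPred_eq] at hx
  exact hx.2

/-- Without negative cycles, cycles can be cut out of a path without making it heavier. -/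
theorem WDigraph.exists_nodup_path (hG : ¬ G.HasNegativeCycle) {u v : Fin n} {p : List (Fin n)}
    (h : G.IsPath u v p) :
    ∃ q, G.IsPath u v q ∧ q.Nodup ∧ G.pathWeight q ≤ G.pathWeight p := by
  induction hk : p.length using Nat.strong_induction_on generalizing p with
  | _ k ih =>
    by_cases hp : p.Nodup
    · exact ⟨p, h, hp, le_rfl⟩
    obtain ⟨x, hx⟩ := List.exists_duplicate_iff_not_nodup.2 hp
    rw [List.duplicate_iff_sublist, List.cons_sublist_iff] at hx
    obtain ⟨r₁, r₂, rfl, hx1, hx2⟩ := hx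
    rw [List.singleton_sublist] at hx2
    obtain ⟨a, b, rfl⟩ := List.append_of_mem hx1
    obtain ⟨c, d, rfl⟩ := List.append_of_mem hx2
    -- The path is `a, x, b, c, x, d`; the part from `x` to `x` is a cycle, which is cut out.
    have heq : a ++ x :: b ++ (c ++ x :: d) = a ++ x :: (b ++ c) ++ x :: d := by simp
    rw [heq] at h hk ⊢
    obtain ⟨h1, h2, h3⟩ := h
    rw [List.isChain_append] at h3
    have h4 := h3.1
    rw [List.isChain_append] at h4
    have hcyc : G.IsPath x x (x :: (b ++ c) ++ [x]) := by
      refine ⟨by simp, by rw [List.getLast?_append]; simp, ?_⟩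
      rw [List.isChain_append]
      refine ⟨h4.2.1, by simp, ?_⟩
      intro y hy z hz
      refine h3.2.2 y ?_ z (by simpa using hz)
      rw [List.getLast?_append]
      simp only [Option.mem_def] at hy ⊢
      rw [hy]; rfl
    have hpath : G.IsPath u v (a ++ x :: d) := by
      refine ⟨?_, ?_, ?_⟩
      · cases a <;> simpa using h1
      · rw [List.getLast?_append] at h2 ⊢
        simpa using h2
      · rw [List.isChain_append]
        exact ⟨h4.1, h3.2.1, fun y hy z hz => h4.2.2 y hy z (by simpa using hz)⟩
    have hnn : 0 ≤ G.pathWeight (x :: (b ++ c) ++ [x]) := by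
      by_contra hneg
      exact hG ⟨x, _, hcyc, not_le.1 hneg⟩
    obtain ⟨q, hq1, hq2, hq3⟩ := ih (a ++ x :: d).length
      (by rw [← hk]; simp only [List.length_append, List.length_cons]; omega) hpath rfl
    refine ⟨q, hq1, hq2, hq3.trans ?_⟩
    have e1 := G.pathWeight_append (v := x) (a ++ x :: (b ++ c)) d
    have e2 := G.pathWeight_append (v := x) a d
    have e3 := G.pathWeight_append (v := x) a (b ++ c ++ [x])
    simp only [List.append_assoc, List.cons_append] at e1 e3 hnn ⊢
    linarith

end Paths

/-! ### Potentials and shortest paths -/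

section Potentials

variable {n : ℕ} {G : WDigraph n}

/-- The weights of the edges in the order in which they are listed, with `0` beyond the last edge,
as in the input. -/
noncomputable def inputWeight (G : WDigraph n) (enum : Fin G.numEdges ≃ {e // e ∈ G.edges})
    (e : ℕ) : ℝ :=
  if h : e < G.numEdges then G.weight (enum ⟨e, h⟩).1.1 (enum ⟨e, h⟩).1.2 else 0

/-- The graph as it is given in the input.  The adjacency lists are in the order of the input. -/
noncomputable def inputNet (G : WDigraph n) (enum : Fin G.numEdges ≃ {e // e ∈ G.edges}) : Net where
  n := n
  m := G.numEdges
  tl e := if h : e < G.numEdges then ((enum ⟨e, h⟩).1.1 : ℕ) else 0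
  hd e := if h : e < G.numEdges then ((enum ⟨e, h⟩).1.2 : ℕ) else 0
  adj v := ((List.range' 0 G.numEdges).filter (fun e =>
    (if h : e < G.numEdges then ((enum ⟨e, h⟩).1.1 : ℕ) else 0) = v)).map (· + 1)

variable (enum : Fin G.numEdges ≃ {e // e ∈ G.edges})

theorem exists_edge {u v : Fin n} (h : (u, v) ∈ G.edges) :
    ∃ e < G.numEdges, (inputNet G enum).tl e = u ∧ (inputNet G enum).hd e = v ∧
      inputWeight G enum e = G.weight u v := by
  refine ⟨enum.symm ⟨(u, v), h⟩, Fin.is_lt _, ?_, ?_, ?_⟩ <;>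
  simp [inputNet, inputWeight]

theorem mem_edges {e : ℕ} (he : e < G.numEdges) :
    ∃ u v : Fin n, (u, v) ∈ G.edges ∧ (inputNet G enum).tl e = u ∧ (inputNet G enum).hd e = v ∧
      inputWeight G enum e = G.weight u v :=
  ⟨(enum ⟨e, he⟩).1.1, (enum ⟨e, he⟩).1.2, (enum ⟨e, he⟩).2, by simp [inputNet, he],
    by simp [inputNet, he], by simp [inputWeight, he]⟩

theorem sum_length_filter (f : ℕ → ℕ) (n : ℕ) (l : List ℕ) (h : ∀ e ∈ l, f e < n) :
    ∑ v ∈ Finset.range n, (l.filter (fun e => f e = v)).length = l.length := by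
  induction l with
  | nil => simp
  | cons a l ih =>
    have h1 : ∀ v, ((a :: l).filter (fun e => f e = v)).length =
        (l.filter (fun e => f e = v)).length + if f a = v then 1 else 0 := by
      intro v
      by_cases hv : f a = v <;> simp [hv]
    simp only [h1]
    rw [Finset.sum_add_distrib, ih fun e he => h e (by simp [he]), Finset.sum_ite_eq,
      if_pos (Finset.mem_range.2 (h a (by simp)))]
    simp

theorem inputNet_ok : (inputNet G enum).OK := by
  have htl : ∀ e < G.numEdges, (inputNet G enum).tl e < n := by
    intro e he
    obtain ⟨u, v, _, h1, _⟩ := mem_edges enum he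
    rw [h1]; exact u.2
  refine ⟨htl, ?_, ?_, ?_⟩
  · intro e he
    obtain ⟨u, v, _, _, h1, _⟩ := mem_edges enum he
    rw [h1]; exact v.2
  · intro v _ a
    change a ∈ ((List.range' 0 G.numEdges).filter (fun e => (inputNet G enum).tl e = v)).map (· + 1)
      ↔ _
    simp only [List.mem_map, List.mem_filter, List.mem_range'_1, decide_eq_true_eq]
    constructor
    · rintro ⟨e, ⟨⟨_, he⟩, hv⟩, rfl⟩
      exact ⟨e, by rwa [zero_add] at he, rfl, hv⟩
    · rintro ⟨e, he, rfl, hv⟩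
      exact ⟨e, ⟨⟨by omega, by rw [zero_add]; exact he⟩, hv⟩, rfl⟩
  · change ∑ v ∈ Finset.range n, (((List.range' 0 G.numEdges).filter
      (fun e => (inputNet G enum).tl e = v)).map (· + 1)).length = G.numEdges
    simp only [List.length_map]
    rw [sum_length_filter _ _ _ fun e he => htl e (by simpa using he)]
    simp

/-- Every value of `D` is the weight of a path ending there. -/
def Attained (G : WDigraph n) (D : ℕ → ℝ) : Prop :=
  ∀ v : Fin n, ∃ u p, G.IsPath u v p ∧ D v = G.pathWeight p

/-- No path with fewer than `j` edges of negative weight is lighter than the value of `D` at its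
end. -/
def BoundedBy (G : WDigraph n) (j : ℕ) (D : ℕ → ℝ) : Prop :=
  ∀ (u v : Fin n) (p : List (Fin n)), G.IsPath u v p → G.negEdges p < j → D v ≤ G.pathWeight p

theorem Attained.update {D : ℕ → ℝ} (hD : Attained G D) {e : ℕ} (he : e < G.numEdges) :
    Attained G (Function.update D ((inputNet G enum).hd e)
      (D ((inputNet G enum).tl e) + inputWeight G enum e)) := by
  obtain ⟨u, v, huv, h1, h2, h3⟩ := mem_edges enum he
  intro x
  by_cases hx : (x : ℕ) = v
  · obtain rfl := Fin.ext hx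
    obtain ⟨y, p, hp, hpD⟩ := hD u
    exact ⟨y, _, hp.snoc huv, by rw [h2, Function.update_self, h1, h3, hp.pathWeight_snoc, hpD]⟩
  · rw [h2, Function.update_of_ne hx]
    exact hD x

/-- A run of Dijkstra's algorithm on the edges of nonnegative weight only extends paths. -/
theorem Attained.solved {D D' : ℕ → ℝ} {lab₀ lab par : ℕ → ℕ} (hD : Attained G D)
    (hs : Job.Solved ⟨inputNet G enum, inputWeight G enum, D, lab₀⟩ D' lab par)
    (hl : ∀ v < n, lab v ≠ 0) : Attained G D' := by
  have key : ∀ x, Got ⟨inputNet G enum, inputWeight G enum, D, lab₀⟩ D' par (Finset.range n) x →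
      ∀ v : Fin n, (v : ℕ) = x → ∃ u p, G.IsPath u v p ∧ D' v = G.pathWeight p := by
    intro x hx
    induction hx with
    | init _ _ h =>
      rintro v rfl
      obtain ⟨u, p, hp, hpD⟩ := hD v
      exact ⟨u, p, hp, h.trans hpD⟩
    | @step e he _ _ _ h1 _ ih =>
      intro v hv
      obtain ⟨a, b, hab, g1, g2, g3⟩ := mem_edges enum he
      obtain rfl : v = b := Fin.ext (hv.trans g2)
      obtain ⟨y, p, hp, hpD⟩ := ih a g1.symm
      refine ⟨y, _, hp.snoc hab, ?_⟩
      have h2 : D' v = D' a + G.weight a v := by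
        have := h1
        simp only [g1, g2, g3] at this
        exact this
      rw [h2, hp.pathWeight_snoc, hpD]
  exact fun v => key v (hs.got v v.2 (hl v v.2)) v rfl

/-- One round of the Bellman-Ford-Dijkstra algorithm, relaxing the edges of negative weight and then
all paths made of edges of nonnegative weight, accounts for one more edge of negative weight. -/
theorem BoundedBy.succ {j : ℕ} {D D' D'' : ℕ → ℝ} (hD : BoundedBy G j D)
    (h1 : ∀ e < G.numEdges, inputWeight G enum e < 0 →
      D' ((inputNet G enum).hd e) ≤ D ((inputNet G enum).tl e) + inputWeight G enum e)
    (h2 : ∀ v < n, D'' v ≤ D' v)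
    (h3 : ∀ e < G.numEdges, 0 ≤ inputWeight G enum e →
      D'' ((inputNet G enum).hd e) ≤ D'' ((inputNet G enum).tl e) + inputWeight G enum e)
    (h0 : ∀ v < n, D'' v ≤ 0) : BoundedBy G (j + 1) D'' := by
  intro u v p hp
  refine hp.induction (P := fun v p => G.negEdges p < j + 1 → D'' v ≤ G.pathWeight p) ?_ ?_
  · intro _
    simpa [WDigraph.pathWeight] using h0 u u.2
  · intro q x v hq hx ih hn
    obtain ⟨e, he, g1, g2, g3⟩ := exists_edge enum hx
    rw [hq.negEdges_snoc] at hn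
    rw [hq.pathWeight_snoc]
    have h1 := h1 e he
    have h3 := h3 e he
    rw [g1, g2, g3] at h1 h3
    split_ifs at hn with hneg
    · have := hD u x q hq (by omega)
      have := h2 v v.2
      have := h1 hneg
      linarith
    · have := ih (by omega)
      have := h3 (not_lt.1 hneg)
      linarith

/-- After more than `n⁻` rounds there is a negative cycle if and only if some edge can still be
relaxed. -/
theorem hasNegativeCycle_iff {D : ℕ → ℝ} (ha : Attained G D)
    (hb : BoundedBy G (G.numNegTargets + 1) D) :
    G.HasNegativeCycle ↔ ∃ e < G.numEdges,
      D ((inputNet G enum).tl e) + inputWeight G enum e < D ((inputNet G enum).hd e) := by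
  constructor
  · rintro ⟨v, p, hp, hneg⟩
    by_contra! hcon
    have key := hp.induction (P := fun x p => D x ≤ D v + G.pathWeight p)
      (by simp [WDigraph.pathWeight]) (by
        intro q x y hq hx ih
        obtain ⟨e, he, g1, g2, g3⟩ := exists_edge enum hx
        have := hcon e he
        rw [g1, g2, g3] at this
        rw [hq.pathWeight_snoc]
        linarith)
    linarith
  · rintro ⟨e, he, hlt⟩
    by_contra hG
    obtain ⟨u, v, huv, g1, g2, g3⟩ := mem_edges enum he
    obtain ⟨y, p, hp, hpD⟩ := ha u
    obtain ⟨q, hq, hqn, hqw⟩ := WDigraph.exists_nodup_path hG (hp.snoc huv)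
    have := hb _ _ q hq (Nat.lt_succ_of_le (hq.negEdges_le hqn))
    rw [hp.pathWeight_snoc] at hqw
    rw [g1, g2, g3] at hlt
    linarith

/-- The reduced weights are nonnegative, and the reduced weight of a path differs from its weight by
an amount that depends only on its ends.  So a run of Dijkstra's algorithm from `s` with the reduced
weights finds shortest paths. -/
theorem solves_of_solved {φ D₀ D' : ℕ → ℝ} {lab₀ lab par : ℕ → ℕ} {s : Fin n} {W : ℕ → ℝ}
    (hD : D₀ s = 0) (hl : ∀ v < n, lab₀ v ≠ 0 ↔ v = s)
    (hW : ∀ e < G.numEdges, W e =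
      inputWeight G enum e + φ ((inputNet G enum).tl e) - φ ((inputNet G enum).hd e))
    (hnn : ∀ e < G.numEdges, 0 ≤ W e)
    (hs : Job.Solved ⟨inputNet G enum, W, D₀, lab₀⟩ D' lab par) (v : Fin n) :
    ((¬ ∃ p, G.IsPath s v p) → lab v = 0) ∧
    ((∃ p, G.IsPath s v p) → lab v = 1 ∧
      ∃ p, p.IsChain (fun x y : Fin n => par y = (x : ℕ)) ∧ G.IsShortestPath s v p ∧
        D' v + φ v - φ s = G.pathWeight p) := by
  have hsinit := hs.init s s.2 ((hl s s.2).2 rfl)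
  simp only [hD] at hsinit
  have hlow : ∀ {v : Fin n} {p : List (Fin n)}, G.IsPath s v p →
      lab v ≠ 0 ∧ D' v ≤ G.pathWeight p + φ s - φ v := by
    intro v p hp
    refine hp.induction (P := fun v p => lab v ≠ 0 ∧ D' v ≤ G.pathWeight p + φ s - φ v) ?_ ?_
    · simpa [WDigraph.pathWeight] using hsinit
    · intro q x v hq hx ih
      obtain ⟨e, he, g1, g2, g3⟩ := exists_edge enum hx
      have h1 := hs.closed e he
      have h2 := hW e he
      have h3 := hnn e he
      simp only [g1, g2, g3] at h1 h2
      obtain ⟨h4, h5⟩ := h1 ih.1 h3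
      refine ⟨h4, ?_⟩
      rw [hq.pathWeight_snoc]
      linarith [ih.2]
  have hgot : ∀ x, Got ⟨inputNet G enum, W, D₀, lab₀⟩ D' par (Finset.range n) x →
      ∀ v : Fin n, (v : ℕ) = x →
      ∃ p, p.IsChain (fun x y : Fin n => par y = (x : ℕ)) ∧ G.IsPath s v p ∧
        D' v + φ v - φ s = G.pathWeight p := by
    intro x hx
    induction hx with
    | init _ h1 h2 =>
      rintro v rfl
      have hvs : v = s := Fin.ext ((hl v v.2).1 h1)
      subst hvs
      refine ⟨[v], by simp, WDigraph.isPath_self v, ?_⟩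
      simp [WDigraph.pathWeight, h2, hD]
    | @step e he _ _ _ h1 h2 ih =>
      intro v hv
      obtain ⟨a, b, hab, g1, g2, g3⟩ := mem_edges enum he
      obtain rfl : v = b := Fin.ext (hv.trans g2)
      obtain ⟨p, hpc, hp, hpD⟩ := ih a g1.symm
      have h3 := hW e he
      simp only [g1, g2, g3] at h1 h2 h3
      refine ⟨_, ?_, hp.snoc hab, ?_⟩
      · rw [List.isChain_append]
        refine ⟨hpc, by simp, ?_⟩
        intro y hy z hz
        rw [hp.2.1] at hy
        simp only [Option.mem_def, Option.some.injEq, List.head?_cons] at hy hz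
        subst hy hz
        exact h2
      · rw [hp.pathWeight_snoc]
        linarith
  constructor
  · intro hno
    by_contra hlv
    obtain ⟨p, _, hp, _⟩ := hgot v (hs.got v v.2 hlv) v rfl
    exact hno ⟨p, hp⟩
  · rintro ⟨q, hq⟩
    have hlv := (hlow hq).1
    obtain ⟨p, hpc, hp, hpD⟩ := hgot v (hs.got v v.2 hlv) v rfl
    refine ⟨le_antisymm (hs.lab_le v v.2) (Nat.one_le_iff_ne_zero.2 hlv), p, hpc, ⟨hp, ?_⟩, hpD⟩
    intro r hr
    have := (hlow hr).2
    linarith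

end Potentials

/-! ### The loops of the algorithm -/

/-- The loop rule for a loop-free body: besides the invariant, all arrays that are not written keep
their contents. -/
theorem runs_countdown_exec {a c : ℕ} {k : NExp} {body : Program} (hb : body.loopFree = true)
    (ha : a ∉ body.natWrites) (hc : body.maxCost + 20 ≤ c) (Inv : ℕ → Memory → Prop) (σ₀ : Memory)
    (step : ∀ i σ, i < k.eval σ₀ → (∀ b, b ≠ a → b ∉ body.natWrites → σ.nat b = σ₀.nat b) →
      (∀ b, b ∉ body.realWrites → σ.real b = σ₀.real b) → σ.nat a 0 = i → Inv (i + 1) σ →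
      Inv i (body.exec σ))
    (hset : ∀ i j σ, Inv i σ → Inv i (σ.setNat a 0 j)) (h : Inv (k.eval σ₀) σ₀) :
    ∃ t τ, Runs (.countdown a k body) σ₀ t τ ∧
      t ≤ c * k.eval σ₀ + k.cost + 20 ∧ Inv 0 τ := by
  obtain ⟨t, τ, h1, h2, -, -, -, h3⟩ := runs_countdown (a := a) (k := k) (body := body)
    (fun i σ => i ≤ k.eval σ₀ ∧ (∀ b, b ≠ a → b ∉ body.natWrites → σ.nat b = σ₀.nat b) ∧
      (∀ b, b ∉ body.realWrites → σ.real b = σ₀.real b) ∧ Inv i σ) body.maxCost (by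
      rintro i σ ⟨h1, h2, h3, h4⟩ hi
      obtain ⟨t, ht, hr⟩ := body.runs_exec hb σ
      refine ⟨t, _, hr, ht, ⟨by omega, fun b hb hbw => ?_, fun b hb => ?_, step i σ h1 h2 h3 hi h4⟩,
        by rw [hr.nat_eq a ha, hi]⟩
      · rw [hr.nat_eq b hbw, h2 b hb hbw]
      · rw [hr.real_eq b hb, h3 b hb]) (by
      rintro i j σ ⟨h1, h2, h3, h4⟩
      refine ⟨h1, fun b hb hbw => ?_, h3, hset i j σ h4⟩
      rw [Memory.setNat_nat, if_neg hb, h2 b hb hbw]) σ₀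
    ⟨le_rfl, fun _ _ _ => rfl, fun _ _ => rfl, h⟩
  exact ⟨t, τ, h1, h2.trans (by gcongr), h3⟩

/-- Build the adjacency lists, make a working copy of the weights, and count, with the help of
marks, the vertices that have an incoming edge of negative weight. -/
def buildProg : Program := .countdown 21 (.read 0 (.lit 1)) (.block [
  .setNat 7 (.var 21) (.read 6 (.read 1 (.var 21))),
  .setNat 6 (.read 1 (.var 21)) (.succ (.var 21)),
  .setReal 2 (.var 21) (.read 0 (.var 21)),
  .ite (.and (.realLt (.read 0 (.var 21)) .zero) (.natEq (.read 8 (.read 2 (.var 21))) (.lit 0)))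
    (.block [.setNat 8 (.read 2 (.var 21)) (.lit 1), .assign 22 (.succ (.var 22))])
    .skip])

/-- Label all vertices. -/
def labelProg : Program := .countdown 21 (.var 0) (.setNat 4 (.var 21) (.lit 1))

/-- Relax the edges of negative weight. -/
def relaxNegProg : Program := .countdown 21 (.read 0 (.lit 1))
  (.ite (.and (.realLt (.read 2 (.var 21)) .zero)
      (.realLt (.add (.read 1 (.read 1 (.var 21))) (.read 2 (.var 21)))
        (.read 1 (.read 2 (.var 21)))))
    (.setReal 1 (.read 2 (.var 21)) (.add (.read 1 (.read 1 (.var 21))) (.read 2 (.var 21))))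
    .skip)

/-- Compute the reduced weights, and raise the flag if one of them is negative. -/
def reduceProg : Program := .countdown 21 (.read 0 (.lit 1)) (.block [
  .setReal 2 (.var 21) (.sub (.add (.read 0 (.var 21)) (.read 1 (.read 1 (.var 21))))
    (.read 1 (.read 2 (.var 21)))),
  .ite (.realLt (.read 2 (.var 21)) .zero) (.assign 3 (.lit 1)) .skip])

/-- Save the potential and remove all labels. -/
def resetProg : Program := .countdown 21 (.var 0)
  (.block [.setReal 4 (.var 21) (.read 1 (.var 21)), .setNat 4 (.var 21) (.lit 0)])

/-- Turn the distances for the reduced weights into distances for the given weights. -/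
def shiftProg : Program := .countdown 21 (.var 0)
  (.setReal 1 (.var 21) (.sub (.add (.read 1 (.var 21)) (.read 4 (.var 21)))
    (.read 4 (.read 0 (.lit 2)))))

section

variable {n : ℕ} {G : WDigraph n} (enum : Fin G.numEdges ≃ {e // e ∈ G.edges})

/-- The heads of the edges of negative weight among the edges `k, …, m - 1`. -/
noncomputable def negHeads (k : ℕ) : Finset ℕ :=
  open Classical in
  ((Finset.Ico k G.numEdges).filter (fun e => inputWeight G enum e < 0)).image (inputNet G enum).hd

theorem card_negHeads : (negHeads enum 0).card = G.numNegTargets := by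
  classical
  rw [WDigraph.numNegTargets, ← Set.ncard_coe_finset,
    ← Set.ncard_image_of_injective _ Fin.val_injective]
  congr 1
  ext x
  simp only [negHeads, Finset.coe_image, Set.mem_image, Finset.coe_filter, Finset.mem_Ico,
    Set.mem_ofPred_eq]
  constructor
  · rintro ⟨e, ⟨⟨_, he⟩, hneg⟩, rfl⟩
    obtain ⟨u, v, huv, _, h2, h3⟩ := mem_edges enum he
    exact ⟨v, ⟨u, huv, h3 ▸ hneg⟩, h2.symm⟩
  · rintro ⟨v, ⟨u, huv, hneg⟩, rfl⟩
    obtain ⟨e, he, _, h2, h3⟩ := exists_edge enum huv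
    exact ⟨e, ⟨⟨Nat.zero_le _, he⟩, h3 ▸ hneg⟩, h2⟩

theorem negHeads_of_lt {k : ℕ} (hk : k < G.numEdges) [Decidable (inputWeight G enum k < 0)] :
    negHeads enum k = if inputWeight G enum k < 0 then
      insert ((inputNet G enum).hd k) (negHeads enum (k + 1)) else negHeads enum (k + 1) := by
  classical
  rw [negHeads, ← Finset.insert_Ico_add_one_left_eq_Ico hk, Finset.filter_insert]
  split_ifs
  · rw [Finset.image_insert, negHeads]
  · rw [negHeads]

/-- The situation after the edges `k, …, m - 1` have been read.  As they are read in decreasing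
order and put in front, the adjacency lists are increasing. -/
structure BuildInv (k : ℕ) (σ : Memory) : Prop where
  adj : ∀ v, Seg (fun a => σ.nat 7 (a - 1)) (σ.nat 6 v)
    (((List.range' k (G.numEdges - k)).filter (fun e => (inputNet G enum).tl e = v)).map (· + 1))
  weight : ∀ e, σ.real 2 e = if k ≤ e then inputWeight G enum e else 0
  mark : ∀ v, σ.nat 8 v ≠ 0 ↔ v ∈ negHeads enum k
  count : σ.nat 22 0 = (negHeads enum k).card

theorem inputMemory_nat {s : Fin n} {a : ℕ} (ha : 2 < a) : (inputMemory G enum s).nat a = 0 := by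
  funext i
  simp [inputMemory, show a ≠ 0 by omega, show a ≠ 1 by omega, show a ≠ 2 by omega]

theorem inputMemory_real {s : Fin n} {a : ℕ} (ha : 0 < a) : (inputMemory G enum s).real a = 0 := by
  funext i
  simp [inputMemory, show a ≠ 0 by omega]

theorem runs_build (s : Fin n) :
    ∃ t τ, Runs buildProg (inputMemory G enum s) t τ ∧ t ≤ 100 * G.numEdges + 100 ∧
      BuildInv enum 0 τ := by
  have hm : NExp.eval (inputMemory G enum s) (.read 0 (.lit 1)) = G.numEdges := by
    simp [NExp.eval, inputMemory]
  obtain ⟨t, τ, h1, h2, h3⟩ := runs_countdown_exec (a := 21) (c := 100) (k := .read 0 (.lit 1))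
    (body := .block [
      .setNat 7 (.var 21) (.read 6 (.read 1 (.var 21))),
      .setNat 6 (.read 1 (.var 21)) (.succ (.var 21)),
      .setReal 2 (.var 21) (.read 0 (.var 21)),
      .ite (.and (.realLt (.read 0 (.var 21)) .zero)
          (.natEq (.read 8 (.read 2 (.var 21))) (.lit 0)))
        (.block [.setNat 8 (.read 2 (.var 21)) (.lit 1), .assign 22 (.succ (.var 22))])
        .skip]) (by decide) (by decide) (by decide) (BuildInv enum) (inputMemory G enum s) (by
      intro i σ hi hnat hreal hi0 hI
      rw [hm] at hi
      have htl : σ.nat 1 = (inputNet G enum).tl := by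
        rw [hnat 1 (by decide) (by decide)]; rfl
      have hhd : σ.nat 2 = (inputNet G enum).hd := by
        rw [hnat 2 (by decide) (by decide)]; rfl
      have hw : σ.real 0 = inputWeight G enum := by
        rw [hreal 0 (by decide)]; rfl
      obtain ⟨e1, e2, e3, e4⟩ := hI
      classical
      have hrange : List.range' i (G.numEdges - i) =
          i :: List.range' (i + 1) (G.numEdges - (i + 1)) := by
        rw [← List.range'_succ]; congr 1; omega
      constructor
      · intro v
        have hseg : Seg (fun a => Function.update (σ.nat 7) i
            (σ.nat 6 ((inputNet G enum).tl i)) (a - 1)) (σ.nat 6 v)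
            (((List.range' (i + 1) (G.numEdges - (i + 1))).filter
              (fun e => (inputNet G enum).tl e = v)).map (· + 1)) := by
          refine (e1 v).congr fun a ha => Function.update_of_ne ?_ _ _
          simp only [List.mem_map, List.mem_filter, List.mem_range'_1] at ha
          omega
        have h7 : ∀ f : ℕ → ℕ, f = Function.update (σ.nat 7) i (σ.nat 6 ((inputNet G enum).tl i)) →
          Seg (fun a => f (a - 1)) (if v = (inputNet G enum).tl i then i + 1 else σ.nat 6 v)
          (((List.range' i (G.numEdges - i)).filter
            (fun e => (inputNet G enum).tl e = v)).map (· + 1)) := by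
          rintro f rfl
          rw [hrange, List.filter_cons]
          by_cases hv : (inputNet G enum).tl i = v
          · simp only [hv, decide_true, if_true, List.map_cons]
            refine ⟨rfl, by omega, ?_⟩
            simpa [hv] using hseg
          · simp only [hv, decide_false, Ne.symm hv, if_false]
            exact hseg
        have := h7 _ rfl
        by_cases hc : inputWeight G enum i < 0 ∧ σ.nat 8 ((inputNet G enum).hd i) = 0 <;>
        simpa [Program.exec, Program.block, NExp.eval, RExp.eval, Test.Holds, Memory.setNat_nat,
          Memory.setReal_nat, Memory.setReal_real, Memory.setNat_real, hi0, htl, hhd, hw, hc,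
          Function.update_apply] using this
      · intro e
        have h2 : Function.update (σ.real 2) i (inputWeight G enum i) e =
            if i ≤ e then inputWeight G enum e else 0 := by
          rw [Function.update_apply, e2]
          split_ifs with g1 g2 g3 g3 <;> first | rfl | (subst g1; rfl) | omega
        by_cases hc : inputWeight G enum i < 0 ∧ σ.nat 8 ((inputNet G enum).hd i) = 0 <;>
        simpa [Program.exec, Program.block, NExp.eval, RExp.eval, Test.Holds, Memory.setNat_nat,
          Memory.setReal_nat, Memory.setReal_real, Memory.setNat_real, hi0, htl, hhd, hw, hc]
          using h2
      · intro v
        have h3 : (if inputWeight G enum i < 0 ∧ σ.nat 8 ((inputNet G enum).hd i) = 0 then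
            Function.update (σ.nat 8) ((inputNet G enum).hd i) 1 else σ.nat 8) v ≠ 0 ↔
            v ∈ negHeads enum i := by
          have h4 := e3 v
          rw [negHeads_of_lt enum hi]
          by_cases hc : inputWeight G enum i < 0
          · by_cases hv : v = (inputNet G enum).hd i
            · subst hv
              by_cases hc' : σ.nat 8 ((inputNet G enum).hd i) = 0 <;> simp [hc, hc']
            · split_ifs <;> simp [hv, ← h4]
          · simpa [hc] using h4
        by_cases hc : inputWeight G enum i < 0 ∧ σ.nat 8 ((inputNet G enum).hd i) = 0 <;>
        simpa [Program.exec, Program.block, NExp.eval, RExp.eval, Test.Holds, Memory.setNat_nat,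
          Memory.setReal_nat, Memory.setReal_real, Memory.setNat_real, hi0, htl, hhd, hw, hc]
          using h3
      · have h3 : (if inputWeight G enum i < 0 ∧ σ.nat 8 ((inputNet G enum).hd i) = 0 then
            σ.nat 22 0 + 1 else σ.nat 22 0) = (negHeads enum i).card := by
          have h4 := e3 ((inputNet G enum).hd i)
          rw [negHeads_of_lt enum hi, e4]
          by_cases hc : inputWeight G enum i < 0
          · by_cases hc' : σ.nat 8 ((inputNet G enum).hd i) = 0
            · rw [if_pos ⟨hc, hc'⟩, if_pos hc, Finset.card_insert_of_notMem]
              exact fun h5 => h4.2 h5 hc'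
            · rw [if_neg (by simp [hc']), if_pos hc, Finset.insert_eq_of_mem (h4.1 hc')]
          · simp [hc]
        by_cases hc : inputWeight G enum i < 0 ∧ σ.nat 8 ((inputNet G enum).hd i) = 0 <;>
        simpa [Program.exec, Program.block, NExp.eval, RExp.eval, Test.Holds, Memory.setNat_nat,
          Memory.setReal_nat, Memory.setReal_real, Memory.setNat_real, hi0, htl, hhd, hw, hc]
          using h3)
    (by
      rintro i j σ ⟨e1, e2, e3, e4⟩
      constructor <;> simpa [Memory.setNat_nat, Memory.setNat_real])
    (by
      rw [hm]
      constructor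
      · intro v; simp [inputMemory_nat, Seg]
      · intro e
        simp [inputMemory_real, inputWeight]
        omega
      · intro v; simp [inputMemory_nat, negHeads]
      · simp [inputMemory_nat, negHeads])
  refine ⟨t, τ, h1, ?_, h3⟩
  rw [hm] at h2
  simp only [NExp.cost] at h2
  omega

end

/-! ### The rounds -/

section

variable {n : ℕ} {G : WDigraph n} (enum : Fin G.numEdges ≃ {e // e ∈ G.edges})

/-- Edges are relaxed in place, so that some of them use values improved in the same pass; the bound
in terms of the values before the pass holds all the same. -/
theorem runs_relaxNeg {σ : Memory} (hN : NetRep σ (inputNet G enum))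
    (hW : σ.real 2 = inputWeight G enum) (hA : Attained G (σ.real 1)) :
    ∃ t τ, Runs relaxNegProg σ t τ ∧ t ≤ 100 * G.numEdges + 100 ∧ Attained G (τ.real 1) ∧
      (∀ v, τ.real 1 v ≤ σ.real 1 v) ∧ ∀ e < G.numEdges, inputWeight G enum e < 0 →
        τ.real 1 ((inputNet G enum).hd e) ≤
          σ.real 1 ((inputNet G enum).tl e) + inputWeight G enum e := by
  have hm : NExp.eval σ (.read 0 (.lit 1)) = G.numEdges := hN.m
  obtain ⟨t, τ, h1, h2, h3, h4, h5⟩ := runs_countdown_exec (a := 21) (c := 100)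
    (k := .read 0 (.lit 1))
    (body := .ite (.and (.realLt (.read 2 (.var 21)) .zero)
        (.realLt (.add (.read 1 (.read 1 (.var 21))) (.read 2 (.var 21)))
          (.read 1 (.read 2 (.var 21)))))
      (.setReal 1 (.read 2 (.var 21)) (.add (.read 1 (.read 1 (.var 21))) (.read 2 (.var 21))))
      .skip) (by decide) (by decide) (by decide)
    (fun k σ' => Attained G (σ'.real 1) ∧ (∀ v, σ'.real 1 v ≤ σ.real 1 v) ∧
      ∀ e, k ≤ e → e < G.numEdges → inputWeight G enum e < 0 →
        σ'.real 1 ((inputNet G enum).hd e) ≤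
          σ.real 1 ((inputNet G enum).tl e) + inputWeight G enum e) σ (by
      rintro i σ' hi hnat hreal hi0 ⟨g1, g2, g3⟩
      rw [hm] at hi
      have htl : σ'.nat 1 = (inputNet G enum).tl := by
        rw [hnat 1 (by decide) (by decide)]; exact hN.tl
      have hhd : σ'.nat 2 = (inputNet G enum).hd := by
        rw [hnat 2 (by decide) (by decide)]; exact hN.hd
      have hw : σ'.real 2 = inputWeight G enum := by
        rw [hreal 2 (by decide)]; exact hW
      have key : ∀ D : ℕ → ℝ, (D = if inputWeight G enum i < 0 ∧
          σ'.real 1 ((inputNet G enum).tl i) + inputWeight G enum i <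
            σ'.real 1 ((inputNet G enum).hd i) then
          Function.update (σ'.real 1) ((inputNet G enum).hd i)
            (σ'.real 1 ((inputNet G enum).tl i) + inputWeight G enum i) else σ'.real 1) →
          Attained G D ∧ (∀ v, D v ≤ σ.real 1 v) ∧
          ∀ e, i ≤ e → e < G.numEdges → inputWeight G enum e < 0 →
            D ((inputNet G enum).hd e) ≤
              σ.real 1 ((inputNet G enum).tl e) + inputWeight G enum e := by
        intro D hD
        have hle : ∀ v, D v ≤ σ'.real 1 v := by
          intro v
          rw [hD]
          split_ifs with hc
          · rw [Function.update_apply]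
            split_ifs with hv
            · rw [hv]; exact hc.2.le
            · exact le_rfl
          · exact le_rfl
        refine ⟨?_, fun v => (hle v).trans (g2 v), fun e he hem hneg => ?_⟩
        · rw [hD]
          split_ifs with hc
          · exact g1.update enum hi
          · exact g1
        · rcases he.eq_or_lt with rfl | he
          · have := g2 ((inputNet G enum).tl i)
            rw [hD]
            split_ifs with hc
            · rw [Function.update_self]; linarith
            · have h4 := not_lt.1 fun h4 => hc ⟨hneg, h4⟩
              linarith
          · exact (hle _).trans (g3 e he hem hneg)
      refine key _ ?_
      by_cases hc : inputWeight G enum i < 0 ∧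
          σ'.real 1 ((inputNet G enum).tl i) + inputWeight G enum i <
            σ'.real 1 ((inputNet G enum).hd i) <;>
      simp [Program.exec, NExp.eval, RExp.eval, Test.Holds, Memory.setReal_real, hi0, htl, hhd, hw,
        hc])
    (fun _ _ _ h => h)
    ⟨hA, fun _ => le_rfl, fun e he hem => by rw [hm] at he; omega⟩
  refine ⟨t, τ, h1, ?_, h3, h4, fun e he => h5 e (Nat.zero_le _) he⟩
  rw [hm] at h2
  simp only [NExp.cost] at h2
  omega

/-- The situation after `j` rounds. -/
structure Round (j : ℕ) (σ : Memory) : Prop where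
  net : NetRep σ (inputNet G enum)
  weight : σ.real 2 = inputWeight G enum
  attained : Attained G (σ.real 1)
  bounded : BoundedBy G j (σ.real 1)
  nonpos : ∀ v < n, σ.real 1 v ≤ 0
  label : ∀ v < n, σ.nat 4 v = 1
  heap : ∃ h, Rep σ h ∧ h.Clean

/-- The bound for the time of one round, up to a constant factor; see `runs_dijkstra`. -/
def roundBound (n m : ℕ) : ℕ := m + (n + 1) * rankBound (n + m)

theorem le_roundBound (n m : ℕ) : m + 2 * n + 2 ≤ roundBound n m := by
  have : (n + 1) * 2 ≤ (n + 1) * rankBound (n + m) :=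
    Nat.mul_le_mul_left _ (by simp [rankBound])
  simp only [roundBound]
  omega

theorem runs_round {j : ℕ} {σ : Memory} (hR : Round enum j σ) :
    ∃ t τ, Runs (.block [relaxNegProg, dijkstraProg]) σ t τ ∧
      t ≤ 3200 * roundBound n G.numEdges ∧ Round enum (j + 1) τ := by
  obtain ⟨t, τ, h1, h2, h3, h4, h5⟩ := runs_relaxNeg enum hR.net hR.weight hR.attained
  obtain ⟨h, hh, hc⟩ := hR.heap
  have hlab : ∀ v < n, τ.nat 4 v = 1 := by
    intro v hv
    rw [h1.nat_eq 4 (by decide), hR.label v hv]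
  have hW : τ.real 2 = inputWeight G enum := by rw [h1.real_eq 2 (by decide), hR.weight]
  have hN : NetRep τ (inputNet G enum) := hR.net.congr (h1.nat_eq_of_forall (by decide))
  obtain ⟨u, ρ, h', g1, g2, g3, g4, g5⟩ := runs_dijkstra
    (J := ⟨inputNet G enum, inputWeight G enum, τ.real 1, τ.nat 4⟩) (inputNet_ok enum)
    (fun v hv => (hlab v hv).le)
    (hh.congr (h1.nat_eq_of_forall (by decide)) (h1.real_eq 3 (by decide))) hc hN hW rfl rfl
  have hl : ∀ v < n, ρ.nat 4 v ≠ 0 ∧ ρ.real 1 v ≤ τ.real 1 v := fun v hv =>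
    g4.init v hv (by simp [hlab v hv])
  have h0 : ∀ v < n, ρ.real 1 v ≤ 0 := fun v hv =>
    ((hl v hv).2.trans (h4 v)).trans (hR.nonpos v hv)
  refine ⟨_, ρ, .seq h1 (.seq g1 (.skip _)), ?_, ?_⟩
  · have := le_roundBound n G.numEdges
    change u ≤ 3000 * roundBound n G.numEdges at g5
    omega
  · refine ⟨hN.congr (g1.nat_eq_of_forall (by decide)), by rw [g1.real_eq 2 (by decide), hW],
      h3.solved enum g4 fun v hv => (hl v hv).1, ?_, h0, ?_, h', g2, g3⟩
    · refine hR.bounded.succ enum h5 (fun v hv => (hl v hv).2) (fun e he hw => ?_) h0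
      exact (g4.closed e he (hl _ ((inputNet_ok enum).tl_lt e he)).1 hw).2
    · exact fun v hv => le_antisymm (g4.lab_le v hv) (Nat.one_le_iff_ne_zero.2 (hl v hv).1)

/-- One round more than there are vertices with an incoming edge of negative weight. -/
def roundsProg : Program :=
  .countdown 22 (.succ (.var 22)) (.block [relaxNegProg, dijkstraProg])

theorem runs_rounds {σ : Memory} (hR : Round enum 0 σ) (hc : σ.nat 22 0 = G.numNegTargets) :
    ∃ t τ, Runs roundsProg σ t τ ∧
      t ≤ 4000 * roundBound n G.numEdges * (G.numNegTargets + 1) ∧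
      Round enum (G.numNegTargets + 1) τ := by
  have hk : NExp.eval σ (.succ (.var 22)) = G.numNegTargets + 1 := by simp [NExp.eval, hc]
  obtain ⟨t, τ, h1, h2, i, h3, h4⟩ := runs_countdown (a := 22) (k := .succ (.var 22))
    (body := .block [relaxNegProg, dijkstraProg])
    (fun k σ' => ∃ i, i + k = G.numNegTargets + 1 ∧ Round enum i σ')
    (3200 * roundBound n G.numEdges) (by
      rintro k σ' ⟨i, hik, h⟩ hk
      obtain ⟨t, τ, h1, h2, h3⟩ := runs_round enum h
      exact ⟨t, τ, h1, h2, ⟨i + 1, by omega, h3⟩, by rw [h1.nat_eq 22 (by decide), hk]⟩) (by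
      rintro k j σ' ⟨i, hik, h⟩
      refine ⟨i, hik, h.net.congr fun a ha => ?_, h.weight, h.attained, h.bounded, h.nonpos, ?_, ?_⟩
      · rw [Memory.setNat_nat, if_neg]
        rintro rfl; revert ha; decide
      · intro v hv
        rw [Memory.setNat_nat, if_neg (by decide), h.label v hv]
      · obtain ⟨h', g1, g2⟩ := h.heap
        refine ⟨h', g1.congr (fun a ha => ?_) rfl, g2⟩
        rw [Memory.setNat_nat, if_neg]
        rintro rfl; revert ha; decide) σ ⟨0, by rw [hk]; omega, hR⟩
  obtain rfl : i = G.numNegTargets + 1 := h3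
  refine ⟨t, τ, h1, ?_, h4⟩
  rw [hk] at h2
  have := le_roundBound n G.numEdges
  simp only [NExp.cost] at h2
  nlinarith [Nat.mul_le_mul_right (G.numNegTargets + 1) this]

theorem runs_label {σ : Memory} (hn : σ.nat 0 0 = n) :
    ∃ t τ, Runs labelProg σ t τ ∧ t ≤ 100 * n + 100 ∧ ∀ v < n, τ.nat 4 v = 1 := by
  have hk : NExp.eval σ (.var 0) = n := hn
  obtain ⟨t, τ, h1, h2, h3⟩ := runs_countdown_exec (a := 21) (c := 100) (k := .var 0)
    (body := .setNat 4 (.var 21) (.lit 1)) (by decide) (by decide) (by decide)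
    (fun k σ' => ∀ v, k ≤ v → v < n → σ'.nat 4 v = 1) σ (by
      intro i σ' hi hnat hreal hi0 hI v hv hvn
      simp only [Program.exec, NExp.eval, Memory.setNat_nat, if_true, hi0, Function.update_apply]
      split_ifs with h
      · rfl
      · exact hI v (by omega) hvn)
    (by
      intro i j σ' hI
      simpa [Memory.setNat_nat] using hI) (by rw [hk]; intros; omega)
  refine ⟨t, τ, h1, ?_, fun v hv => h3 v (Nat.zero_le _) hv⟩
  rw [hk] at h2
  simp only [NExp.cost] at h2
  omega

/-- In the initial memory the heap is empty. -/
theorem exists_clean (σ : Memory) (h0 : ∀ a ∈ [9, 10, 11, 12, 13, 14, 15, 16, 17], σ.nat a = 0)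
    (h3 : σ.real 3 = 0) : ∃ h, Rep σ h ∧ h.Clean := by
  refine ⟨⟨0, 0, 0, 0, 0, 0, 0, fun _ => [], []⟩, ?_, ?_⟩
  · constructor
    · exact h0 9 (by decide)
    · exact h0 10 (by decide)
    · exact h0 11 (by decide)
    · exact h0 14 (by decide)
    · exact h3
    · rw [h0 16 (by decide)]; rfl
    · rw [h0 17 (by decide)]; rfl
    · rw [h0 15 (by decide)]; rfl
    · intro x; rw [h0 12 (by decide)]; rfl
    · rw [h0 13 (by decide)]; rfl
  · refine ⟨?_, ⟨fun _ => rfl, rfl⟩, rfl, fun _ => rfl⟩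
    constructor <;> simp [Heap.Full, Heap.Placed]
    · exact fun x hx h => hx h.symm
    · exact fun x hx h => absurd h.symm hx

theorem runs_potential (s : Fin n) :
    ∃ t τ, Runs (.seq buildProg (.seq labelProg roundsProg)) (inputMemory G enum s) t τ ∧
      t ≤ 5000 * roundBound n G.numEdges * (G.numNegTargets + 1) ∧
      Round enum (G.numNegTargets + 1) τ := by
  obtain ⟨t, τ, h1, h2, h3⟩ := runs_build enum s
  have hn : τ.nat 0 0 = n := by
    rw [h1.nat_eq 0 (by decide)]; simp [inputMemory]
  obtain ⟨u, ρ, g1, g2, g3⟩ := runs_label hn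
  have hreal : ρ.real 1 = 0 := by
    rw [g1.real_eq 1 (by decide), h1.real_eq 1 (by decide), inputMemory_real enum (by decide)]
  have hR : Round enum 0 ρ := by
    constructor
    case net =>
      refine NetRep.congr ?_ (g1.nat_eq_of_forall (by decide))
      constructor
      · exact hn
      · rw [h1.nat_eq 0 (by decide)]; simp [inputMemory, inputNet]
      · rw [h1.nat_eq 1 (by decide)]; rfl
      · rw [h1.nat_eq 2 (by decide)]; rfl
      · exact fun v _ => h3.adj v
    case weight =>
      rw [g1.real_eq 2 (by decide)]
      funext e
      rw [h3.weight, if_pos (Nat.zero_le _)]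
    case attained =>
      rw [hreal]
      exact fun v => ⟨v, [v], WDigraph.isPath_self v, by simp [WDigraph.pathWeight]⟩
    case bounded => exact fun u v p _ h => absurd h (Nat.not_lt_zero _)
    case nonpos => intro v _; simp [hreal]
    case label => exact g3
    case heap =>
      refine exists_clean ρ (fun a ha => ?_) ?_
      · rw [g1.nat_eq_of_forall (by decide) a ha, h1.nat_eq_of_forall (by decide) a ha,
          inputMemory_nat]
        revert a; decide
      · rw [g1.real_eq 3 (by decide), h1.real_eq 3 (by decide), inputMemory_real enum (by decide)]
  obtain ⟨w, π, f1, f2, f3⟩ := runs_rounds enum hR (by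
    rw [g1.nat_eq 22 (by decide), h3.count, card_negHeads])
  refine ⟨_, π, .seq h1 (.seq g1 f1), ?_, f3⟩
  have := le_roundBound n G.numEdges
  have e' : 1000 * roundBound n G.numEdges * 1 ≤
    1000 * roundBound n G.numEdges * (G.numNegTargets + 1) := Nat.mul_le_mul_left _ (by omega)
  have e : 5000 * roundBound n G.numEdges * (G.numNegTargets + 1) =
      4000 * roundBound n G.numEdges * (G.numNegTargets + 1) +
      1000 * roundBound n G.numEdges * (G.numNegTargets + 1) := by ring
  omega

end

/-! ### From the potential to the distances -/

section

variable {n : ℕ} {G : WDigraph n} (enum : Fin G.numEdges ≃ {e // e ∈ G.edges})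

/-- The reduced weights with respect to the potential `φ`. -/
noncomputable def reducedWeight (φ : ℕ → ℝ) (e : ℕ) : ℝ :=
  inputWeight G enum e + φ ((inputNet G enum).tl e) - φ ((inputNet G enum).hd e)

theorem runs_reduce {σ : Memory} (hN : NetRep σ (inputNet G enum))
    (hw : σ.real 0 = inputWeight G enum) (hf : σ.nat 3 0 = 0) :
    ∃ t τ, Runs reduceProg σ t τ ∧ t ≤ 100 * G.numEdges + 100 ∧
      (∀ e < G.numEdges, τ.real 2 e = reducedWeight enum (σ.real 1) e) ∧
      ((∃ e < G.numEdges, reducedWeight enum (σ.real 1) e < 0) → τ.nat 3 0 = 1) ∧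
      ((∀ e < G.numEdges, 0 ≤ reducedWeight enum (σ.real 1) e) → τ.nat 3 0 = 0) := by
  have hm : NExp.eval σ (.read 0 (.lit 1)) = G.numEdges := hN.m
  obtain ⟨t, τ, h1, h2, h3, h4, h5⟩ := runs_countdown_exec (a := 21) (c := 100)
    (k := .read 0 (.lit 1))
    (body := .block [
      .setReal 2 (.var 21) (.sub (.add (.read 0 (.var 21)) (.read 1 (.read 1 (.var 21))))
        (.read 1 (.read 2 (.var 21)))),
      .ite (.realLt (.read 2 (.var 21)) .zero) (.assign 3 (.lit 1)) .skip])
    (by decide) (by decide) (by decide)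
    (fun k σ' =>
      (∀ e, k ≤ e → e < G.numEdges → σ'.real 2 e = reducedWeight enum (σ.real 1) e) ∧
      ((∃ e, k ≤ e ∧ e < G.numEdges ∧ reducedWeight enum (σ.real 1) e < 0) → σ'.nat 3 0 = 1) ∧
      ((∀ e, k ≤ e → e < G.numEdges → 0 ≤ reducedWeight enum (σ.real 1) e) → σ'.nat 3 0 = 0)) σ (by
      rintro i σ' hi hnat hreal hi0 ⟨g1, g2, g3⟩
      rw [hm] at hi
      have htl : σ'.nat 1 = (inputNet G enum).tl := by
        rw [hnat 1 (by decide) (by decide)]; exact hN.tl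
      have hhd : σ'.nat 2 = (inputNet G enum).hd := by
        rw [hnat 2 (by decide) (by decide)]; exact hN.hd
      have hw' : σ'.real 0 = inputWeight G enum := by
        rw [hreal 0 (by decide)]; exact hw
      have hD : σ'.real 1 = σ.real 1 := hreal 1 (by decide)
      have key : ∀ (W : ℕ → ℝ) (f : ℕ),
          W = Function.update (σ'.real 2) i (reducedWeight enum (σ.real 1) i) →
          (f = if reducedWeight enum (σ.real 1) i < 0 then 1 else σ'.nat 3 0) →
          (∀ e, i ≤ e → e < G.numEdges → W e = reducedWeight enum (σ.real 1) e) ∧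
          ((∃ e, i ≤ e ∧ e < G.numEdges ∧ reducedWeight enum (σ.real 1) e < 0) → f = 1) ∧
          ((∀ e, i ≤ e → e < G.numEdges → 0 ≤ reducedWeight enum (σ.real 1) e) → f = 0) := by
        rintro W f rfl rfl
        refine ⟨fun e he hem => ?_, ?_, fun h => ?_⟩
        · rw [Function.update_apply]
          split_ifs with hei
          · rw [hei]
          · exact g1 e (by omega) hem
        · rintro ⟨e, he, hem, hneg⟩
          split_ifs with hc
          · rfl
          · rcases he.eq_or_lt with rfl | he
            · exact absurd hneg hc
            · exact g2 ⟨e, he, hem, hneg⟩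
        · rw [if_neg (not_lt.2 (h i le_rfl hi))]
          exact g3 fun e he => h e (by omega)
      refine key _ _ ?_ ?_ <;>
      by_cases hc : reducedWeight enum (σ.real 1) i < 0 <;>
      simp only [reducedWeight] at hc <;>
      simp [Program.exec, Program.block, NExp.eval, RExp.eval, Test.Holds, Memory.setReal_real,
        Memory.setNat_nat, Memory.setReal_nat, Memory.setNat_real, hi0, htl, hhd, hw', hD, hc,
        reducedWeight])
    (by
      rintro i j σ' ⟨g1, g2, g3⟩
      exact ⟨g1, by simpa [Memory.setNat_nat] using g2, by simpa [Memory.setNat_nat] using g3⟩)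
    (by
      rw [hm]
      refine ⟨fun e he hem => by omega, ?_, fun _ => hf⟩
      rintro ⟨e, he, hem, _⟩
      omega)
  refine ⟨t, τ, h1, ?_, fun e => h3 e (Nat.zero_le _), ?_, fun h => h5 fun e _ => h e⟩
  · rw [hm] at h2
    simp only [NExp.cost] at h2
    omega
  · rintro ⟨e, he, hneg⟩
    exact h4 ⟨e, Nat.zero_le _, he, hneg⟩

theorem runs_reset {σ : Memory} (hn : σ.nat 0 0 = n) :
    ∃ t τ, Runs resetProg σ t τ ∧ t ≤ 100 * n + 100 ∧
      ∀ v < n, τ.real 4 v = σ.real 1 v ∧ τ.nat 4 v = 0 := by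
  have hk : NExp.eval σ (.var 0) = n := hn
  obtain ⟨t, τ, h1, h2, h3⟩ := runs_countdown_exec (a := 21) (c := 100) (k := .var 0)
    (body := .block [.setReal 4 (.var 21) (.read 1 (.var 21)), .setNat 4 (.var 21) (.lit 0)])
    (by decide) (by decide) (by decide)
    (fun k σ' => ∀ v, k ≤ v → v < n → σ'.real 4 v = σ.real 1 v ∧ σ'.nat 4 v = 0) σ (by
      intro i σ' hi hnat hreal hi0 hI v hv hvn
      have hD : σ'.real 1 = σ.real 1 := hreal 1 (by decide)
      by_cases hvi : v = i
      · simp [Program.exec, Program.block, NExp.eval, RExp.eval, Memory.setNat_nat,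
          Memory.setReal_nat, Memory.setNat_real, Memory.setReal_real, hi0, hD, hvi]
      · have := hI v (by omega) hvn
        simpa [Program.exec, Program.block, NExp.eval, RExp.eval, Memory.setNat_nat,
          Memory.setReal_nat, Memory.setNat_real, Memory.setReal_real, hi0, hD, hvi] using this)
    (by
      intro i j σ' hI
      simpa [Memory.setNat_nat, Memory.setNat_real] using hI) (by rw [hk]; intros; omega)
  refine ⟨t, τ, h1, ?_, fun v hv => h3 v (Nat.zero_le _) hv⟩
  rw [hk] at h2
  simp only [NExp.cost] at h2
  omega

theorem runs_shift {σ : Memory} {s : Fin n} (hn : σ.nat 0 0 = n) (hs : σ.nat 0 2 = s) :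
    ∃ t τ, Runs shiftProg σ t τ ∧ t ≤ 100 * n + 100 ∧
      ∀ v < n, τ.real 1 v = σ.real 1 v + σ.real 4 v - σ.real 4 s := by
  have hk : NExp.eval σ (.var 0) = n := hn
  obtain ⟨t, τ, h1, h2, h3⟩ := runs_countdown_exec (a := 21) (c := 100) (k := .var 0)
    (body := .setReal 1 (.var 21) (.sub (.add (.read 1 (.var 21)) (.read 4 (.var 21)))
      (.read 4 (.read 0 (.lit 2)))))
    (by decide) (by decide) (by decide)
    (fun k σ' => ∀ v < n, σ'.real 1 v =
      if k ≤ v then σ.real 1 v + σ.real 4 v - σ.real 4 s else σ.real 1 v) σ (by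
      intro i σ' hi hnat hreal hi0 hI v hvn
      have hφ : σ'.real 4 = σ.real 4 := hreal 4 (by decide)
      have hs' : σ'.nat 0 2 = s := by rw [hnat 0 (by decide) (by decide), hs]
      have hv := hI v hvn
      by_cases hvi : v = i
      · subst hvi
        rw [if_neg (by omega)] at hv
        simp [Program.exec, NExp.eval, RExp.eval, Memory.setReal_real, hi0, hs', hφ, hv]
      · have h1 : i + 1 ≤ v ↔ i ≤ v := by omega
        rw [← ite_cond_congr (propext h1), ← hv]
        simp [Program.exec, NExp.eval, RExp.eval, Memory.setReal_real, hi0, hvi])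
    (fun _ _ _ h => h) (by
      intro v hv
      rw [hk, if_neg (by omega)])
  refine ⟨t, τ, h1, ?_, fun v hv => ?_⟩
  · rw [hk] at h2
    simp only [NExp.cost] at h2
    omega
  · rw [h3 v hv, if_pos (Nat.zero_le _)]

/-- The last part of the algorithm: from the potential computed by the rounds to the output. -/
def finishProg : Program := .block [
  reduceProg,
  resetProg,
  .setNat 4 (.read 0 (.lit 2)) (.lit 1),
  .setReal 1 (.read 0 (.lit 2)) .zero,
  dijkstraProg,
  shiftProg]

/-- If there is a negative cycle, the last run of Dijkstra's algorithm ignores the edges of negative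
reduced weight, and its outcome does not matter. -/
theorem runs_finish {s : Fin n} {σ : Memory} (hR : Round enum (G.numNegTargets + 1) σ)
    (hs : σ.nat 0 2 = s) (hw : σ.real 0 = inputWeight G enum) (hf : σ.nat 3 0 = 0) :
    ∃ t τ, Runs finishProg σ t τ ∧ t ≤ 4000 * roundBound n G.numEdges ∧ SolvesSSSP G s τ := by
  set φ := σ.real 1 with hφ
  obtain ⟨t₁, σ₁, a1, a2, a3, a4, a5⟩ := runs_reduce enum hR.net hw hf
  have hN₁ : NetRep σ₁ (inputNet G enum) := hR.net.congr (a1.nat_eq_of_forall (by decide))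
  obtain ⟨t₂, σ₂, b1, b2, b3⟩ := runs_reset (n := n) hN₁.n
  have hN₂ : NetRep σ₂ (inputNet G enum) := hN₁.congr (b1.nat_eq_of_forall (by decide))
  have hs₂ : σ₂.nat 0 2 = s := by rw [b1.nat_eq 0 (by decide), a1.nat_eq 0 (by decide), hs]
  set σ₃ := (σ₂.setNat 4 s 1).setReal 1 s 0 with hσ₃
  have hnat₃ : ∀ a, a ≠ 4 → σ₃.nat a = σ₂.nat a := by
    intro a ha
    rw [hσ₃, Memory.setReal_nat, Memory.setNat_nat, if_neg ha]
  have hreal₃ : ∀ a, a ≠ 1 → σ₃.real a = σ₂.real a := by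
    intro a ha
    rw [hσ₃, Memory.setReal_real, if_neg ha, Memory.setNat_real]
  have hlab : ∀ v < n, σ₃.nat 4 v = if v = s then 1 else 0 := by
    intro v hv
    rw [hσ₃, Memory.setReal_nat, Memory.setNat_nat, if_pos rfl, Function.update_apply,
      (b3 v hv).2]
  have hD₃ : σ₃.real 1 s = 0 := by
    rw [hσ₃, Memory.setReal_real, if_pos rfl, Function.update_self]
  obtain ⟨h, hh, hc⟩ := hR.heap
  have hh₃ : Rep σ₃ h := by
    refine hh.congr (fun a ha => ?_) ?_
    · rw [hnat₃ a (by rintro rfl; revert ha; decide), b1.nat_eq_of_forall (by decide) a ha,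
        a1.nat_eq_of_forall (by decide) a ha]
    · rw [hreal₃ 3 (by decide), b1.real_eq 3 (by decide), a1.real_eq 3 (by decide)]
  obtain ⟨t₄, σ₄, h', c1, -, -, c2, c3⟩ := runs_dijkstra
    (J := ⟨inputNet G enum, σ₃.real 2, σ₃.real 1, σ₃.nat 4⟩) (inputNet_ok enum)
    (fun v hv => by
      change σ₃.nat 4 v ≤ 1
      rw [hlab v hv]; split_ifs <;> decide)
    hh₃ hc (hN₂.congr fun a ha => hnat₃ a (by rintro rfl; revert ha; decide)) rfl rfl rfl
  have hN₄ : NetRep σ₄ (inputNet G enum) :=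
    (hN₂.congr fun a ha => hnat₃ a (by rintro rfl; revert ha; decide)).congr
      (c1.nat_eq_of_forall (by decide))
  have hs₄ : σ₄.nat 0 2 = s := by rw [c1.nat_eq 0 (by decide), hnat₃ 0 (by decide), hs₂]
  obtain ⟨t₅, σ₅, d1, d2, d3⟩ := runs_shift (n := n) hN₄.n hs₄
  have hφ₄ : ∀ v < n, σ₄.real 4 v = φ v := by
    intro v hv
    rw [c1.real_eq 4 (by decide), hreal₃ 4 (by decide), (b3 v hv).1, a1.real_eq 1 (by decide)]
  have hflag : σ₅.nat 3 0 = σ₁.nat 3 0 := by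
    rw [d1.nat_eq 3 (by decide), c1.nat_eq 3 (by decide), hnat₃ 3 (by decide),
      b1.nat_eq 3 (by decide)]
  have hiff : G.HasNegativeCycle ↔ ∃ e < G.numEdges, reducedWeight enum φ e < 0 := by
    rw [hasNegativeCycle_iff enum hR.attained hR.bounded]
    simp only [reducedWeight, sub_neg, ← hφ, add_comm (inputWeight G enum _)]
  refine ⟨_, σ₅, .seq a1 (.seq b1 (.seq (.setNat _ _ _ _) (.seq (.setReal _ _ _ _)
    (.seq (t := t₄) (τ := σ₄) ?_ (.seq d1 (.skip _)))))), ?_, ?_, ?_⟩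
  · convert c1 using 1
    simp [hσ₃, NExp.eval, RExp.eval, Memory.setNat_nat, hs₂]
  · have := le_roundBound n G.numEdges
    change t₄ ≤ 3000 * roundBound n G.numEdges at c3
    simp only [NExp.cost, RExp.cost]
    omega
  · intro hneg
    rw [Memory.negCycleFlag, hflag]
    exact a4 (hiff.1 hneg)
  · intro hno
    have hnn : ∀ e < G.numEdges, 0 ≤ reducedWeight enum φ e := fun e he =>
      not_lt.1 fun h => hno (hiff.2 ⟨e, he, h⟩)
    have hW : ∀ e < G.numEdges, σ₃.real 2 e = reducedWeight enum φ e := by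
      intro e he
      rw [hreal₃ 2 (by decide), b1.real_eq 2 (by decide), a3 e he]
    refine ⟨by rw [Memory.negCycleFlag, hflag]; exact a5 hnn, fun v => ?_⟩
    have key := solves_of_solved enum (φ := φ) (s := s) hD₃
      (fun v hv => by rw [hlab v hv]; simp) hW (fun e he => by rw [hW e he]; exact hnn e he) c2 v
    rw [← hφ₄ v v.2, ← hφ₄ s s.2, ← d3 v v.2, ← d1.nat_eq 4 (by decide),
      ← d1.nat_eq 5 (by decide)] at key
    exact key

end

/-! ### The running time -/

/-- A simple bound: as `m ≤ n²`, the logarithm of `n + m` is at most a constant times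
`1 + log n`. -/
theorem roundBound_le {n m : ℕ} (hn : 1 ≤ n) (hm : m ≤ n * n) :
    (roundBound n m : ℝ) ≤ 28 * (m + n * Real.log n + 1) := by
  have hn' : (1 : ℝ) ≤ n := by exact_mod_cast hn
  have hlog0 : 0 ≤ Real.log n := Real.log_nonneg hn'
  have h2 := Real.log_two_gt_d9
  have hlog : (Nat.log 2 (n + m) : ℝ) ≤ 1 + 3 * Real.log n := by
    refine (Real.natLog_le_logb _ _).trans ?_
    rw [Real.logb, div_le_iff₀ (by norm_num; linarith)]
    have h3 : Real.log ((n + m : ℕ) : ℝ) ≤ Real.log (2 * (n * n)) := by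
      refine Real.log_le_log (by positivity) ?_
      have : n + m ≤ 2 * (n * n) := by nlinarith
      exact_mod_cast this
    rw [Real.log_mul (by norm_num) (by positivity), Real.log_mul (by positivity) (by positivity)]
      at h3
    have h4 : ((2 : ℕ) : ℝ) = 2 := by norm_num
    rw [h4]
    nlinarith
  -- The term `1` in the bound is needed for `n = 1`, where the logarithm vanishes.
  have hle : (n : ℝ) ≤ 1 + 2 * (n * Real.log n) := by
    rcases hn.eq_or_lt with rfl | hn2
    · simp
    · have h3 : Real.log 2 ≤ Real.log n := Real.log_le_log (by norm_num) (by exact_mod_cast hn2)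
      nlinarith
  have hcast : (roundBound n m : ℝ) = m + (n + 1) * (2 * Nat.log 2 (n + m) + 2) := by
    simp [roundBound, rankBound]
  rw [hcast]
  have h5 : ((n : ℝ) + 1) * (2 * Nat.log 2 (n + m) + 2) ≤ (2 * n) * (4 + 6 * Real.log n) := by
    refine mul_le_mul (by linarith) (by linarith) (by positivity) (by positivity)
  have hm0 : (0 : ℝ) ≤ m := Nat.cast_nonneg m
  nlinarith

/-- The algorithm: preparation, rounds, and the run from the source. -/
def ssspProg : Program := .seq (.seq buildProg (.seq labelProg roundsProg)) finishProg

theorem runs_sssp {n : ℕ} {G : WDigraph n} (enum : Fin G.numEdges ≃ {e // e ∈ G.edges})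
    (s : Fin n) : ∃ t τ, Runs ssspProg (inputMemory G enum s) t τ ∧ SolvesSSSP G s τ ∧
      t ≤ 9000 * roundBound n G.numEdges * (G.numNegTargets + 1) := by
  obtain ⟨t, τ, h1, h2, h3⟩ := runs_potential enum s
  obtain ⟨u, ρ, g1, g2, g3⟩ := runs_finish enum (s := s) h3
    (by rw [h1.nat_eq 0 (by decide)]; simp [inputMemory])
    (by rw [h1.real_eq 0 (by decide)]; rfl)
    (by rw [h1.nat_eq 3 (by decide), inputMemory_nat enum (by decide)]; rfl)
  refine ⟨_, ρ, .seq h1 g1, g3, ?_⟩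
  nlinarith [Nat.zero_le (roundBound n G.numEdges * G.numNegTargets)]

theorem WDigraph.numEdges_le {n : ℕ} (G : WDigraph n) : G.numEdges ≤ n * n := by
  have := Finset.card_le_univ G.edges
  simpa [WDigraph.numEdges] using this

end SSSP

theorem mainTheorem4 :
    ∃ (P : SSSP.Program) (C : ℝ),
      ∀ (n : ℕ) (G : SSSP.WDigraph n) (enum : Fin G.numEdges ≃ {e // e ∈ G.edges}) (s : Fin n),
        ∃ (t : ℕ) (σ : SSSP.Memory),
          SSSP.Runs P (SSSP.inputMemory G enum s) t σ ∧
          SSSP.SolvesSSSP G s σ ∧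
          (t : ℝ) ≤ C * (max 1 G.numNegTargets : ℕ) *
            ((G.numEdges : ℝ) + (n : ℝ) * Real.log n + 1) := by
  -- The factor `2` is from `n⁻ + 1 ≤ 2 * max 1 n⁻`.
  refine ⟨SSSP.ssspProg, 9000 * 28 * 2, fun n G enum s => ?_⟩
  obtain ⟨t, σ, h1, h2, h3⟩ := SSSP.runs_sssp enum s
  refine ⟨t, σ, h1, h2, ?_⟩
  have hb := SSSP.roundBound_le s.pos G.numEdges_le
  have hk : G.numNegTargets + 1 ≤ 2 * max 1 G.numNegTargets := by omega
  calc (t : ℝ) ≤ 9000 * SSSP.roundBound n G.numEdges * (G.numNegTargets + 1 : ℕ) := by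
        exact_mod_cast h3
    _ ≤ 9000 * (28 * (G.numEdges + n * Real.log n + 1)) * (2 * max 1 G.numNegTargets : ℕ) := by
        gcongr
    _ = _ := by push_cast; ring
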